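/- Let $d\geqslant 1$, let $U\in\mathcal C^2(\mathbb R^d)$, and suppose that there are $L,m>0$ such that for all $x,y\in\mathbb R^d$ $$|\nabla U(x)-\nabla U(y)|\leqslant L|x-y|,\qquad (x-y)\cdot(\nabla U(x)-\nabla U(y))\geqslant m|x-y|^2 .$$ Let $\gamma\geqslant 2\sqrt L$ and $0<\delta\leqslant m/(33\gamma^3)$, and put $\eta=e^{-\delta\gamma/2}$. Let $\pi$ be the probability measure on $\mathbb R^{2d}$ with density proportional to $\exp(-U(x)-|v|^2/2)$, and let $P$ be the transition kernel of the OBABO chain on $\mathbb R^d\times\mathbb R^d$, whose transition $(x_0,v_0)\mapsto(x_1,v_1)$ is $$v_0'=\eta v_0+\sqrt{1-\eta^2}\,G,\quad v_{1/2}=v_0'-\tfrac\delta2\nabla U(x_0),\quad x_1=x_0+\delta v_{1/2},\quad v_1'=v_{1/2}-\tfrac\delta2\nabla U(x_1),\quad v_1=\eta v_1'+\sqrt{1-\eta^2}\,G',$$ with $G,G'$ independent standard Gaussian vectors of $\mathbb R^d$. For $p\geqslant 1$ real let $\mathcal P_p(\mathbb R^{2d})$ be the set of probability measures on $\mathbb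 R^{2d}$ with finite $p$-th moment, let $\mathcal W_p(\mu,\nu)=\inf\big(\mathbb E|X-Y|^p\big)^{1/p}$ with the Euclidean norm of $\mathbb R^{2d}$, and let $\|\mu-\nu\|_{TV}=\inf 2\,\mathbb P(X\neq Y)$, both infima being over all couplings $(X,Y)$ of $\mu$ and $\nu$. Define $$\kappa=\frac{m}{3\gamma},\qquad K_1=\sqrt3\max(L^{1/2},L^{-1/2}),\qquad K_2=\sqrt{\frac{\delta}{2\pi(1-\eta^2)}}\;\max\Big(2+\frac{3\delta^2L}2,\,3\delta\Big)$$ (in $K_2$, $\pi$ is the number), $$K_3=L\Big[1+e^{L\delta^2}\Big(\frac\delta6+\frac{\delta^2L}{24}\Big)\Big]\Big(1+\frac{\delta L}{2\sqrt m}\Big),\qquad K_4=L\Big(1+\frac\delta4+\frac{\delta^2L}4\Big)\Big(1+\frac{\delta L}{\sqrt m}+\frac{\delta^2L^2}{4m}\Big)+\frac{\delta L^2}{m}.$$ Then $P$ has a unique invariant probability measure $\pi_\delta$. Moreover $\pi,\pi_\delta\in\mathcal P_p(\mathbb R^{2d})$ for all real $p\geqslant1$, and $$\mathcal W_p(\pi,\pi_\delta)\;\leqslant\;\delta\,\sqrt{d+(p-2)_+}\;\frac{2K_1K_3}{\kappa}\qquad\text{for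 all real }p\geqslant 1,$$ $$\|\pi-\pi_\delta\|_{TV}\;\leqslant\;\delta\,d\,\big(2+|\ln(\delta^3d)|\big)\left(\frac{2K_1^2K_2K_3}{\kappa\sqrt{1-\delta\kappa}}+\frac{K_4}{\kappa}\right).$$ In addition, for fixed $L$ and $m$, $K_3\to L$ and $K_4\to L$ as $\delta\downarrow0$. -/

import Mathlib

open MeasureTheory ProbabilityTheory Filter Topology
open scoped ENNReal Gradient

noncomputable section

namespace OBABO

/-- `ℝᵈ` with its Euclidean structure. -/
abbrev E (d : ℕ) : Type := EuclideanSpace ℝ (Fin d)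

/-- Phase space `ℝᵈ × ℝᵈ` of pairs (position, velocity). Only its measurable structure and Lebesgue
measure are used; the Euclidean distance of `ℝ²ᵈ` is `phaseDist` (the `Prod` metric is a sup). -/
abbrev Phase (d : ℕ) : Type := E d × E d

/-- The Euclidean distance on `ℝᵈ × ℝᵈ = ℝ²ᵈ`. -/
def phaseDist {d : ℕ} (z z' : Phase d) : ℝ :=
  Real.sqrt (‖z.1 - z'.1‖ ^ 2 + ‖z.2 - z'.2‖ ^ 2)

/-! ### Wasserstein distances and total variation -/

/-- Transference plans (couplings) of `μ` and `ν`. -/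
def couplings {X : Type*} [MeasurableSpace X] (μ ν : Measure X) : Set (Measure (X × X)) :=
  {ζ | IsProbabilityMeasure ζ ∧ ζ.map Prod.fst = μ ∧ ζ.map Prod.snd = ν}

/-- The `L^p` Wasserstein distance associated with the cost `ρ`:
the infimum over couplings `ζ` of `‖ρ‖_{L^p(ζ)}`. -/
def wassersteinWith {X : Type*} [MeasurableSpace X] (ρ : X → X → ℝ) (p : ℝ) (μ ν : Measure X) :
    ℝ≥0∞ :=
  ⨅ ζ ∈ couplings μ ν, (∫⁻ w, ENNReal.ofReal (ρ w.1 w.2) ^ p ∂ζ) ^ (1 / p)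

/-- `W_p` on `ℝ²ᵈ` for the Euclidean distance. -/
def wasserstein {d : ℕ} (p : ℝ) (μ ν : Measure (Phase d)) : ℝ≥0∞ :=
  wassersteinWith phaseDist p μ ν

open Classical in
/-- Total variation norm `‖μ - ν‖_TV`, with the normalisation in which it takes values in `[0, 2]`:
the `W_1` distance of the cost `2 · 1_{x ≠ y}`, that is the infimum of `2 ℙ(X ≠ Y)` over couplings. -/
def tvNorm {X : Type*} [MeasurableSpace X] (μ ν : Measure X) : ℝ≥0∞ :=
  wassersteinWith (fun x y => if x = y then 0 else 2) 1 μ ν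

/-- `μ` belongs to `𝒫_p(ℝ²ᵈ)`: a probability measure with finite `p`-th moment. -/
def MemPp {d : ℕ} (p : ℝ) (μ : Measure (Phase d)) : Prop :=
  IsProbabilityMeasure μ ∧ ∫⁻ z, ENNReal.ofReal (phaseDist 0 z) ^ p ∂μ < ∞

/-! ### Assumptions on the potential -/

/-- `∇U` is `L`-Lipschitz. -/
def GradLip {d : ℕ} (U : E d → ℝ) (L : ℝ) : Prop :=
  ∀ x y, ‖∇ U x - ∇ U y‖ ≤ L * ‖x - y‖

/-- `U` is `m`-strongly convex (monotonicity of the gradient). -/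
def StrongConv {d : ℕ} (U : E d → ℝ) (m : ℝ) : Prop :=
  ∀ x y, m * ‖x - y‖ ^ 2 ≤ inner ℝ (x - y) (∇ U x - ∇ U y)

/-! ### The target measure and the OBABO chain -/

/-- The Hamiltonian `H(x, v) = U(x) + |v|² / 2`. -/
def hamiltonian {d : ℕ} (U : E d → ℝ) (z : Phase d) : ℝ := U z.1 + ‖z.2‖ ^ 2 / 2

/-- The Gibbs measure: density `exp (-H) / ∫ exp (-H)` with respect to Lebesgue measure. -/
def gibbs {d : ℕ} (U : E d → ℝ) : Measure (Phase d) :=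
  volume.tilted (fun z => -hamiltonian U z)

/-- `η = exp (-δγ/2)`. -/
def eta (δ γ : ℝ) : ℝ := Real.exp (-(δ * γ) / 2)

/-- The O step with noise `g`. -/
def stepO {d : ℕ} (δ γ : ℝ) (g : E d) (z : Phase d) : Phase d :=
  (z.1, eta δ γ • z.2 + Real.sqrt (1 - eta δ γ ^ 2) • g)

/-- The B step (half a time-step of force). -/
def stepB {d : ℕ} (U : E d → ℝ) (δ : ℝ) (z : Phase d) : Phase d :=
  (z.1, z.2 - (δ / 2) • ∇ U z.1)

/-- The A step (free transport). -/
def stepA {d : ℕ} (δ : ℝ) (z : Phase d) : Phase d := (z.1 + δ • z.2, z.2)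

/-- One OBABO transition from `z`, with noises `g` (first O step) and `g'` (last O step). -/
def obaboMap {d : ℕ} (U : E d → ℝ) (δ γ : ℝ) (z : Phase d) (g g' : E d) : Phase d :=
  stepO δ γ g' (stepB U δ (stepA δ (stepB U δ (stepO δ γ g z))))

/-- Transition kernel `P` of the OBABO chain: `P(z, ·)` is the law of `obaboMap U δ γ z G G'` for
independent standard Gaussian vectors `G`, `G'`. -/
def obaboKernel {d : ℕ} (U : E d → ℝ) (δ γ : ℝ) : Kernel (Phase d) (Phase d) :=
  (Kernel.id ×ₖ Kernel.const (Phase d) ((stdGaussian (E d)).prod (stdGaussian (E d)))).map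
    (fun w => obaboMap U δ γ w.1 w.2.1 w.2.2)

theorem measurable_obaboMap {d : ℕ} {U : E d → ℝ} (hU : ContDiff ℝ 2 U) (δ γ : ℝ) :
    Measurable (fun w : Phase d × (E d × E d) => obaboMap U δ γ w.1 w.2.1 w.2.2) := by
  have hg : Continuous (∇ U) :=
    (InnerProductSpace.toDual ℝ (E d)).symm.continuous.comp (hU.continuous_fderiv (by norm_num))
  apply Continuous.measurable
  unfold obaboMap stepO stepB stepA
  fun_prop

/-- The kernel is what its description says as soon as `U` is `C²`. -/
theorem obaboKernel_apply {d : ℕ} {U : E d → ℝ} (hU : ContDiff ℝ 2 U) (δ γ : ℝ) (z : Phase d) :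
    obaboKernel U δ γ z = ((stdGaussian (E d)).prod (stdGaussian (E d))).map
      (fun g => obaboMap U δ γ z g.1 g.2) := by
  have h := measurable_obaboMap hU δ γ
  rw [obaboKernel, Kernel.map_apply _ h, Kernel.prod_apply, Kernel.id_apply, Kernel.const_apply,
    Measure.dirac_prod, Measure.map_map h (by fun_prop)]
  rfl

/-! ### Constants -/

/-- Contraction rate `κ = m / (3γ)`. -/
def kappa (m γ : ℝ) : ℝ := m / (3 * γ)

/-- `K₁ = √3 max(L^{1/2}, L^{-1/2})`. -/
def K1 (L : ℝ) : ℝ := Real.sqrt 3 * max (Real.sqrt L) (Real.sqrt L)⁻¹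

/-- `K₂ = √(δ / (2π(1 - η²))) max(2 + 3δ²L/2, 3δ)`. -/
def K2 (L γ δ : ℝ) : ℝ :=
  Real.sqrt (δ / (2 * Real.pi * (1 - eta δ γ ^ 2))) * max (2 + 3 * δ ^ 2 * L / 2) (3 * δ)

/-- `K₃ = L [1 + e^{Lδ²}(δ/6 + δ²L/24)] (1 + δL/(2√m))`. -/
def K3 (L m δ : ℝ) : ℝ :=
  L * (1 + Real.exp (L * δ ^ 2) * (δ / 6 + δ ^ 2 * L / 24)) * (1 + δ * L / (2 * Real.sqrt m))

/-- `K₄ = L (1 + δ/4 + δ²L/4) (1 + δL/√m + δ²L²/(4m)) + δL²/m`. -/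
def K4 (L m δ : ℝ) : ℝ :=
  L * (1 + δ / 4 + δ ^ 2 * L / 4) * (1 + δ * L / Real.sqrt m + δ ^ 2 * L ^ 2 / (4 * m))
    + δ * L ^ 2 / m

end OBABO

end

/-!
The invariant measure `πδ` of the OBABO scheme is compared with the Gibbs measure `π` by two
mechanisms: the chain contracts when two copies are driven by the same noise, and one step of it is
close to a step that leaves `π` invariant.

*Contraction.* Put `‖z‖_γ² = |x|² + 2 x·v / γ + |v|² / L`, the squared norm `‖twist L γ z‖²`, which
is equivalent to the Euclidean one because `γ ≥ 2√L`. Two copies driven by the same noise get closer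
by the factor `ρ = √(1 - δκ)` in this norm at every step (`norm_twist_obaboMap_sub_le`). After
rescaling to `L = 1` the squared norm after one step is a quadratic expression in the differences of
the positions, of the velocities and of the forces before and after the drift. Friction supplies a
negative multiple of `|v|²`; since `∇U` is cocoercive (`cocoercive`) and strongly monotone, the
position-force products supply a negative multiple of the squared force and of `|x|²`. Together they
absorb all other terms when `δ ≤ m / (33 γ³)` (`contraction_scalar`). Composing the random maps
backwards gives an almost surely convergent sequence, whose limit law is the unique invariant
measure and has all moments (`exists_unique_invariant_of_contraction`).

*Wasserstein bias.* The two Gaussian steps preserve `π` (`map_stepO_gibbs`), and so does the exact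
Hamiltonian flow, which differs from the Verlet step by `O(δ²)`, with a constant that is linear in
`|v| + δ |∇U(x)| / 2` (`exists_hamiltonian_flow`, `IsHamiltonianArc.verlet_error`). Invariance of
`π` under the flow needs no differentiability in the initial condition: the flow conserves energy
and is a limit of compositions of shears, and Fatou's lemma passes volume preservation to the limit
(`map_gibbs_of_tendsto`). The moments `(E|x - x₀|^p)^{1/p} ≤ √((d + (p - 2)₊) / m)` around the
minimiser (`eLpNorm_tilted_le`) turn the local error into `δ² √(d + (p - 2)₊) K₃`. Running the
exact-flow chain from `π` and the scheme from `πδ` with common noise, the local errors add up to a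
geometric series (`exists_coupling_eLpNorm_le`), bounded by `1 / (1 - ρ) ≤ 2 / (δκ)`; the constants
of the equivalence of norms multiply to `K₁` (`equivalence_constants`).

*Total variation bias.* Let `f` be the indicator of an event. Then `π(f) - πδ(f)` is `π(f) -
π(P^{n+1} f)` plus `π(P^{n+1} f) - πδ(P^{n+1} f)`. The first part is at most `(n + 1) δ² L d / 2`: a
volume preserving map changes the `π`-probability of an event by no more than the mean energy
increase along its inverse (`abs_integral_comp_sub_gibbs_le`), and a convex potential makes the
energy increase of a Verlet step quadratic in `δ` (`hamiltonian_verlet_sub_le`). For the second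
part, changing the starting point of one step amounts to translating its two Gaussian vectors
(`obaboStep_eq_obaboStep_add`), so `P f` is Lipschitz with constant `O(1 / (δ √(1 - η²)))`
(`abs_average_sub_le`). The remaining `n` steps shrink this constant by `ρⁿ`, and the `W₁` bound
applies. The choice `n = ⌊|ln(δ³ d)| / (δκ)⌋` balances the two parts (`tvNorm_gibbs_le`). A bound
that is uniform over events becomes a bound over couplings by keeping the common part of the two
measures on the diagonal (`tvNorm_le`).
-/

open MeasureTheory ProbabilityTheory Filter Topology
open scoped ENNReal Gradient

noncomputable section

namespace OBABO

/-! ### Convexity and smoothness -/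

section Convex

variable {F : Type*} [NormedAddCommGroup F] [InnerProductSpace ℝ F] [CompleteSpace F]

/-- A gradient that is `c`-monotone (with `c` of any sign) gives the quadratic lower bound: `c = m`
is strong convexity, and `c = -L` for `-U` is the descent lemma. -/
theorem quadratic_lower_bound {U : F → ℝ} {g : F → F} (hg : ∀ x, HasGradientAt U (g x) x) {c : ℝ}
    (hc : ∀ x y, c * ‖x - y‖ ^ 2 ≤ inner ℝ (x - y) (g x - g y)) (x y : F) :
    U x + inner ℝ (g x) (y - x) + c / 2 * ‖y - x‖ ^ 2 ≤ U y := by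
  set w := y - x with hw
  let φ : ℝ → ℝ := fun t => U (x + t • w) - t * inner ℝ (g x) w - c / 2 * ‖w‖ ^ 2 * t ^ 2
  have hline : ∀ t : ℝ, HasDerivAt (fun t : ℝ => x + t • w) w t := fun t => by
    simpa using ((hasDerivAt_id t).smul_const w).const_add x
  have hφ : ∀ t, HasDerivAt φ
      (inner ℝ (g (x + t • w)) w - inner ℝ (g x) w - c * ‖w‖ ^ 2 * t) t := fun t => by
    have h1 : HasDerivAt (fun t : ℝ => U (x + t • w)) (inner ℝ (g (x + t • w)) w) t := by
      have := (hg (x + t • w)).hasFDerivAt.comp_hasDerivAt t (hline t)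
      simpa [Function.comp_def] using this
    have h2 := (h1.sub ((hasDerivAt_id t).mul_const (inner ℝ (g x) w))).sub
      ((hasDerivAt_pow 2 t).const_mul (c / 2 * ‖w‖ ^ 2))
    exact HasDerivAt.congr_deriv h2 (by norm_num; ring)
  have hmono : MonotoneOn φ (Set.Icc 0 1) := by
    refine monotoneOn_of_deriv_nonneg (convex_Icc 0 1)
      (fun t _ => (hφ t).continuousAt.continuousWithinAt)
      (fun t _ => (hφ t).differentiableAt.differentiableWithinAt) fun t ht => ?_
    rw [interior_Icc] at ht
    rw [(hφ t).deriv]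
    have h := hc (x + t • w) x
    rw [add_sub_cancel_left, norm_smul, inner_smul_left, inner_sub_right,
      real_inner_comm (g _) w, real_inner_comm (g x) w] at h
    simp only [conj_trivial, Real.norm_eq_abs, mul_pow, sq_abs] at h
    have : 0 ≤ t * (inner ℝ (g (x + t • w)) w - inner ℝ (g x) w - c * ‖w‖ ^ 2 * t) := by
      rw [real_inner_comm w, real_inner_comm w (g x)] at h ⊢
      nlinarith
    exact nonneg_of_mul_nonneg_right this ht.1
  have := hmono (Set.left_mem_Icc.2 zero_le_one) (Set.right_mem_Icc.2 zero_le_one) zero_le_one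
  simp only [φ, zero_smul, one_smul, add_zero, hw, add_sub_cancel] at this
  rw [hw]
  linarith

theorem quadratic_upper_bound {U : F → ℝ} {g : F → F} (hg : ∀ x, HasGradientAt U (g x) x) {L : ℝ}
    (hL : ∀ x y, ‖g x - g y‖ ≤ L * ‖x - y‖) (x y : F) :
    U y ≤ U x + inner ℝ (g x) (y - x) + L / 2 * ‖y - x‖ ^ 2 := by
  have hneg : ∀ x, HasGradientAt (fun z => -U z) (-g x) x := fun x => by
    rw [hasGradientAt_iff_hasFDerivAt, map_neg]
    exact (hg x).hasFDerivAt.neg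
  have h := quadratic_lower_bound hneg (c := -L) (fun x y => ?_) x y
  · rw [inner_neg_left] at h
    linarith
  · have h1 := abs_real_inner_le_norm (x - y) (-g x - -g y)
    have h2 : ‖-g x - -g y‖ = ‖g x - g y‖ := by rw [← norm_neg]; congr 1; abel
    rw [h2] at h1
    nlinarith [hL x y, neg_abs_le (inner ℝ (x - y) (-g x - -g y)), norm_nonneg (x - y)]

/-- Baillon–Haddad: the gradient of an `L`-smooth convex function is `1/L`-cocoercive. The proof
compares `U - ⟪g x, ·⟫`, which is minimal at `x`, with its value after one gradient step from
`y`. -/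
theorem cocoercive {U : F → ℝ} {g : F → F} (hg : ∀ x, HasGradientAt U (g x) x) {L : ℝ}
    (hL0 : 0 < L) (hL : ∀ x y, ‖g x - g y‖ ≤ L * ‖x - y‖)
    (hc : ∀ x y, 0 ≤ inner ℝ (x - y) (g x - g y)) (x y : F) :
    ‖g x - g y‖ ^ 2 ≤ L * inner ℝ (x - y) (g x - g y) := by
  have key : ∀ x y, U x + inner ℝ (g x) (y - x) + ‖g y - g x‖ ^ 2 / (2 * L) ≤ U y := by
    intro x y
    set w := g y - g x with hw
    set z := y - (1 / L) • w with hz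
    have h1 := quadratic_lower_bound hg (c := 0) (fun x y => by simpa using hc x y) x z
    have h2 := quadratic_upper_bound hg hL y z
    have e1 : z - x = (y - x) - (1 / L) • w := by rw [hz]; abel
    have e2 : z - y = -((1 / L) • w) := by rw [hz]; abel
    rw [e1, inner_sub_right, inner_smul_right] at h1
    rw [e2, inner_neg_right, inner_smul_right, norm_neg, norm_smul, mul_pow, Real.norm_eq_abs,
      sq_abs] at h2
    have h3 : inner ℝ (g y) w = inner ℝ (g x) w + ‖w‖ ^ 2 := by
      rw [← real_inner_self_eq_norm_sq, ← inner_add_left, hw, add_sub_cancel]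
    rw [h3] at h2
    have e3 : L / 2 * ((1 / L) ^ 2 * ‖w‖ ^ 2) = ‖w‖ ^ 2 / (2 * L) := by field_simp
    have e4 : 1 / L * (inner ℝ (g x) w + ‖w‖ ^ 2) = 1 / L * inner ℝ (g x) w
        + 2 * (‖w‖ ^ 2 / (2 * L)) := by field_simp
    rw [e3, e4] at h2
    linarith
  have h1 := key x y
  have h2 := key y x
  have e : inner ℝ (x - y) (g x - g y) = -inner ℝ (g x) (y - x) - inner ℝ (g y) (x - y) := by
    simp only [inner_sub_right, real_inner_comm (g x), real_inner_comm (g y)]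
    ring
  rw [norm_sub_rev] at h1
  have : 2 * (‖g x - g y‖ ^ 2 / (2 * L)) ≤ inner ℝ (x - y) (g x - g y) := by rw [e]; linarith
  have e5 : 2 * (‖g x - g y‖ ^ 2 / (2 * L)) = ‖g x - g y‖ ^ 2 / L := by field_simp
  rw [e5, div_le_iff₀ hL0] at this
  linarith

/-- The average of the tangent bounds at the two end points: the trapezoidal rule overestimates the
increment of a convex `L`-smooth function by at most `L/4` times the squared step. -/
theorem increment_le_trapezoid {U : F → ℝ} {g : F → F} (hg : ∀ x, HasGradientAt U (g x) x) {L : ℝ}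
    (hL : ∀ x y, ‖g x - g y‖ ≤ L * ‖x - y‖)
    (hc : ∀ x y, 0 ≤ inner ℝ (x - y) (g x - g y)) (x y : F) :
    U y - U x ≤ inner ℝ (g x + g y) (y - x) / 2 + L / 4 * ‖y - x‖ ^ 2 := by
  have h1 := quadratic_upper_bound hg hL x y
  have h2 := quadratic_lower_bound hg (c := 0) (fun x y => by simpa using hc x y) y x
  rw [inner_add_left]
  have e : inner ℝ (g y) (x - y) = -inner ℝ (g y) (y - x) := by
    rw [← inner_neg_right, neg_sub]
  rw [e] at h2
  linarith

end Convex

variable {d : ℕ} {U : E d → ℝ}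

theorem hasGradientAt_gradient (hU : ContDiff ℝ 2 U) (x : E d) : HasGradientAt U (∇ U x) x :=
  ((hU.differentiable (by norm_num)) x).hasGradientAt

theorem continuous_gradient (hU : ContDiff ℝ 2 U) : Continuous (∇ U) :=
  (InnerProductSpace.toDual ℝ (E d)).symm.continuous.comp (hU.continuous_fderiv (by norm_num))

theorem inner_gradient_sub_nonneg {m : ℝ} (hm : 0 < m) (hConv : StrongConv U m) (x y : E d) :
    0 ≤ inner ℝ (x - y) (∇ U x - ∇ U y) :=
  le_trans (by positivity) (hConv x y)

/-- Strong convexity makes `U` coercive, so it has a minimiser, at which the gradient vanishes. -/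
theorem exists_gradient_eq_zero (hU : ContDiff ℝ 2 U) {m : ℝ} (hm : 0 < m)
    (hConv : StrongConv U m) : ∃ x₀, ∇ U x₀ = 0 := by
  have hlow := fun y => quadratic_lower_bound (hasGradientAt_gradient hU) hConv 0 y
  have hlim : Tendsto U (cocompact (E d)) atTop := by
    have h1 : Tendsto (fun x : E d => ‖x‖) (cocompact (E d)) atTop :=
      tendsto_norm_cocompact_atTop
    have h2 : Tendsto (fun r : ℝ => U 0 + r * (m / 2 * r - ‖∇ U 0‖)) atTop atTop := by
      refine tendsto_atTop_add_const_left _ _ (tendsto_id.atTop_mul_atTop₀ ?_)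
      exact tendsto_atTop_add_const_right _ _ (tendsto_id.const_mul_atTop (by positivity))
    refine tendsto_atTop_mono (fun x => ?_) (h2.comp h1)
    have h := hlow x
    have h3 := abs_real_inner_le_norm (∇ U 0) x
    simp only [sub_zero] at h
    simp only [Function.comp_apply]
    nlinarith [neg_abs_le (inner ℝ (∇ U 0) x)]
  obtain ⟨x₀, hx₀⟩ := hU.continuous.exists_forall_le hlim
  refine ⟨x₀, ?_⟩
  have hmin : IsLocalMin U x₀ := Eventually.of_forall hx₀
  rw [gradient, hmin.fderiv_eq_zero, map_zero]

/-- In dimension `0` the two assumptions hold for all `m` and `L`, hence the hypothesis `1 ≤ d`. -/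
theorem strongConv_le_lip (hd : 1 ≤ d) {L m : ℝ} (hLip : GradLip U L) (hConv : StrongConv U m) :
    m ≤ L := by
  have : Nonempty (Fin d) := ⟨⟨0, hd⟩⟩
  obtain ⟨x, hx⟩ := exists_ne (0 : E d)
  have h1 := hLip x 0
  have h2 := hConv x 0
  have h3 := real_inner_le_norm (x - 0) (∇ U x - ∇ U 0)
  simp only [sub_zero] at h1 h2 h3
  have hx' : 0 < ‖x‖ := norm_pos_iff.2 hx
  have : m * ‖x‖ ^ 2 ≤ L * ‖x‖ ^ 2 := by nlinarith
  exact le_of_mul_le_mul_right this (by positivity)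

/-! ### Contraction of one step in units where `L = 1` -/

section Contraction

variable {F : Type*} [NormedAddCommGroup F] [InnerProductSpace ℝ F]

/-- The position-velocity term: to first order in `δ` the coefficient of `2 x·v / γ` is unchanged by
the step. Here and below `b = 1 / γ`. -/
theorem contraction_xv {γ b δ m η X V c : ℝ} (hb : b * γ = 1) (hb0 : 0 < b) (hm : 0 < m)
    (hδ : 0 < δ) (hγ0 : 0 < γ) (hτ : δ * γ ≤ m * b / 66)
    (hη1 : η ≤ 1) (hη : 1 - δ * γ / 2 ≤ η)
    (hη2 : 1 - δ * γ ≤ η ^ 2) (hη2' : η ^ 2 ≤ 1 - δ * γ + (δ * γ) ^ 2 / 2)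
    (hX : 0 ≤ X) (hV : 0 ≤ V) (hc : |c| ≤ X * V) :
    (2 * δ * η + 2 * b * η ^ 2 - 2 * b) * c ≤ δ * (m * b / 132) * (X ^ 2 + V ^ 2) := by
  have hD : |2 * δ * η + 2 * b * η ^ 2 - 2 * b| ≤ δ * (δ * γ) := by
    have e1 : b * (δ * γ) = δ := by linear_combination δ * hb
    have e2 : b * (δ * γ) ^ 2 = δ * (δ * γ) := by linear_combination δ ^ 2 * γ * hb
    rw [abs_le]
    constructor
    · have h1 := mul_le_mul_of_nonneg_left hη2 (by linarith : 0 ≤ 2 * b)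
      have h2 := mul_le_mul_of_nonneg_left hη (by linarith : 0 ≤ 2 * δ)
      linarith
    · have h1 := mul_le_mul_of_nonneg_left hη2' (by linarith : 0 ≤ 2 * b)
      have h2 := mul_le_mul_of_nonneg_left hη1 (by linarith : 0 ≤ 2 * δ)
      linarith
  have h1 : (2 * δ * η + 2 * b * η ^ 2 - 2 * b) * c ≤ δ * (δ * γ) * (X * V) := by
    refine (le_abs_self _).trans ?_
    rw [abs_mul]
    exact mul_le_mul hD hc (abs_nonneg _) (by positivity)
  have h3 : X * V ≤ (X ^ 2 + V ^ 2) / 2 := by linarith [two_mul_le_add_sq X V]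
  have h4 : δ * (δ * γ) * (X * V) ≤ δ * (m * b / 66) * ((X ^ 2 + V ^ 2) / 2) := by
    gcongr
  linarith

/-- The velocity-force terms, by Young's inequality `2 V G ≤ b G² + γ V²`. The bounds `q`, `q'` of
the squared forces are the position-force products of cocoercivity. -/
theorem contraction_vg {γ b δ η V G G' q q' s s' : ℝ} (hb : b * γ = 1) (hb0 : 0 < b)
    (hb2 : b ≤ 1 / 2) (hδ : 0 < δ) (hδ2 : 264 * δ ≤ 1)
    (hη0 : 0 < η) (hη1 : η ≤ 1) (hη2l : η ^ 2 ≤ 1) (hη3l : η ^ 3 ≤ 1)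
    (hs : |s| ≤ V * G) (hs' : |s'| ≤ V * G') (hGq : G ^ 2 ≤ q) (hGq' : G' ^ 2 ≤ q') :
    -((δ ^ 2 + 2 * b * η * δ + η ^ 2) * (η * δ)) * s - η ^ 3 * δ * s'
      ≤ δ * (1.005 * (b * (q + q') / 2 + γ * V ^ 2)) := by
  have hVG : 0 ≤ V * G := (abs_nonneg s).trans hs
  have hVG' : 0 ≤ V * G' := (abs_nonneg s').trans hs'
  have hD : δ ^ 2 + 2 * b * η * δ + η ^ 2 ≤ 1.005 := by
    have h1 : b * η * δ ≤ 1 / 2 * 1 * (1 / 264) := by gcongr; linarith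
    have h2 : δ * δ ≤ 1 / 264 * (1 / 264) := by gcongr <;> linarith
    linarith
  have h1 : -((δ ^ 2 + 2 * b * η * δ + η ^ 2) * (η * δ)) * s ≤ 1.005 * (1 * δ) * (V * G) := by
    refine (le_abs_self _).trans ?_
    rw [abs_mul, abs_neg, abs_of_nonneg (by positivity)]
    gcongr
  have h1' : -(η ^ 3 * δ) * s' ≤ 1 * δ * (V * G') := by
    refine (le_abs_self _).trans ?_
    rw [abs_mul, abs_neg, abs_of_nonneg (by positivity)]
    gcongr
  have h2 : ∀ G : ℝ, 2 * (V * G) ≤ b * G ^ 2 + γ * V ^ 2 := fun G => by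
    have : 0 ≤ b * (G - γ * V) ^ 2 := by positivity
    have e : b * (G - γ * V) ^ 2 = b * G ^ 2 - 2 * (V * G) + γ * V ^ 2 := by
      linear_combination (-2 * G * V + γ * V ^ 2) * hb
    linarith
  have h3 : b * G ^ 2 ≤ b * q := by gcongr
  have h3' : b * G' ^ 2 ≤ b * q' := by gcongr
  have h4 : δ * (1.005 * (V * G) + 1 * (V * G')) ≤
      δ * (1.005 * (b * (q + q') / 2 + γ * V ^ 2)) :=
    mul_le_mul_of_nonneg_left (by linarith [h2 G, h2 G']) hδ.le
  linarith

/-- The square of the velocity: friction lowers its coefficient by `2 δγ` to first order. -/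
theorem contraction_vv {γ b δ η V : ℝ} (hb0 : 0 < b) (hγb : 4 * b ≤ γ) (hγ : 2 ≤ γ)
    (hδ : 0 < δ) (hδ2 : 264 * δ ≤ 1) (hτ1 : 132 * (δ * γ) ≤ 1)
    (hη2l : η ^ 2 ≤ 1) (hη3l : η ^ 3 ≤ 1)
    (hη4 : η ^ 4 ≤ 1 - 2 * (δ * γ) + 2 * (δ * γ) ^ 2) :
    (η ^ 4 + 2 * b * δ * η ^ 3 + δ ^ 2 * η ^ 2) * V ^ 2 ≤ (1 - 1.48 * (δ * γ)) * V ^ 2 := by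
  refine mul_le_mul_of_nonneg_right ?_ (sq_nonneg V)
  have h1 : b * δ * η ^ 3 ≤ b * δ * 1 := by gcongr
  have h2 : δ ^ 2 * η ^ 2 ≤ δ ^ 2 * 1 := by gcongr
  have h3 : 4 * b * δ ≤ γ * δ := by gcongr
  have h4 : δ * γ * (δ * γ) ≤ δ * γ * (1 / 132) := by gcongr; linarith
  have h5 : δ * δ ≤ δ * (γ / 528) := by gcongr; linarith
  have h6 : 0 < δ * γ := by positivity
  linarith

/-- The position-force products, with coefficient `-bδ` to first order, dominate the squared forces,
whose coefficients are of order `δ²`. -/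
theorem contraction_xg {b δ η G G' p q q' : ℝ} (hb0 : 0 < b) (hb2 : b ≤ 1 / 2) (hδ : 0 < δ)
    (hδ2 : 264 * δ ≤ 1) (hδb : 132 * δ ≤ b) (hη0 : 0 < η) (hηl : 0.99 ≤ η) (hη1 : η ≤ 1)
    (hη2l : η ^ 2 ≤ 1) (hp : |p| ≤ G * G') (hGq : G ^ 2 ≤ q) (hGq' : G' ^ 2 ≤ q') :
    -(δ ^ 2 + b * η * δ) * q - b * η * δ * q'
        + (δ ^ 2 + 2 * b * η * δ + η ^ 2) * (δ ^ 2 / 4) * G ^ 2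
        + η ^ 2 * δ ^ 2 / 2 * p + η ^ 2 * δ ^ 2 / 4 * G' ^ 2
      ≤ -(0.98 * (b * δ)) * (q + q') := by
  have hq : 0 ≤ q := (sq_nonneg G).trans hGq
  have hq' : 0 ≤ q' := (sq_nonneg G').trans hGq'
  have hD : δ ^ 2 + 2 * b * η * δ + η ^ 2 ≤ 1.005 := by
    have h1 : b * η * δ ≤ 1 / 2 * 1 * (1 / 264) := by gcongr; linarith
    have h2 : δ * δ ≤ 1 / 264 * (1 / 264) := by gcongr <;> linarith
    linarith
  have h1 : (δ ^ 2 + 2 * b * η * δ + η ^ 2) * (δ ^ 2 / 4) * G ^ 2 ≤ 1.005 * (δ ^ 2 / 4) * q := by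
    gcongr
  have h2 : η ^ 2 * δ ^ 2 / 2 * p ≤ 1 * δ ^ 2 / 2 * ((q + q') / 2) := by
    have hp1 : |p| ≤ (q + q') / 2 := by linarith [two_mul_le_add_sq G G']
    calc η ^ 2 * δ ^ 2 / 2 * p ≤ η ^ 2 * δ ^ 2 / 2 * |p| := by gcongr; exact le_abs_self p
      _ ≤ _ := by gcongr
  have h3 : η ^ 2 * δ ^ 2 / 4 * G' ^ 2 ≤ 1 * δ ^ 2 / 4 * q' := by gcongr
  have h4 : b * δ * 0.99 * (q + q') ≤ b * δ * η * (q + q') := by gcongr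
  have h5 : δ * δ * q' ≤ b / 132 * δ * q' := by gcongr; linarith
  have h6 : 0 ≤ δ ^ 2 * q := by positivity
  have h7 : 0 ≤ b * δ * q := by positivity
  have h8 : 0 ≤ b * δ * q' := by positivity
  linarith

/-- Scalar core of `contraction_unit`: `X`, `V`, `G`, `G'` stand for the norms of the differences of
positions, velocities, and forces before and after the free transport, and the other letters for
their inner products. -/
theorem contraction_scalar {γ b δ m η X V G G' c p q q' s s' : ℝ} (hγ : 2 ≤ γ) (hb : b * γ = 1)
    (hm : 0 < m) (hm1 : m ≤ 1) (hδ : 0 < δ) (hδb : 33 * δ ≤ m * b ^ 3)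
    (hη1 : η ≤ 1) (hη : 1 - δ * γ / 2 ≤ η)
    (hη2 : 1 - δ * γ ≤ η ^ 2) (hη2' : η ^ 2 ≤ 1 - δ * γ + (δ * γ) ^ 2 / 2)
    (hη4 : η ^ 4 ≤ 1 - 2 * (δ * γ) + 2 * (δ * γ) ^ 2)
    (hX : 0 ≤ X) (hV : 0 ≤ V) (hc : |c| ≤ X * V) (hs : |s| ≤ V * G) (hs' : |s'| ≤ V * G')
    (hp : |p| ≤ G * G') (hGq : G ^ 2 ≤ q) (hGq' : G' ^ 2 ≤ q') (hXq : m * X ^ 2 ≤ q)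
    (hXq' : m * (0.99 * X ^ 2 - 0.01 * V ^ 2) ≤ q') :
    X ^ 2 + (2 * δ * η + 2 * b * η ^ 2) * c - (δ ^ 2 + b * η * δ) * q - b * η * δ * q'
      + (δ ^ 2 + 2 * b * η * δ + η ^ 2) * (η ^ 2 * V ^ 2 - η * δ * s + δ ^ 2 / 4 * G ^ 2)
      - η ^ 3 * δ * s' + η ^ 2 * δ ^ 2 / 2 * p + η ^ 2 * δ ^ 2 / 4 * G' ^ 2
    ≤ (1 - δ * (m * b / 3)) * (X ^ 2 + 2 * b * c + V ^ 2) := by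
  have hγ0 : 0 < γ := by linarith
  have hb0 : 0 < b := pos_of_mul_pos_left (by rw [hb]; exact one_pos) hγ0.le
  have hb2 : b ≤ 1 / 2 := by nlinarith only [hb, hγ, hb0]
  have hγb : 4 * b ≤ γ := by linarith
  have hb22 : b ^ 2 ≤ b / 2 := by nlinarith only [hb2, hb0]
  have hb3 : b ^ 3 ≤ b / 4 := by nlinarith only [hb22, hb0, hb2]
  have hδ1 : 132 * δ ≤ m * b := by
    have := mul_le_mul_of_nonneg_left hb3 hm.le
    linarith
  have hmb1 : m * b ≤ b := mul_le_of_le_one_left hb0.le hm1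
  have hδ2 : 264 * δ ≤ 1 := by linarith
  -- the product `δ γ` is small because `b γ = 1`
  have hτb : 33 * (δ * γ) ≤ m * b ^ 2 := by
    have := mul_le_mul_of_nonneg_right hδb hγ0.le
    have e : m * b ^ 3 * γ = m * b ^ 2 := by linear_combination m * b ^ 2 * hb
    linarith
  have hτ2 : δ * γ ≤ m * b / 66 := by
    have := mul_le_mul_of_nonneg_left hb22 hm.le
    linarith
  have hτ1 : 132 * (δ * γ) ≤ 1 := by linarith
  have hη0 : 0 < η := by linarith
  have hη2l : η ^ 2 ≤ 1 := pow_le_one₀ hη0.le hη1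
  have hη3l : η ^ 3 ≤ 1 := pow_le_one₀ hη0.le hη1
  have hV2 : 0 ≤ V ^ 2 := sq_nonneg V
  have hmb : 0 < m * b := by positivity
  have t1 := contraction_xv hb hb0 hm hδ hγ0 hτ2 hη1 hη hη2 hη2' hX hV hc
  have t2 := contraction_vg hb hb0 hb2 hδ hδ2 hη0 hη1 hη2l hη3l hs hs' hGq hGq'
  have t3 := contraction_vv (V := V) hb0 hγb hγ hδ hδ2 hτ1 hη2l hη3l hη4
  have t4 := contraction_xg hb0 hb2 hδ hδ2 (by linarith) hη0 (by linarith) hη1 hη2l hp hGq hGq'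
  have t6 : δ * (m * b / 3) * (X ^ 2 + 2 * b * c + V ^ 2) ≤ δ * (m * b / 2 * (X ^ 2 + V ^ 2)) := by
    have h1 : 2 * b * c ≤ (X ^ 2 + V ^ 2) / 2 := by
      have : b * c ≤ 1 / 2 * (X * V) :=
        (le_abs_self _).trans (by rw [abs_mul, abs_of_pos hb0]; gcongr)
      linarith [two_mul_le_add_sq X V]
    have h2 : δ * (m * b / 3) * (X ^ 2 + 2 * b * c + V ^ 2)
        ≤ δ * (m * b / 3) * (X ^ 2 + (X ^ 2 + V ^ 2) / 2 + V ^ 2) := by gcongr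
    linarith
  have hbq : b * (m * (1.99 * X ^ 2 - 0.01 * V ^ 2)) ≤ b * (q + q') :=
    mul_le_mul_of_nonneg_left (by linarith) hb0.le
  have hmbX : 0 ≤ m * b * X ^ 2 := by positivity
  have hmbV : m * b * V ^ 2 ≤ γ / 4 * V ^ 2 := by gcongr; linarith
  have hγV : 0 ≤ γ * V ^ 2 := by positivity
  -- the net gains are `0.4775 = 0.98 - 1.005/2` for `b (q + q')` and `0.475 = 1.48 - 1.005` for
  -- `γ V²`; they pay for the losses `1/132` of the cross term and `1/2` of the contraction rate
  have fin : 0 ≤ δ * (0.4775 * (b * (q + q')) - (m * b) * X ^ 2 * (1 / 132 + 1 / 2)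
      + (0.475 * γ * V ^ 2 - m * b * V ^ 2 * (1 / 132 + 1 / 2))) :=
    mul_nonneg hδ.le (by linarith)
  linarith

/-- One step of the scheme with the same noise, in units where `L = 1`. Here `g` and `g'` are the
force differences at the old and the new positions; they are only tied to the respective position
differences, since the Hessian may vary along the step. -/
theorem contraction_unit {γ δ m : ℝ} (hγ : 2 ≤ γ) (hm : 0 < m) (hm1 : m ≤ 1) (hδ : 0 < δ)
    (hδγ : δ ≤ m / (33 * γ ^ 3)) {x v g g' u x' : F} (hu : u = eta δ γ • v - (δ / 2) • g)
    (hx' : x' = x + δ • u) (hco : ‖g‖ ^ 2 ≤ inner ℝ x g) (hmono : m * ‖x‖ ^ 2 ≤ inner ℝ x g)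
    (hco' : ‖g'‖ ^ 2 ≤ inner ℝ x' g') (hmono' : m * ‖x'‖ ^ 2 ≤ inner ℝ x' g') :
    ‖x'‖ ^ 2 + 2 / γ * inner ℝ x' (eta δ γ • (u - (δ / 2) • g'))
      + ‖eta δ γ • (u - (δ / 2) • g')‖ ^ 2
    ≤ (1 - δ * (m / (3 * γ))) * (‖x‖ ^ 2 + 2 / γ * inner ℝ x v + ‖v‖ ^ 2) := by
  have hγ0 : 0 < γ := by linarith
  set b := 1 / γ with hbdef
  have hb : b * γ = 1 := by rw [hbdef]; field_simp
  have hb0 : 0 < b := by positivity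
  have hb2 : b ≤ 1 / 2 := by nlinarith only [hb, hγ, hb0]
  have hδb : 33 * δ ≤ m * b ^ 3 := by
    have : m / (33 * γ ^ 3) = m * b ^ 3 / 33 := by rw [hbdef]; field_simp
    linarith
  have hb22 : b ^ 2 ≤ b / 2 := by nlinarith only [hb2, hb0]
  have hb3 : b ^ 3 ≤ b / 4 := by nlinarith only [hb22, hb0, hb2]
  have hδ2 : 264 * δ ≤ 1 := by
    have := mul_le_mul hm1 hb3 (by positivity) zero_le_one
    linarith
  set η := eta δ γ with hη
  have hτ0 : 0 < δ * γ := by positivity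
  have hη0 : 0 < η := Real.exp_pos _
  have hη1 : η ≤ 1 := Real.exp_le_one_iff.2 (by linarith)
  have hηl : 1 - δ * γ / 2 ≤ η := by
    have := Real.add_one_le_exp (-(δ * γ) / 2)
    rw [hη, eta]; linarith
  have e2 : η ^ 2 = Real.exp (-(δ * γ)) := by
    rw [hη, eta, ← Real.exp_nat_mul]; congr 1; push_cast; ring
  have e4 : η ^ 4 = Real.exp (-(2 * (δ * γ))) := by
    rw [hη, eta, ← Real.exp_nat_mul]; congr 1; push_cast; ring
  have hexp : ∀ t : ℝ, 0 ≤ t → Real.exp (-t) ≤ 1 - t + t ^ 2 / 2 := fun t ht => by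
    have h := Real.quadratic_le_exp_of_nonneg ht
    rw [Real.exp_neg, inv_le_iff_one_le_mul₀ (Real.exp_pos _)]
    have : 0 ≤ 1 - t + t ^ 2 / 2 := by nlinarith [sq_nonneg (t - 1)]
    have := mul_le_mul_of_nonneg_left h this
    nlinarith only [this, sq_nonneg (t ^ 2)]
  have hη2 : 1 - δ * γ ≤ η ^ 2 := by
    rw [e2]; linarith [Real.add_one_le_exp (-(δ * γ))]
  have hη2' : η ^ 2 ≤ 1 - δ * γ + (δ * γ) ^ 2 / 2 := by
    rw [e2]; exact hexp _ hτ0.le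
  have hη4 : η ^ 4 ≤ 1 - 2 * (δ * γ) + 2 * (δ * γ) ^ 2 := by
    rw [e4]; have := hexp (2 * (δ * γ)) (by positivity); linarith
  have hX := norm_nonneg x
  have hV := norm_nonneg v
  have hGX : ‖g‖ ≤ ‖x‖ := by
    have := real_inner_le_norm x g
    by_contra! h
    nlinarith only [this, h, hco, norm_nonneg g, norm_nonneg x]
  have hun : ‖u‖ ≤ ‖v‖ + 1 / 528 * ‖x‖ := by
    rw [hu]
    refine (norm_sub_le _ _).trans ?_
    rw [norm_smul, norm_smul, Real.norm_of_nonneg hη0.le, Real.norm_of_nonneg (by positivity)]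
    have h1 := mul_le_of_le_one_left hV hη1
    have h2 : δ / 2 * ‖g‖ ≤ 1 / 528 * ‖x‖ :=
      mul_le_mul (by linarith) hGX (norm_nonneg _) (by norm_num)
    linarith
  have hx'n : 0.99 * ‖x‖ ^ 2 - 0.01 * ‖v‖ ^ 2 ≤ ‖x'‖ ^ 2 := by
    have h1 : -(‖x‖ * ‖u‖) ≤ inner ℝ x u :=
      (neg_le_neg (abs_real_inner_le_norm x u)).trans (neg_abs_le _)
    have h2 : δ * (‖x‖ * ‖u‖) ≤ 1 / 264 * (‖x‖ * (‖v‖ + 1 / 528 * ‖x‖)) := by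
      gcongr; linarith
    rw [hx', norm_add_sq_real, inner_smul_right]
    have h3 := mul_le_mul_of_nonneg_left h1 hδ.le
    nlinarith only [h2, h3, two_mul_le_add_sq ‖x‖ ‖v‖, sq_nonneg ‖δ • u‖, sq_nonneg ‖x‖,
      sq_nonneg ‖v‖]
  have hexpand : ‖x'‖ ^ 2 + 2 / γ * inner ℝ x' (η • (u - (δ / 2) • g'))
      + ‖η • (u - (δ / 2) • g')‖ ^ 2 =
      ‖x‖ ^ 2 + (2 * δ * η + 2 * b * η ^ 2) * inner ℝ x v - (δ ^ 2 + b * η * δ) * inner ℝ x g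
      - b * η * δ * inner ℝ x' g'
      + (δ ^ 2 + 2 * b * η * δ + η ^ 2) *
        (η ^ 2 * ‖v‖ ^ 2 - η * δ * inner ℝ v g + δ ^ 2 / 4 * ‖g‖ ^ 2)
      - η ^ 3 * δ * inner ℝ v g' + η ^ 2 * δ ^ 2 / 2 * inner ℝ g g'
      + η ^ 2 * δ ^ 2 / 4 * ‖g'‖ ^ 2 := by
    have hγb : (2 : ℝ) / γ = 2 * b := by rw [hbdef]; ring
    rw [hγb, hx', hu]
    simp only [← real_inner_self_eq_norm_sq, inner_add_left, inner_add_right, inner_sub_left,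
      inner_sub_right, real_inner_smul_left, real_inner_smul_right, real_inner_comm x v,
      real_inner_comm x g, real_inner_comm v g, real_inner_comm v g', real_inner_comm g g']
    ring
  rw [hexpand]
  have hγb : (2 : ℝ) / γ = 2 * b := by rw [hbdef]; ring
  have hγb' : m / (3 * γ) = m * b / 3 := by rw [hbdef]; field_simp
  rw [hγb, hγb']
  exact contraction_scalar hγ hb hm hm1 hδ hδb hη1 hηl hη2 hη2' hη4 hX hV
    (abs_real_inner_le_norm x v) (abs_real_inner_le_norm v g) (abs_real_inner_le_norm v g')
    (abs_real_inner_le_norm g g') hco hco' hmono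
    ((mul_le_mul_of_nonneg_left hx'n hm.le).trans hmono')

end Contraction

/-! ### The twisted norm -/

/-- The linear change of variables `(x, v) ↦ (x + v / γ, √(1/L - 1/γ²) v)` into `ℝ²ᵈ` with its
Euclidean norm. The norm `‖twist L γ z‖`, whose square is `|x|² + 2 x·v / γ + |v|² / L`, is the
one that the synchronous coupling contracts. -/
def twist {d : ℕ} (L γ : ℝ) : Phase d →L[ℝ] WithLp 2 (E d × E d) :=
  (WithLp.prodContinuousLinearEquiv 2 ℝ (E d) (E d)).symm.toContinuousLinearMap.comp
    ((ContinuousLinearMap.fst ℝ (E d) (E d) + γ⁻¹ • ContinuousLinearMap.snd ℝ (E d) (E d)).prod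
      (Real.sqrt (L⁻¹ - γ⁻¹ ^ 2) • ContinuousLinearMap.snd ℝ (E d) (E d)))

section Twist

variable {d : ℕ} {L γ : ℝ}

theorem sq_le_of_two_sqrt_le (hL : 0 < L) (hγ : 2 * Real.sqrt L ≤ γ) : 4 * L ≤ γ ^ 2 := by
  have := pow_le_pow_left₀ (by positivity) hγ 2
  rwa [mul_pow, Real.sq_sqrt hL.le, show (2 : ℝ) ^ 2 = 4 by norm_num] at this

theorem pos_of_two_sqrt_le (hL : 0 < L) (hγ : 2 * Real.sqrt L ≤ γ) : 0 < γ :=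
  lt_of_lt_of_le (by have := Real.sqrt_pos.2 hL; positivity) hγ

theorem inv_sq_le (hL : 0 < L) (hγ : 2 * Real.sqrt L ≤ γ) : 4 * γ⁻¹ ^ 2 ≤ L⁻¹ := by
  have hγ0 := pos_of_two_sqrt_le hL hγ
  have := sq_le_of_two_sqrt_le hL hγ
  rw [inv_pow, ← div_eq_mul_inv, div_le_iff₀ (by positivity), ← div_eq_inv_mul, le_div_iff₀ hL]
  linarith

theorem norm_twist_sq (hL : 0 < L) (hγ : 2 * Real.sqrt L ≤ γ) (z : Phase d) :
    ‖twist L γ z‖ ^ 2 = ‖z.1‖ ^ 2 + 2 / γ * inner ℝ z.1 z.2 + ‖z.2‖ ^ 2 / L := by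
  have h : 0 ≤ L⁻¹ - γ⁻¹ ^ 2 := by have := inv_sq_le hL hγ; nlinarith [sq_nonneg γ⁻¹]
  rw [WithLp.prod_norm_sq_eq_of_L2]
  change ‖z.1 + γ⁻¹ • z.2‖ ^ 2 + ‖Real.sqrt (L⁻¹ - γ⁻¹ ^ 2) • z.2‖ ^ 2 = _
  rw [norm_add_sq_real, norm_smul, norm_smul, mul_pow, mul_pow, inner_smul_right,
    Real.norm_eq_abs, Real.norm_eq_abs, sq_abs, sq_abs, Real.sq_sqrt h]
  ring

theorem le_norm_twist_sq (hL : 0 < L) (hγ : 2 * Real.sqrt L ≤ γ) (z : Phase d) :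
    (‖z.1‖ ^ 2 + ‖z.2‖ ^ 2 / L) / 2 ≤ ‖twist L γ z‖ ^ 2 ∧
      ‖twist L γ z‖ ^ 2 ≤ 3 / 2 * (‖z.1‖ ^ 2 + ‖z.2‖ ^ 2 / L) := by
  have hγ0 := pos_of_two_sqrt_le hL hγ
  have h := abs_real_inner_le_norm z.1 z.2
  have h1 : 2 * (‖z.1‖ * (γ⁻¹ * ‖z.2‖)) ≤ ‖z.1‖ ^ 2 / 2 + 2 * (γ⁻¹ * ‖z.2‖) ^ 2 := by
    nlinarith [sq_nonneg (‖z.1‖ - 2 * (γ⁻¹ * ‖z.2‖))]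
  have h2 := mul_le_mul_of_nonneg_right (inv_sq_le hL hγ) (sq_nonneg ‖z.2‖)
  have h3 : |2 / γ * inner ℝ z.1 z.2| ≤ (‖z.1‖ ^ 2 + ‖z.2‖ ^ 2 / L) / 2 := by
    rw [abs_mul, abs_of_pos (by positivity)]
    calc 2 / γ * |inner ℝ z.1 z.2| ≤ 2 / γ * (‖z.1‖ * ‖z.2‖) := by gcongr
      _ = 2 * (‖z.1‖ * (γ⁻¹ * ‖z.2‖)) := by ring
      _ ≤ ‖z.1‖ ^ 2 / 2 + 2 * (γ⁻¹ * ‖z.2‖) ^ 2 := h1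
      _ ≤ _ := by rw [mul_pow]; rw [← div_eq_inv_mul] at h2; linarith
  rw [norm_twist_sq hL hγ]
  rw [abs_le] at h3
  constructor <;> linarith [h3.1, h3.2]

theorem phaseDist_eq (z z' : Phase d) :
    phaseDist z z' = Real.sqrt (‖(z - z').1‖ ^ 2 + ‖(z - z').2‖ ^ 2) := rfl

theorem norm_fst_le_norm_twist (hL : 0 < L) (hγ : 2 * Real.sqrt L ≤ γ) (z : Phase d) :
    ‖z.1‖ ≤ Real.sqrt 2 * ‖twist L γ z‖ := by
  refine abs_le_of_sq_le_sq' ?_ (by positivity) |>.2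
  rw [mul_pow, Real.sq_sqrt zero_le_two]
  have := (le_norm_twist_sq hL hγ z).1
  have h : 0 ≤ ‖z.2‖ ^ 2 / L := by positivity
  linarith

theorem norm_snd_le_norm_twist (hL : 0 < L) (hγ : 2 * Real.sqrt L ≤ γ) (z : Phase d) :
    ‖z.2‖ ≤ Real.sqrt L * (Real.sqrt 2 * ‖twist L γ z‖) := by
  refine abs_le_of_sq_le_sq' ?_ (by positivity) |>.2
  rw [mul_pow, mul_pow, Real.sq_sqrt zero_le_two, Real.sq_sqrt hL.le]
  have := (le_norm_twist_sq hL hγ z).1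
  have h : ‖z.2‖ ^ 2 / L ≤ 2 * ‖twist L γ z‖ ^ 2 := by nlinarith [sq_nonneg ‖z.1‖]
  rw [div_le_iff₀ hL] at h
  linarith

theorem phaseDist_le_norm_twist (hL : 0 < L) (hγ : 2 * Real.sqrt L ≤ γ) (z z' : Phase d) :
    phaseDist z z' ≤ Real.sqrt 2 * max 1 (Real.sqrt L) * ‖twist L γ (z - z')‖ := by
  rw [phaseDist_eq]
  refine Real.sqrt_le_iff.2 ⟨by positivity, ?_⟩
  set w := z - z'
  rw [mul_pow, mul_pow, Real.sq_sqrt zero_le_two]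
  have h := (le_norm_twist_sq hL hγ w).1
  have h1 : 1 ≤ max 1 (Real.sqrt L) ^ 2 := one_le_pow₀ (le_max_left _ _)
  have h2 : L ≤ max 1 (Real.sqrt L) ^ 2 := by
    rw [← Real.sq_sqrt hL.le]
    exact pow_le_pow_left₀ (Real.sqrt_nonneg _)
      (by rw [Real.sq_sqrt hL.le]; exact le_max_right _ _) 2
  have h3 : ‖w.2‖ ^ 2 ≤ max 1 (Real.sqrt L) ^ 2 * (‖w.2‖ ^ 2 / L) := by
    calc ‖w.2‖ ^ 2 = L * (‖w.2‖ ^ 2 / L) := by field_simp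
      _ ≤ _ := by gcongr
  have h4 := mul_le_mul_of_nonneg_right h1 (sq_nonneg ‖w.1‖)
  nlinarith

theorem norm_twist_le_phaseDist (hL : 0 < L) (hγ : 2 * Real.sqrt L ≤ γ) (z z' : Phase d) :
    ‖twist L γ (z - z')‖ ≤ Real.sqrt (3 / 2) * max 1 (Real.sqrt L)⁻¹ * phaseDist z z' := by
  rw [phaseDist_eq]
  set w := z - z'
  refine abs_le_of_sq_le_sq' ?_ (by positivity) |>.2
  rw [mul_pow, mul_pow, Real.sq_sqrt (by norm_num), Real.sq_sqrt (by positivity)]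
  have h := (le_norm_twist_sq hL hγ w).2
  have h1 : 1 ≤ max 1 (Real.sqrt L)⁻¹ ^ 2 := one_le_pow₀ (le_max_left _ _)
  have h2 : L⁻¹ ≤ max 1 (Real.sqrt L)⁻¹ ^ 2 := by
    rw [← Real.sq_sqrt hL.le, ← inv_pow]
    exact pow_le_pow_left₀ (by positivity) (by rw [Real.sq_sqrt hL.le]; exact le_max_right _ _) 2
  have h3 : ‖w.2‖ ^ 2 / L ≤ max 1 (Real.sqrt L)⁻¹ ^ 2 * ‖w.2‖ ^ 2 := by
    rw [div_eq_inv_mul]; gcongr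
  have h4 := mul_le_mul_of_nonneg_right h1 (sq_nonneg ‖w.1‖)
  nlinarith

/-- The product of the constants of `phaseDist_le_norm_twist` and `norm_twist_le_phaseDist`. -/
theorem equivalence_constants (hL : 0 < L) :
    Real.sqrt 2 * max 1 (Real.sqrt L) * (Real.sqrt (3 / 2) * max 1 (Real.sqrt L)⁻¹) = K1 L := by
  have h1 : Real.sqrt 2 * Real.sqrt (3 / 2) = Real.sqrt 3 := by
    rw [← Real.sqrt_mul zero_le_two]; norm_num
  have h2 : max 1 (Real.sqrt L) * max 1 (Real.sqrt L)⁻¹ = max (Real.sqrt L) (Real.sqrt L)⁻¹ := by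
    have hs := Real.sqrt_pos.2 hL
    rcases le_total 1 (Real.sqrt L) with h | h
    · have h' : (Real.sqrt L)⁻¹ ≤ 1 := inv_le_one_of_one_le₀ h
      rw [max_eq_right h, max_eq_left h', max_eq_left (h'.trans h), mul_one]
    · have h' : 1 ≤ (Real.sqrt L)⁻¹ := (one_le_inv₀ hs).2 h
      rw [max_eq_left h, max_eq_right h', max_eq_right (h.trans h'), one_mul]
  rw [K1, ← h1, ← h2]
  ring

end Twist

/-! ### Consequences of the step-size restriction -/

section StepSize

variable {L m γ δ : ℝ}

/-- The step-size restriction in dimensionless form: `γ ≥ 2√L` makes it imply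
`δ √L ≤ (m / L) / 264`. -/
theorem step_mul_sqrt_le (hL : 0 < L) (hm : 0 < m) (hγ : 2 * Real.sqrt L ≤ γ)
    (hδγ : δ ≤ m / (33 * γ ^ 3)) : 264 * (δ * Real.sqrt L) ≤ m / L := by
  have hs := Real.sqrt_pos.2 hL
  have h1 : m / (33 * γ ^ 3) ≤ m / (33 * (2 * Real.sqrt L) ^ 3) := by gcongr
  have h2 : (2 * Real.sqrt L) ^ 3 = 8 * (L * Real.sqrt L) := by
    rw [mul_pow, pow_succ (Real.sqrt L), Real.sq_sqrt hL.le]; ring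
  have h3 := hδγ.trans h1
  rw [h2, le_div_iff₀ (by positivity)] at h3
  rw [le_div_iff₀ hL]
  linarith

theorem step_sq_mul_lip_le (hL : 0 < L) (hm : 0 < m) (hmL : m ≤ L) (hγ : 2 * Real.sqrt L ≤ γ)
    (hδ : 0 < δ) (hδγ : δ ≤ m / (33 * γ ^ 3)) : δ ^ 2 * L ≤ 1 / 69696 := by
  have h := step_mul_sqrt_le hL hm hγ hδγ
  have h1 : δ * Real.sqrt L ≤ 1 / 264 := by
    have : m / L ≤ 1 := (div_le_one hL).2 hmL
    linarith
  have h2 := pow_le_pow_left₀ (by positivity) h1 2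
  rw [mul_pow, Real.sq_sqrt hL.le] at h2
  linarith

/-- `δ L ≤ √m / 264`. -/
theorem step_mul_lip_le (hL : 0 < L) (hm : 0 < m) (hmL : m ≤ L) (hγ : 2 * Real.sqrt L ≤ γ)
    (hδγ : δ ≤ m / (33 * γ ^ 3)) : δ * L / Real.sqrt m ≤ 1 / 264 := by
  have h := step_mul_sqrt_le hL hm hγ hδγ
  have hs := Real.sqrt_pos.2 hL
  have hsm := Real.sqrt_pos.2 hm
  have hss : Real.sqrt m ≤ Real.sqrt L := Real.sqrt_le_sqrt hmL
  rw [le_div_iff₀ hL] at h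
  rw [div_le_iff₀ hsm]
  have e : δ * Real.sqrt L * L = δ * L * Real.sqrt L := by ring
  have h1 : 264 * (δ * L) * Real.sqrt L ≤ Real.sqrt m * Real.sqrt L := by
    calc 264 * (δ * L) * Real.sqrt L ≤ m := by linarith
      _ = Real.sqrt m * Real.sqrt m := (Real.mul_self_sqrt hm.le).symm
      _ ≤ _ := by gcongr
  have := le_of_mul_le_mul_right h1 hs
  linarith

theorem kappa_pos (hm : 0 < m) (hγ : 0 < γ) : 0 < kappa m γ := by
  unfold kappa; positivity

theorem step_mul_kappa_le (hL : 0 < L) (hm : 0 < m) (hmL : m ≤ L) (hγ : 2 * Real.sqrt L ≤ γ)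
    (hδγ : δ ≤ m / (33 * γ ^ 3)) : δ * kappa m γ ≤ 1 / 2 := by
  have hγ0 := pos_of_two_sqrt_le hL hγ
  have h4 := sq_le_of_two_sqrt_le hL hγ
  have h1 : δ * kappa m γ ≤ m / (33 * γ ^ 3) * kappa m γ :=
    mul_le_mul_of_nonneg_right hδγ (kappa_pos hm hγ0).le
  refine h1.trans ?_
  rw [kappa, div_mul_div_comm, div_le_iff₀ (by positivity)]
  have h5 : m * m ≤ γ ^ 2 / 4 * (γ ^ 2 / 4) :=
    mul_le_mul (by linarith) (by linarith) hm.le (by positivity)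
  nlinarith [sq_nonneg (γ ^ 2)]

end StepSize

/-! ### Contraction of the twisted norm -/

/-- Contraction factor of one step in the twisted norm. -/
def rho (m γ δ : ℝ) : ℝ := Real.sqrt (1 - δ * kappa m γ)

section Contraction

variable {d : ℕ} {U : E d → ℝ} {L m γ δ : ℝ}

theorem rho_nonneg : 0 ≤ rho m γ δ := Real.sqrt_nonneg _

theorem rho_sq (hL : 0 < L) (hm : 0 < m) (hmL : m ≤ L) (hγ : 2 * Real.sqrt L ≤ γ)
    (hδγ : δ ≤ m / (33 * γ ^ 3)) : rho m γ δ ^ 2 = 1 - δ * kappa m γ :=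
  Real.sq_sqrt (by linarith [step_mul_kappa_le hL hm hmL hγ hδγ])

theorem rho_lt_one (hm : 0 < m) (hγ : 0 < γ) (hδ : 0 < δ) : rho m γ δ < 1 := by
  have : 0 < δ * kappa m γ := mul_pos hδ (kappa_pos hm hγ)
  rw [rho, Real.sqrt_lt' one_pos]
  linarith

/-- `1 - ρ ≥ δκ/2`. -/
theorem half_step_mul_kappa_le (hL : 0 < L) (hm : 0 < m) (hmL : m ≤ L)
    (hγ : 2 * Real.sqrt L ≤ γ) (hδγ : δ ≤ m / (33 * γ ^ 3)) :
    δ * kappa m γ / 2 ≤ 1 - rho m γ δ := by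
  have h := rho_sq hL hm hmL hγ hδγ
  nlinarith [sq_nonneg (rho m γ δ - 1)]

theorem obaboMap_sub (U : E d → ℝ) (δ γ : ℝ) (z z' : Phase d) (g g' : E d) :
    obaboMap U δ γ z g g' - obaboMap U δ γ z' g g' =
      ((z.1 - z'.1) + δ • (eta δ γ • (z.2 - z'.2) - (δ / 2) • (∇ U z.1 - ∇ U z'.1)),
        eta δ γ • (eta δ γ • (z.2 - z'.2) - (δ / 2) • (∇ U z.1 - ∇ U z'.1)
          - (δ / 2) • (∇ U (obaboMap U δ γ z g g').1 - ∇ U (obaboMap U δ γ z' g g').1))) := by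
  simp only [obaboMap, stepO, stepB, stepA, Prod.mk_sub_mk]
  ext1
  · module
  · module

/-- Two copies of the chain driven by the same noise get closer by the factor `ρ` in the twisted
norm, whatever the noise. -/
theorem norm_twist_obaboMap_sub_le (hU : ContDiff ℝ 2 U) (hL : 0 < L) (hm : 0 < m) (hmL : m ≤ L)
    (hLip : GradLip U L) (hConv : StrongConv U m) (hγ : 2 * Real.sqrt L ≤ γ) (hδ : 0 < δ)
    (hδγ : δ ≤ m / (33 * γ ^ 3)) (z z' : Phase d) (g g' : E d) :
    ‖twist L γ (obaboMap U δ γ z g g' - obaboMap U δ γ z' g g')‖ ≤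
      rho m γ δ * ‖twist L γ (z - z')‖ := by
  have hs := Real.sqrt_pos.2 hL
  have hss := Real.mul_self_sqrt hL.le
  have hγ0 := pos_of_two_sqrt_le hL hγ
  refine abs_le_of_sq_le_sq' ?_ (mul_nonneg rho_nonneg (norm_nonneg _)) |>.2
  rw [mul_pow, rho_sq hL hm hmL hγ hδγ, norm_twist_sq hL hγ, norm_twist_sq hL hγ]
  set s := Real.sqrt L with hsdef
  have hη : eta (δ * s) (γ / s) = eta δ γ := by
    unfold eta; congr 2; field_simp
  -- the scaled force difference satisfies the hypotheses of `contraction_unit` at any two points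
  have hforce : ∀ x y : E d,
      ‖L⁻¹ • (∇ U x - ∇ U y)‖ ^ 2 ≤ inner ℝ (x - y) (L⁻¹ • (∇ U x - ∇ U y)) ∧
      m / L * ‖x - y‖ ^ 2 ≤ inner ℝ (x - y) (L⁻¹ • (∇ U x - ∇ U y)) := fun x y => by
    constructor
    · rw [norm_smul, mul_pow, inner_smul_right, Real.norm_eq_abs, sq_abs]
      have := cocoercive (hasGradientAt_gradient hU) hL hLip (inner_gradient_sub_nonneg hm hConv)
        x y
      calc L⁻¹ ^ 2 * ‖∇ U x - ∇ U y‖ ^ 2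
          ≤ L⁻¹ ^ 2 * (L * inner ℝ (x - y) (∇ U x - ∇ U y)) := by gcongr
        _ = _ := by field_simp
    · rw [inner_smul_right]
      calc m / L * ‖x - y‖ ^ 2 = L⁻¹ * (m * ‖x - y‖ ^ 2) := by ring
        _ ≤ _ := by gcongr; exact hConv x y
  have hf := hforce z.1 z'.1
  have hf' := hforce (obaboMap U δ γ z g g').1 (obaboMap U δ γ z' g g').1
  have hsub := obaboMap_sub U δ γ z z' g g'
  rw [← Prod.fst_sub, hsub] at hf'
  rw [hsub, Prod.fst_sub, Prod.snd_sub]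
  generalize ∇ U (obaboMap U δ γ z g g').1 - ∇ U (obaboMap U δ γ z' g g').1 = G' at hf' ⊢
  generalize ∇ U z.1 - ∇ U z'.1 = G at hf hf' ⊢
  generalize z.1 - z'.1 = X at hf hf' ⊢
  generalize z.2 - z'.2 = V at hf' ⊢
  -- in the units `√L t`, `v / √L` and `∇U / L` the potential has Lipschitz constant `1`
  have key := contraction_unit (γ := γ / s) (δ := δ * s) (m := m / L) (x := X) (v := s⁻¹ • V)
    (g := L⁻¹ • G) (g' := L⁻¹ • G') (x' := X + δ • (eta δ γ • V - (δ / 2) • G))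
    (u := s⁻¹ • (eta δ γ • V - (δ / 2) • G))
    (by rwa [le_div_iff₀ hs]) (by positivity)
    ((div_le_one hL).2 hmL) (by positivity) ?_ ?_ ?_ hf.1 hf.2 hf'.1 hf'.2
  · rw [hη] at key
    set η := eta δ γ
    have e2 : η • (s⁻¹ • (η • V - (δ / 2) • G) - (δ * s / 2) • L⁻¹ • G')
        = s⁻¹ • (η • (η • V - (δ / 2) • G - (δ / 2) • G')) := by
      have : δ * s / 2 * L⁻¹ = s⁻¹ * (δ / 2) := by rw [← hss]; field_simp
      rw [smul_smul (δ * s / 2), this]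
      module
    have hcross : ∀ a b : E d, 2 / (γ / s) * inner ℝ a (s⁻¹ • b) = 2 / γ * inner ℝ a b :=
      fun a b => by rw [inner_smul_right]; field_simp
    have hsq : ∀ b : E d, ‖s⁻¹ • b‖ ^ 2 = ‖b‖ ^ 2 / L := fun b => by
      rw [norm_smul, mul_pow, Real.norm_eq_abs, sq_abs, ← hss]; field_simp
    have hrate : δ * s * (m / L / (3 * (γ / s))) = δ * kappa m γ := by
      rw [kappa, ← hss]; field_simp
    rw [e2, hcross, hcross, hsq, hsq, hrate] at key
    exact key
  · rw [le_div_iff₀ (by positivity)]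
    rw [le_div_iff₀ (by positivity)] at hδγ
    have : δ * s * (33 * (γ / s) ^ 3) = δ * (33 * γ ^ 3) / L := by rw [← hss]; field_simp
    rw [this]; gcongr
  · rw [hη]
    have : δ * s / 2 * L⁻¹ = s⁻¹ * (δ / 2) := by rw [← hss]; field_simp
    rw [smul_smul (δ * s / 2), this]
    module
  · rw [smul_smul, mul_assoc, mul_inv_cancel₀ hs.ne', mul_one]

end Contraction

/-! ### Gaussian refreshment and the Gibbs measure -/

section Tilted

theorem tilted_prod {X Y : Type*} [MeasurableSpace X] [MeasurableSpace Y] (μ : Measure X)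
    (ν : Measure Y) [SigmaFinite μ] [SigmaFinite ν] {f : X → ℝ} {g : Y → ℝ} (hf : Measurable f)
    (hg : Measurable g) :
    (μ.prod ν).tilted (fun z => f z.1 + g z.2) = (μ.tilted f).prod (ν.tilted g) := by
  rw [Measure.tilted, Measure.tilted, Measure.tilted,
    prod_withDensity (by fun_prop) (by fun_prop)]
  congr 1
  ext z
  rw [← ENNReal.ofReal_mul (by positivity)]
  simp_rw [Real.exp_add]
  rw [integral_prod_mul (fun x => Real.exp (f x)) (fun y => Real.exp (g y)), div_mul_div_comm]

variable {V : Type*} [NormedAddCommGroup V] [InnerProductSpace ℝ V] [FiniteDimensional ℝ V]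
  [MeasurableSpace V] [BorelSpace V]

theorem integrable_exp_neg_mul_norm_sq {b : ℝ} (hb : 0 < b) :
    Integrable (fun v : V => Real.exp (-b * ‖v‖ ^ 2)) := by
  have h := (GaussianFourier.integrable_cexp_neg_mul_sq_norm_add (V := V) (b := (b : ℂ))
    (by simpa using hb) 0 0).norm
  refine h.congr (Eventually.of_forall fun v => ?_)
  simp only [zero_mul, add_zero, Complex.norm_exp]
  congr 1
  norm_cast

/-- The standard Gaussian measure is defined through coordinates; its density is identified by
comparing characteristic functions. -/
theorem stdGaussian_eq_tilted :
    stdGaussian V = (volume : Measure V).tilted (fun v => -(‖v‖ ^ 2 / 2)) := by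
  have hint : Integrable (fun v : V => Real.exp (-(‖v‖ ^ 2 / 2))) := by
    refine (integrable_exp_neg_mul_norm_sq (V := V) (b := 1 / 2) (by norm_num)).congr
      (Eventually.of_forall fun v => ?_)
    simp only; congr 1; ring
  have := isProbabilityMeasure_tilted hint
  refine Measure.ext_of_charFun (funext fun t => ?_)
  rw [charFun_stdGaussian, charFun_apply, integral_tilted]
  have hb : (0 : ℝ) < (1 / 2 : ℂ).re := by norm_num
  have h1 := GaussianFourier.integral_cexp_neg_mul_sq_norm_add (V := V) hb Complex.I t
  have h0 := GaussianFourier.integral_cexp_neg_mul_sq_norm (V := V) hb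
  have hZ : ((∫ v : V, Real.exp (-(‖v‖ ^ 2 / 2)) : ℝ) : ℂ)
      = (Real.pi / (1 / 2 : ℂ)) ^ (Module.finrank ℝ V / 2 : ℂ) := by
    rw [← h0, ← integral_complex_ofReal]
    congr with v
    push_cast
    congr 1; ring
  have hZ0 : ((∫ v : V, Real.exp (-(‖v‖ ^ 2 / 2)) : ℝ) : ℂ) ≠ 0 := by
    exact_mod_cast (integral_exp_pos hint).ne'
  have h2 : ∀ v : V, (Real.exp (-(‖v‖ ^ 2 / 2)) / ∫ v : V, Real.exp (-(‖v‖ ^ 2 / 2))) •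
      Complex.exp (↑(inner ℝ v t) * Complex.I) =
      ((∫ v : V, Real.exp (-(‖v‖ ^ 2 / 2)) : ℝ) : ℂ)⁻¹ *
        Complex.exp (-(1 / 2 : ℂ) * ‖v‖ ^ 2 + Complex.I * inner ℝ t v) := fun v => by
    rw [Complex.real_smul, Complex.exp_add, real_inner_comm]
    push_cast
    rw [show -((‖v‖ : ℂ) ^ 2 / 2) = -(1 / 2 : ℂ) * ‖v‖ ^ 2 by ring, mul_comm Complex.I]
    ring
  simp_rw [h2]
  rw [integral_const_mul, h1, ← hZ, ← mul_assoc, inv_mul_cancel₀ hZ0, one_mul, Complex.I_sq]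
  congr 1
  ring

/-- The partial refreshment `v ↦ a v + b g` preserves the standard Gaussian law if
`a² + b² = 1`. -/
theorem map_smul_add_smul_stdGaussian {a b : ℝ} (hab : a ^ 2 + b ^ 2 = 1) :
    ((stdGaussian V).prod (stdGaussian V)).map (fun w => a • w.1 + b • w.2) = stdGaussian V := by
  have hm : Measurable (fun w : V × V => a • w.1 + b • w.2) := by fun_prop
  have := Measure.isProbabilityMeasure_map (μ := (stdGaussian V).prod (stdGaussian V))
    hm.aemeasurable
  refine Measure.ext_of_charFun (funext fun t => ?_)
  rw [charFun_apply, integral_map hm.aemeasurable (by fun_prop)]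
  have h : ∀ w : V × V, Complex.exp (↑(inner ℝ (a • w.1 + b • w.2) t) * Complex.I) =
      Complex.exp (↑(inner ℝ w.1 (a • t)) * Complex.I) *
        Complex.exp (↑(inner ℝ w.2 (b • t)) * Complex.I) := fun w => by
    rw [← Complex.exp_add, inner_add_left, inner_smul_left, inner_smul_left, inner_smul_right,
      inner_smul_right]
    push_cast
    simp only [conj_trivial]
    ring_nf
  simp_rw [h]
  rw [integral_prod_mul (fun x => Complex.exp (↑(inner ℝ x (a • t)) * Complex.I))
    (fun x => Complex.exp (↑(inner ℝ x (b • t)) * Complex.I)), ← charFun_apply, ← charFun_apply,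
    charFun_stdGaussian, charFun_stdGaussian, charFun_stdGaussian, ← Complex.exp_add]
  congr 1
  rw [norm_smul, norm_smul, mul_comm, mul_comm ‖b‖]
  push_cast
  rw [mul_pow, mul_pow, ← Complex.ofReal_pow ‖a‖, ← Complex.ofReal_pow ‖b‖, Real.norm_eq_abs,
    Real.norm_eq_abs, sq_abs, sq_abs]
  have : (b : ℂ) ^ 2 = 1 - (a : ℂ) ^ 2 := by
    rw [eq_sub_iff_add_eq, add_comm]; exact_mod_cast hab
  push_cast
  rw [this]
  ring

end Tilted

section Gibbs

variable {d : ℕ} {U : E d → ℝ} {m : ℝ}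

/-- The density is below a Gaussian one centred at the minimiser. -/
theorem integrable_exp_neg (hU : ContDiff ℝ 2 U) (hm : 0 < m) (hConv : StrongConv U m) :
    Integrable (fun x => Real.exp (-U x)) := by
  obtain ⟨x₀, hx₀⟩ := exists_gradient_eq_zero hU hm hConv
  have h := ((integrable_exp_neg_mul_norm_sq (V := E d) (b := m / 2) (by positivity)).comp_sub_right
    x₀).const_mul (Real.exp (-U x₀))
  refine h.mono' (by have := hU.continuous; fun_prop) (Eventually.of_forall fun x => ?_)
  rw [Real.norm_of_nonneg (Real.exp_pos _).le, ← Real.exp_add]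
  have := quadratic_lower_bound (hasGradientAt_gradient hU) hConv x₀ x
  rw [hx₀, inner_zero_left] at this
  exact Real.exp_le_exp.2 (by linarith)

theorem isProbabilityMeasure_tilted_neg (hU : ContDiff ℝ 2 U) (hm : 0 < m)
    (hConv : StrongConv U m) :
    IsProbabilityMeasure ((volume : Measure (E d)).tilted (fun x => -U x)) :=
  isProbabilityMeasure_tilted (integrable_exp_neg hU hm hConv)

/-- Under the Gibbs measure position and velocity are independent, and the velocity is standard
Gaussian. -/
theorem gibbs_eq_prod (hU : ContDiff ℝ 2 U) :
    gibbs U = ((volume : Measure (E d)).tilted (fun x => -U x)).prod (stdGaussian (E d)) := by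
  have := hU.continuous
  rw [stdGaussian_eq_tilted, ← tilted_prod _ _ (by fun_prop) (by fun_prop), gibbs,
    Measure.volume_eq_prod]
  congr with z
  rw [hamiltonian]
  ring

theorem isProbabilityMeasure_gibbs (hU : ContDiff ℝ 2 U) (hm : 0 < m)
    (hConv : StrongConv U m) : IsProbabilityMeasure (gibbs U) := by
  have := isProbabilityMeasure_tilted_neg hU hm hConv
  rw [gibbs_eq_prod hU]
  infer_instance

theorem eta_sq_add_sq {δ γ : ℝ} (h : 0 ≤ δ * γ) :
    eta δ γ ^ 2 + Real.sqrt (1 - eta δ γ ^ 2) ^ 2 = 1 := by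
  have h1 : eta δ γ ≤ 1 := Real.exp_le_one_iff.2 (by linarith)
  have h0 : 0 ≤ eta δ γ := (Real.exp_pos _).le
  rw [Real.sq_sqrt (by nlinarith)]
  ring

/-- The Ornstein–Uhlenbeck step preserves the Gibbs measure. -/
theorem map_stepO_gibbs (hU : ContDiff ℝ 2 U) (hm : 0 < m) (hConv : StrongConv U m) {δ γ : ℝ}
    (h : 0 ≤ δ * γ) :
    ((gibbs U).prod (stdGaussian (E d))).map (fun w => stepO δ γ w.2 w.1) = gibbs U := by
  have := isProbabilityMeasure_tilted_neg hU hm hConv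
  rw [gibbs_eq_prod hU]
  set μ := (volume : Measure (E d)).tilted (fun x => -U x)
  have hmp := measurePreserving_prodAssoc μ (stdGaussian (E d)) (stdGaussian (E d))
  have h2 : MeasurePreserving
      (fun w : E d × E d => eta δ γ • w.1 + Real.sqrt (1 - eta δ γ ^ 2) • w.2)
      ((stdGaussian (E d)).prod (stdGaussian (E d))) (stdGaussian (E d)) :=
    ⟨by fun_prop, map_smul_add_smul_stdGaussian (eta_sq_add_sq h)⟩
  exact (((MeasurePreserving.id μ).prod h2).comp hmp).map_eq

end Gibbs

/-! ### Moments of log-concave measures -/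

section Moments

variable {d : ℕ} {W : E d → ℝ} {m : ℝ}

/-- Comparison of `∫ |x|^q e^{-W}` with its image under the dilation `x ↦ (1 + s) x`: this is
integration by parts in integrated form, and avoids differentiating. -/
theorem integral_norm_rpow_one_sub_exp_le (hWc : Continuous W) {q : ℝ}
    (hint : Integrable (fun x => ‖x‖ ^ q * Real.exp (-W x))) {s : ℝ} (hs : 0 < s) (hm : 0 < m)
    (hq : 0 ≤ q) (hW : ∀ x, W x + s * m * ‖x‖ ^ 2 ≤ W ((1 + s) • x)) :
    ∫ x, ‖x‖ ^ q * Real.exp (-W x) * (1 - Real.exp (-(s * m * ‖x‖ ^ 2))) ≤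
      (1 - (1 + s) ^ (-(d + q))) * ∫ x, ‖x‖ ^ q * Real.exp (-W x) := by
  have h1s : 0 < 1 + s := by linarith
  set f : E d → ℝ := fun x => ‖x‖ ^ q * Real.exp (-W x) with hf
  have hfm : Measurable f := by have := hWc.measurable; fun_prop
  have hint2 : Integrable (fun x => f x * Real.exp (-(s * m * ‖x‖ ^ 2))) := by
    refine hint.mono' (by fun_prop) (Eventually.of_forall fun x => ?_)
    rw [Real.norm_of_nonneg (by positivity)]
    exact mul_le_of_le_one_right (by positivity) (Real.exp_le_one_iff.2 (by
      have : 0 ≤ s * m * ‖x‖ ^ 2 := by positivity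
      linarith))
  have hscale := Measure.integral_comp_smul (volume : Measure (E d)) f (1 + s)
  rw [finrank_euclideanSpace_fin, abs_of_pos (by positivity), smul_eq_mul] at hscale
  have hle : ∫ x, f ((1 + s) • x) ≤ (1 + s) ^ q * ∫ x, f x * Real.exp (-(s * m * ‖x‖ ^ 2)) := by
    rw [← integral_const_mul]
    refine integral_mono (hint.comp_smul h1s.ne') (hint2.const_mul _) fun x => ?_
    simp only [hf]
    rw [norm_smul, Real.norm_of_nonneg h1s.le, Real.mul_rpow h1s.le (norm_nonneg _)]
    have : Real.exp (-W ((1 + s) • x)) ≤ Real.exp (-W x) * Real.exp (-(s * m * ‖x‖ ^ 2)) := by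
      rw [← Real.exp_add]
      exact Real.exp_le_exp.2 (by linarith [hW x])
    calc (1 + s) ^ q * ‖x‖ ^ q * Real.exp (-W ((1 + s) • x))
        ≤ (1 + s) ^ q * ‖x‖ ^ q * (Real.exp (-W x) * Real.exp (-(s * m * ‖x‖ ^ 2))) := by gcongr
      _ = _ := by ring
  have hge : (1 + s) ^ (-(d + q)) * ∫ x, f x ≤ ∫ x, f x * Real.exp (-(s * m * ‖x‖ ^ 2)) := by
    rw [hscale] at hle
    rw [neg_add, Real.rpow_add h1s, Real.rpow_neg h1s.le q, Real.rpow_neg h1s.le d,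
      Real.rpow_natCast]
    have := mul_le_mul_of_nonneg_left hle (by positivity : 0 ≤ ((1 + s) ^ q)⁻¹)
    rw [inv_mul_cancel_left₀ (by positivity)] at this
    linarith
  have hsub : ∫ x, f x * (1 - Real.exp (-(s * m * ‖x‖ ^ 2))) =
      (∫ x, f x) - ∫ x, f x * Real.exp (-(s * m * ‖x‖ ^ 2)) := by
    rw [← integral_sub hint hint2]
    congr with x
    ring
  rw [hsub]
  linarith

/-- Letting the dilation tend to the identity: `m E|x|^{q+2} ≤ (d + q) E|x|^q` under `e^{-W}`. -/
theorem lintegral_norm_rpow_add_two_le (hWc : Continuous W) {q : ℝ}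
    (hint : Integrable (fun x => ‖x‖ ^ q * Real.exp (-W x))) (hm : 0 < m) (hq : 0 ≤ q)
    (hW : ∀ s : ℝ, 0 < s → ∀ x, W x + s * m * ‖x‖ ^ 2 ≤ W ((1 + s) • x)) :
    ∫⁻ x, ENNReal.ofReal (m * (‖x‖ ^ (q + 2) * Real.exp (-W x))) ≤
      ENNReal.ofReal ((d + q) * ∫ x, ‖x‖ ^ q * Real.exp (-W x)) := by
  set f : E d → ℝ := fun x => ‖x‖ ^ q * Real.exp (-W x) with hf
  have hfm : Measurable f := by have := hWc.measurable; fun_prop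
  have hf0 : ∀ x, 0 ≤ f x := fun x => by positivity
  let s : ℕ → ℝ := fun n => 1 / ((n : ℝ) + 1)
  have hs0 : ∀ n, 0 < s n := fun n => by positivity
  have hslim : Tendsto s atTop (𝓝[≠] 0) :=
    tendsto_nhdsWithin_iff.2 ⟨tendsto_one_div_add_atTop_nhds_zero_nat,
      Eventually.of_forall fun n => (hs0 n).ne'⟩
  let F : ℕ → E d → ℝ≥0∞ := fun n x =>
    ENNReal.ofReal (f x * (1 - Real.exp (-(s n * m * ‖x‖ ^ 2))) / s n)
  have hFm : ∀ n, Measurable (F n) := fun n => by fun_prop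
  have hpt : ∀ x, Tendsto (fun n => F n x) atTop
      (𝓝 (ENNReal.ofReal (m * (‖x‖ ^ (q + 2) * Real.exp (-W x))))) := fun x => by
    refine (ENNReal.continuous_ofReal.tendsto _).comp ?_
    have hd : HasDerivAt (fun s : ℝ => Real.exp (-(s * m * ‖x‖ ^ 2)))
        (Real.exp (-(0 * m * ‖x‖ ^ 2)) * -(1 * m * ‖x‖ ^ 2)) 0 :=
      ((((hasDerivAt_id (0 : ℝ)).mul_const m).mul_const (‖x‖ ^ 2)).neg).exp
    have h := ((hasDerivAt_iff_tendsto_slope.1 hd).comp hslim).neg.const_mul (f x)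
    have e : f x * -(Real.exp (-(0 * m * ‖x‖ ^ 2)) * -(1 * m * ‖x‖ ^ 2)) =
        m * (‖x‖ ^ (q + 2) * Real.exp (-W x)) := by
      rw [Real.rpow_add_of_nonneg (norm_nonneg x) hq zero_le_two, Real.rpow_two]
      simp [hf]
      ring
    rw [e] at h
    refine h.congr fun n => ?_
    simp only [slope, Function.comp_apply, vsub_eq_sub, sub_zero, smul_eq_mul, zero_mul, neg_zero,
      Real.exp_zero]
    ring
  have hbound : ∀ n, ∫⁻ x, F n x ≤
      ENNReal.ofReal ((1 - (1 + s n) ^ (-(d + q))) / s n * ∫ x, f x) := fun n => by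
    have h := integral_norm_rpow_one_sub_exp_le hWc hint (hs0 n) hm hq (hW (s n) (hs0 n))
    have hle1 : ∀ x : E d, 0 ≤ 1 - Real.exp (-(s n * m * ‖x‖ ^ 2)) ∧
        1 - Real.exp (-(s n * m * ‖x‖ ^ 2)) ≤ 1 := fun x => by
      have h0 : 0 ≤ s n * m * ‖x‖ ^ 2 := by have := hs0 n; positivity
      constructor
      · linarith [Real.exp_le_one_iff.2 (by linarith : -(s n * m * ‖x‖ ^ 2) ≤ 0)]
      · linarith [Real.exp_pos (-(s n * m * ‖x‖ ^ 2))]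
    have hi : Integrable (fun x => f x * (1 - Real.exp (-(s n * m * ‖x‖ ^ 2)))) := by
      refine hint.mono' (by fun_prop) (Eventually.of_forall fun x => ?_)
      rw [Real.norm_of_nonneg (mul_nonneg (hf0 x) (hle1 x).1)]
      exact mul_le_of_le_one_right (hf0 x) (hle1 x).2
    rw [← ofReal_integral_eq_lintegral_ofReal (hi.div_const _)
      (Eventually.of_forall fun x => div_nonneg (mul_nonneg (hf0 x) (hle1 x).1) (hs0 n).le),
      integral_div]
    exact ENNReal.ofReal_le_ofReal ((div_le_div_of_nonneg_right h (hs0 n).le).trans_eq (by ring))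
  have hlim : Tendsto (fun n => ENNReal.ofReal ((1 - (1 + s n) ^ (-(d + q))) / s n * ∫ x, f x))
      atTop (𝓝 (ENNReal.ofReal ((d + q) * ∫ x, f x))) := by
    refine (ENNReal.continuous_ofReal.tendsto _).comp (Tendsto.mul_const _ ?_)
    have hd : HasDerivAt (fun s : ℝ => (1 + s) ^ (-(d + q)))
        (1 * (-(d + q)) * (1 + 0) ^ (-(d + q) - 1)) 0 :=
      ((hasDerivAt_id (0 : ℝ)).const_add 1).rpow_const (Or.inl (by norm_num))
    have h := ((hasDerivAt_iff_tendsto_slope.1 hd).comp hslim).neg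
    have e : -(1 * (-(d + q)) * (1 + 0) ^ (-(d + q) - 1)) = (d + q) := by simp
    rw [e] at h
    refine h.congr fun n => ?_
    simp only [slope, Function.comp_apply, vsub_eq_sub, sub_zero, smul_eq_mul, add_zero,
      Real.one_rpow]
    ring
  calc ∫⁻ x, ENNReal.ofReal (m * (‖x‖ ^ (q + 2) * Real.exp (-W x)))
      = ∫⁻ x, liminf (fun n => F n x) atTop :=
        lintegral_congr fun x => (hpt x).liminf_eq.symm
    _ ≤ liminf (fun n => ∫⁻ x, F n x) atTop := lintegral_liminf_le hFm
    _ ≤ liminf (fun n => ENNReal.ofReal ((1 - (1 + s n) ^ (-(d + q))) / s n * ∫ x, f x)) atTop :=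
        liminf_le_liminf (Eventually.of_forall hbound)
    _ = _ := hlim.liminf_eq

theorem integral_norm_rpow_add_two_le (hWc : Continuous W) {q : ℝ}
    (hint : Integrable (fun x => ‖x‖ ^ q * Real.exp (-W x))) (hm : 0 < m) (hq : 0 ≤ q)
    (hW : ∀ s : ℝ, 0 < s → ∀ x, W x + s * m * ‖x‖ ^ 2 ≤ W ((1 + s) • x)) :
    Integrable (fun x => ‖x‖ ^ (q + 2) * Real.exp (-W x)) ∧
    m * ∫ x, ‖x‖ ^ (q + 2) * Real.exp (-W x) ≤ (d + q) * ∫ x, ‖x‖ ^ q * Real.exp (-W x) := by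
  have h := lintegral_norm_rpow_add_two_le hWc hint hm hq hW
  have hmeas : Measurable (fun x : E d => m * (‖x‖ ^ (q + 2) * Real.exp (-W x))) := by
    have := hWc.measurable; fun_prop
  have hnn : ∀ x : E d, 0 ≤ m * (‖x‖ ^ (q + 2) * Real.exp (-W x)) := fun x => by positivity
  have hI : Integrable (fun x => m * (‖x‖ ^ (q + 2) * Real.exp (-W x))) := by
    refine ⟨hmeas.aestronglyMeasurable, ?_⟩
    rw [hasFiniteIntegral_iff_ofReal (Eventually.of_forall hnn)]
    exact h.trans_lt ENNReal.ofReal_lt_top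
  refine ⟨(hI.const_mul m⁻¹).congr (Eventually.of_forall fun x => ?_), ?_⟩
  · simp only
    rw [inv_mul_cancel_left₀ hm.ne']
  · rw [← ofReal_integral_eq_lintegral_ofReal hI (Eventually.of_forall hnn), integral_const_mul]
      at h
    have h0 : 0 ≤ (d + q) * ∫ x, ‖x‖ ^ q * Real.exp (-W x) :=
      mul_nonneg (by positivity) (integral_nonneg fun x => by positivity)
    exact (ENNReal.ofReal_le_ofReal_iff h0).1 h

/-- The recursion of `integral_norm_rpow_add_two_le` reaches all even exponents from `0`, and these
dominate the others. -/
theorem integrable_norm_rpow_mul_exp (hWc : Continuous W)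
    (hint : Integrable (fun x => Real.exp (-W x))) (hm : 0 < m)
    (hW : ∀ s : ℝ, 0 < s → ∀ x, W x + s * m * ‖x‖ ^ 2 ≤ W ((1 + s) • x)) {q : ℝ} (hq : 0 ≤ q) :
    Integrable (fun x => ‖x‖ ^ q * Real.exp (-W x)) := by
  have heven : ∀ k : ℕ, Integrable (fun x => ‖x‖ ^ (2 * k : ℝ) * Real.exp (-W x)) := fun k => by
    induction k with
    | zero => simpa using hint
    | succ k ih =>
      have := (integral_norm_rpow_add_two_le hWc ih hm (by positivity) hW).1
      rwa [show (2 * (k : ℝ) + 2) = 2 * ((k + 1 : ℕ) : ℝ) by push_cast; ring] at this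
  obtain ⟨k, hk⟩ := exists_nat_ge q
  refine (hint.add (heven k)).mono' (by have := hWc.measurable; fun_prop)
    (Eventually.of_forall fun x => ?_)
  rw [Real.norm_of_nonneg (by positivity), Pi.add_apply]
  have : ‖x‖ ^ q ≤ 1 + ‖x‖ ^ (2 * k : ℝ) := by
    rcases le_total ‖x‖ 1 with h | h
    · have h1 := Real.rpow_le_one (norm_nonneg x) h hq
      have h2 : 0 ≤ ‖x‖ ^ (2 * k : ℝ) := by positivity
      linarith
    · have h1 := Real.rpow_le_rpow_of_exponent_le h (by linarith [hk, hq] : q ≤ 2 * k)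
      linarith
  nlinarith [Real.exp_pos (-W x)]

/-- Moments of a strongly log-concave measure centred at its mode:
`(E|x|^p)^{1/p} ≤ √((d + (p-2)₊)/m)`. For `p ≥ 2` the recursion for the moments is closed by the
monotonicity of `L^p` norms, and smaller `p` follow from `p = 2`. -/
theorem eLpNorm_tilted_le (hWc : Continuous W)
    (hint : Integrable (fun x => Real.exp (-W x))) (hm : 0 < m)
    (hW : ∀ s : ℝ, 0 < s → ∀ x, W x + s * m * ‖x‖ ^ 2 ≤ W ((1 + s) • x)) {p : ℝ} (hp : 1 ≤ p) :
    eLpNorm (fun x : E d => x) (ENNReal.ofReal p) (volume.tilted fun x => -W x) ≤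
      ENNReal.ofReal (Real.sqrt ((d + max (p - 2) 0) / m)) := by
  set μ := (volume : Measure (E d)).tilted (fun x => -W x) with hμ
  have hprob : IsProbabilityMeasure μ := isProbabilityMeasure_tilted hint
  have hZ : 0 < ∫ x, Real.exp (-W x) := integral_exp_pos hint
  wlog hp2 : 2 ≤ p generalizing p
  · push Not at hp2
    have h := this one_le_two le_rfl
    rw [max_eq_right (by linarith)]
    rw [sub_self, max_self] at h
    exact (eLpNorm_le_eLpNorm_of_exponent_le (ENNReal.ofReal_le_ofReal hp2.le)
      (by fun_prop)).trans h
  have hint' : ∀ q : ℝ, 0 ≤ q → ∫ x, ‖x‖ ^ q ∂μ =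
      (∫ x, ‖x‖ ^ q * Real.exp (-W x)) / ∫ x, Real.exp (-W x) := fun q _ => by
    rw [hμ, integral_tilted, ← integral_div]
    congr with x
    rw [smul_eq_mul]; ring
  have hI : ∀ q : ℝ, 0 ≤ q → Integrable (fun x => ‖x‖ ^ q) μ := fun q hq => by
    rw [hμ, integrable_tilted_iff hint]
    refine (integrable_norm_rpow_mul_exp hWc hint hm hW hq).congr (Eventually.of_forall fun x => ?_)
    simp only [smul_eq_mul]; ring
  have hrec : m * ∫ x, ‖x‖ ^ p ∂μ ≤ (d + (p - 2)) * ∫ x, ‖x‖ ^ (p - 2) ∂μ := by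
    have h := (integral_norm_rpow_add_two_le hWc (integrable_norm_rpow_mul_exp hWc hint hm hW
      (by linarith : 0 ≤ p - 2)) hm (by linarith) hW).2
    rw [sub_add_cancel] at h
    rw [hint' _ (by linarith), hint' _ (by linarith), ← mul_div_assoc, ← mul_div_assoc]
    exact div_le_div_of_nonneg_right h hZ.le
  rw [max_eq_left (by linarith)]
  set A := (∫ x, ‖x‖ ^ p ∂μ) ^ (1 / p) with hA
  have hM0 : 0 ≤ ∫ x, ‖x‖ ^ p ∂μ := integral_nonneg fun x => by positivity
  have hA0 : 0 ≤ A := by positivity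
  have hAp : ∫ x, ‖x‖ ^ p ∂μ = A ^ p := by
    rw [hA, ← Real.rpow_mul hM0, one_div_mul_cancel (by linarith), Real.rpow_one]
  have hnorm : eLpNorm (fun x : E d => x) (ENNReal.ofReal p) μ = ENNReal.ofReal A := by
    have hL : MemLp (fun x : E d => x) (ENNReal.ofReal p) μ := by
      rw [← integrable_norm_rpow_iff (by fun_prop) (by simp; linarith) (by simp),
        ENNReal.toReal_ofReal (by linarith)]
      exact hI p (by linarith)
    rw [hL.eLpNorm_eq_integral_rpow_norm (by simp; linarith) (by simp),
      ENNReal.toReal_ofReal (by linarith), hA, one_div]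
  -- Jensen, in the form `‖·‖^{p-2} = (‖·‖^p)^{(p-2)/p}`
  have hJ : ∫ x, ‖x‖ ^ (p - 2) ∂μ ≤ A ^ (p - 2) := by
    have h := (Real.concaveOn_rpow (p := (p - 2) / p) (by apply div_nonneg <;> linarith)
      (by rw [div_le_one] <;> linarith)).le_map_integral (μ := μ) (f := fun x => ‖x‖ ^ p)
      (Real.continuous_rpow_const (by apply div_nonneg <;> linarith)).continuousOn isClosed_Ici
      (Eventually.of_forall fun x => by simp; positivity) (hI p (by linarith)) ?_
    · rw [hAp, ← Real.rpow_mul hA0, mul_div_cancel₀ _ (by linarith)] at h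
      refine le_trans (le_of_eq ?_) h
      congr with x
      rw [← Real.rpow_mul (norm_nonneg x), mul_div_cancel₀ _ (by linarith)]
    · refine (hI (p - 2) (by linarith)).congr (Eventually.of_forall fun x => ?_)
      simp only [Function.comp_apply]
      rw [← Real.rpow_mul (norm_nonneg x), mul_div_cancel₀ _ (by linarith)]
  rw [hnorm]
  refine ENNReal.ofReal_le_ofReal (Real.le_sqrt_of_sq_le ?_)
  rcases hA0.eq_or_lt with h0 | hpos
  · rw [← h0]
    have : 0 ≤ (d + (p - 2)) / m :=
      div_nonneg (by have := Nat.cast_nonneg (α := ℝ) d; linarith) hm.le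
    simpa using this
  · rw [hAp, show p = (p - 2) + 2 by ring, Real.rpow_add hpos, Real.rpow_two] at hrec
    rw [show p - 2 + 2 - 2 = p - 2 by ring] at hrec
    have hpos' : 0 < A ^ (p - 2) := by positivity
    rw [le_div_iff₀ hm]
    have h2 : A ^ (p - 2) * (A ^ 2 * m) ≤ A ^ (p - 2) * (d + (p - 2)) := by
      have hdp : (0 : ℝ) ≤ d + (p - 2) := by
        have := Nat.cast_nonneg (α := ℝ) d
        linarith
      have := mul_le_mul_of_nonneg_left hJ hdp
      linarith
    exact le_of_mul_le_mul_left h2 hpos'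

theorem map_tilted {X Y : Type*} [MeasurableSpace X] [MeasurableSpace Y] {μ : Measure X}
    {ν : Measure Y} {e : X → Y} (he : MeasurePreserving e μ ν) {f : Y → ℝ} (hf : Measurable f) :
    (μ.tilted fun x => f (e x)).map e = ν.tilted f := by
  ext s hs
  have hZ : ∫ x, Real.exp (f (e x)) ∂μ = ∫ y, Real.exp (f y) ∂ν := by
    rw [← he.map_eq, integral_map he.measurable.aemeasurable (by fun_prop)]
  rw [Measure.map_apply he.measurable hs, tilted_apply' _ _ (he.measurable hs),
    tilted_apply' _ _ hs, hZ,
    ← he.setLIntegral_comp_preimage hs (f := fun y => ENNReal.ofReal (Real.exp (f y) / _))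
      (by fun_prop)]

variable {U : E d → ℝ}

/-- `x₀` is the minimiser of `U`, that is the mode of the position marginal. -/
theorem eLpNorm_fst_gibbs_le (hU : ContDiff ℝ 2 U) (hm : 0 < m) (hConv : StrongConv U m)
    {x₀ : E d} (hx₀ : ∇ U x₀ = 0) {p : ℝ} (hp : 1 ≤ p) :
    eLpNorm (fun z : Phase d => z.1 - x₀) (ENNReal.ofReal p) (gibbs U) ≤
      ENNReal.ofReal (Real.sqrt ((d + max (p - 2) 0) / m)) := by
  have hprob := isProbabilityMeasure_tilted_neg hU hm hConv
  have hUc := hU.continuous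
  have hint := (integrable_exp_neg hU hm hConv).comp_add_right x₀
  have hshift := map_tilted (measurePreserving_add_right (volume : Measure (E d)) x₀)
    (f := fun x => -U x) hUc.measurable.neg
  rw [gibbs_eq_prod hU]
  have h1 := eLpNorm_comp_measurePreserving (p := ENNReal.ofReal p)
    (f := (Prod.fst : E d × E d → E d))
    (g := fun x : E d => x - x₀) (by fun_prop)
    (measurePreserving_fst (μ := (volume : Measure (E d)).tilted fun x => -U x)
      (ν := stdGaussian (E d)))
  have h2 := eLpNorm_map_measure (p := ENNReal.ofReal p) (g := fun x : E d => x - x₀)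
    (f := fun x => x + x₀) (μ := (volume : Measure (E d)).tilted fun x => -U (x + x₀))
    (by fun_prop) (by fun_prop)
  rw [hshift] at h2
  rw [show (fun z : Phase d => z.1 - x₀) = (fun x : E d => x - x₀) ∘ Prod.fst from rfl, h1, h2]
  have h3 : (fun x : E d => x - x₀) ∘ (fun x => x + x₀) = fun x => x := by
    ext1 x; simp
  rw [h3]
  refine eLpNorm_tilted_le (W := fun x => U (x + x₀)) (by fun_prop) hint hm (fun s hs x => ?_) hp
  -- convexity along the ray from the minimiser
  have h4 := quadratic_lower_bound (hasGradientAt_gradient hU) (c := 0)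
    (fun x y => by simpa using inner_gradient_sub_nonneg hm hConv x y) (x + x₀) ((1 + s) • x + x₀)
  have h5 := hConv (x + x₀) x₀
  rw [hx₀, sub_zero, add_sub_cancel_right, real_inner_comm] at h5
  have h6 : (1 + s) • x + x₀ - (x + x₀) = s • x := by module
  rw [h6, inner_smul_right] at h4
  nlinarith

theorem eLpNorm_snd_gibbs_le (hU : ContDiff ℝ 2 U) (hm : 0 < m) (hConv : StrongConv U m)
    {p : ℝ} (hp : 1 ≤ p) :
    eLpNorm (fun z : Phase d => z.2) (ENNReal.ofReal p) (gibbs U) ≤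
      ENNReal.ofReal (Real.sqrt (d + max (p - 2) 0)) := by
  have hprob := isProbabilityMeasure_tilted_neg hU hm hConv
  rw [gibbs_eq_prod hU]
  have h1 := eLpNorm_comp_measurePreserving (p := ENNReal.ofReal p)
    (f := (Prod.snd : E d × E d → E d))
    (g := fun x : E d => x) (by fun_prop)
    (measurePreserving_snd (μ := (volume : Measure (E d)).tilted fun x => -U x)
      (ν := stdGaussian (E d)))
  rw [show (fun z : Phase d => z.2) = (fun x : E d => x) ∘ Prod.snd from rfl, h1,
    stdGaussian_eq_tilted]
  have h := eLpNorm_tilted_le (d := d) (W := fun v => ‖v‖ ^ 2 / 2) (by fun_prop) ?_ one_pos ?_ hp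
  · simpa using h
  · refine (integrable_exp_neg_mul_norm_sq (V := E d) (b := 1 / 2) (by norm_num)).congr
      (Eventually.of_forall fun v => ?_)
    simp only; congr 1; ring
  · intro s hs x
    rw [norm_smul, Real.norm_of_nonneg (by linarith)]
    nlinarith [sq_nonneg (s * ‖x‖)]

end Moments

/-! ### Newton's equation and the local error of the Verlet step -/

section Arc

variable {F : Type*} [NormedAddCommGroup F] [NormedSpace ℝ F]

/-- `(x, v)` solves Newton's equation `x' = v`, `v' = -g(x)` on `[0, T]`. -/
structure IsHamiltonianArc (g : F → F) (T : ℝ) (x v : ℝ → F) : Prop where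
  pos : ∀ t ∈ Set.Icc 0 T, HasDerivWithinAt x (v t) (Set.Icc 0 T) t
  vel : ∀ t ∈ Set.Icc 0 T, HasDerivWithinAt v (-g (x t)) (Set.Icc 0 T) t

/-- A bound `B'` of the norm of the derivative integrates to a bound `B` of the norm. -/
theorem norm_le_of_norm_deriv_le {f f' : ℝ → F} {B B' : ℝ → ℝ} {T : ℝ}
    (hf : ∀ t ∈ Set.Icc 0 T, HasDerivWithinAt f (f' t) (Set.Icc 0 T) t) (h0 : ‖f 0‖ ≤ B 0)
    (hB : ∀ t, HasDerivAt B (B' t) t) (hb : ∀ t ∈ Set.Icc 0 T, ‖f' t‖ ≤ B' t) :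
    ∀ t ∈ Set.Icc 0 T, ‖f t‖ ≤ B t := by
  refine image_norm_le_of_norm_deriv_right_le_deriv_boundary
    (fun t ht => (hf t ht).continuousWithinAt) (fun t ht => ?_) h0 hB
    (fun t ht => hb t (Set.Ico_subset_Icc_self ht))
  exact (hf t (Set.Ico_subset_Icc_self ht)).mono_of_mem_nhdsWithin (Icc_mem_nhdsGE_of_mem ht)

theorem hasDerivAt_const_mul_pow (c : ℝ) (n : ℕ) (t : ℝ) :
    HasDerivAt (fun t : ℝ => c * t ^ (n + 1)) (c * ((n + 1 : ℕ) * t ^ n)) t := by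
  simpa using (hasDerivAt_pow (n + 1) t).const_mul c

/-- Newton's equation with an `L`-Lipschitz force has a solution on `[0, T]` if `T √L ≤ 1/3`: this
is Picard–Lindelöf with the velocity rescaled by `√L`, which makes the vector field
`√L`-Lipschitz. -/
theorem exists_isHamiltonianArc [CompleteSpace F] {g : F → F} {L T : ℝ} (hL : 0 < L) (hT : 0 ≤ T)
    (hg : ∀ x y, ‖g x - g y‖ ≤ L * ‖x - y‖) (hTL : 3 * (T * Real.sqrt L) ≤ 1) (z : F × F) :
    ∃ x v : ℝ → F, x 0 = z.1 ∧ v 0 = z.2 ∧ IsHamiltonianArc g T x v := by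
  set s := Real.sqrt L with hs
  have hs0 : 0 < s := Real.sqrt_pos.2 hL
  have hss : s * s = L := Real.mul_self_sqrt hL.le
  let f : F × F → F × F := fun y => (s • y.2, -(s⁻¹ • g y.1))
  have hf : ∀ y y', ‖f y - f y'‖ ≤ s * ‖y - y'‖ := fun y y' => by
    refine norm_prod_le_iff.2 ⟨?_, ?_⟩
    · change ‖s • y.2 - s • y'.2‖ ≤ _
      rw [← smul_sub, norm_smul, Real.norm_of_nonneg hs0.le]
      gcongr
      exact norm_snd_le (y - y')
    · change ‖-(s⁻¹ • g y.1) - -(s⁻¹ • g y'.1)‖ ≤ _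
      rw [← neg_sub', norm_neg, ← smul_sub, norm_smul, Real.norm_of_nonneg (by positivity)]
      calc s⁻¹ * ‖g y.1 - g y'.1‖ ≤ s⁻¹ * (L * ‖y.1 - y'.1‖) := by gcongr; exact hg _ _
        _ = s * ‖y.1 - y'.1‖ := by rw [← hss]; field_simp
        _ ≤ s * ‖y - y'‖ := by gcongr; exact norm_fst_le (y - y')
  let y₀ : F × F := (z.1, s⁻¹ • z.2)
  set C := ‖f y₀‖ with hC
  have hC0 : 0 ≤ C := norm_nonneg _
  let a : NNReal := ⟨2 * (C * T), by positivity⟩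
  let M : NNReal := ⟨C + s * (2 * (C * T)), by positivity⟩
  have hPL : IsPicardLindelof (fun _ => f) (⟨0, Set.left_mem_Icc.2 hT⟩ : Set.Icc (0 : ℝ) T) y₀ a 0
      M ⟨s, hs0.le⟩ := by
    refine IsPicardLindelof.of_time_independent (fun y hy => ?_) ?_ ?_
    · rw [mem_closedBall_iff_norm] at hy
      have h1 := norm_le_norm_add_norm_sub (f y₀) (f y)
      have h2 := hf y y₀
      have h3 : s * ‖y - y₀‖ ≤ s * (2 * (C * T)) := by gcongr; exact hy
      rw [norm_sub_rev] at h1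
      change ‖f y‖ ≤ C + s * (2 * (C * T))
      linarith
    · refine LipschitzOnWith.of_dist_le_mul fun y _ y' _ => ?_
      rw [dist_eq_norm, dist_eq_norm]
      exact hf y y'
    · simp only [sub_zero, NNReal.coe_zero, sub_self]
      rw [max_eq_left hT]
      change (C + s * (2 * (C * T))) * T ≤ 2 * (C * T)
      have := mul_le_mul_of_nonneg_left hTL (by positivity : 0 ≤ C * T)
      linarith [mul_nonneg hC0 hT]
  obtain ⟨α, hα0, hα⟩ := hPL.exists_eq_forall_mem_Icc_hasDerivWithinAt₀
  refine ⟨fun t => (α t).1, fun t => s • (α t).2, ?_, ?_, ⟨fun t ht => ?_, fun t ht => ?_⟩⟩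
  · change (α ((⟨0, Set.left_mem_Icc.2 hT⟩ : Set.Icc (0 : ℝ) T) : ℝ)).1 = _
    rw [hα0]
  · change s • (α ((⟨0, Set.left_mem_Icc.2 hT⟩ : Set.Icc (0 : ℝ) T) : ℝ)).2 = _
    rw [hα0, smul_inv_smul₀ hs0.ne']
  · exact (hα t ht).fst
  · have h : HasDerivWithinAt (fun t => (α t).2) (f (α t)).2 (Set.Icc 0 T) t := (hα t ht).snd
    refine (h.const_smul s).congr_deriv ?_
    simp only [f]
    rw [smul_neg, smul_inv_smul₀ hs0.ne']

namespace IsHamiltonianArc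

variable {g : F → F} {L T : ℝ} {x v : ℝ → F}

theorem continuousOn_pos (h : IsHamiltonianArc g T x v) : ContinuousOn x (Set.Icc 0 T) :=
  fun t ht => (h.pos t ht).continuousWithinAt

theorem continuousOn_vel (h : IsHamiltonianArc g T x v) : ContinuousOn v (Set.Icc 0 T) :=
  fun t ht => (h.vel t ht).continuousWithinAt

/-- A priori bounds in terms of `V = (|v₀| + T|g(x₀)|/2)/(1 - LT²/2)`, which bounds the average
speed from time `0`; the speed itself is at most `2V`. -/
theorem displacement_le (h : IsHamiltonianArc g T x v) (hL : 0 < L) (hT : 0 < T)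
    (hg : ∀ x y, ‖g x - g y‖ ≤ L * ‖x - y‖) (hTL : L * T ^ 2 / 2 < 1) {V : ℝ}
    (hV : ‖v 0‖ + T / 2 * ‖g (x 0)‖ = (1 - L * T ^ 2 / 2) * V) :
    (∀ t ∈ Set.Icc 0 T, ‖x t - x 0‖ ≤ V * t) ∧ (∀ t ∈ Set.Icc 0 T, ‖v t‖ ≤ 2 * V) := by
  have hV0 : 0 ≤ V := by
    have : 0 ≤ (1 - L * T ^ 2 / 2) * V := by rw [← hV]; positivity
    exact nonneg_of_mul_nonneg_right this (by linarith)
  obtain ⟨τ, hτ, hmax⟩ := isCompact_Icc.exists_isMaxOn (Set.nonempty_Icc.2 hT.le)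
    (f := fun t => ‖x t - x 0‖) (h.continuousOn_pos.sub continuousOn_const).norm
  set R := ‖x τ - x 0‖ with hR
  have hRmax : ∀ t ∈ Set.Icc 0 T, ‖x t - x 0‖ ≤ R := fun t ht => hmax ht
  have hR0 : 0 ≤ R := norm_nonneg _
  have hvel : ∀ t ∈ Set.Icc 0 T, ‖v t - v 0 + t • g (x 0)‖ ≤ L * R * t ^ (0 + 1) := by
    refine norm_le_of_norm_deriv_le (f' := fun t => -g (x t) + (1 : ℝ) • g (x 0)) (fun t ht => ?_)
      (by simp) (hasDerivAt_const_mul_pow (L * R) 0) (fun t ht => ?_)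
    · exact ((h.vel t ht).sub_const (v 0)).add
        ((hasDerivWithinAt_id t _).smul_const (g (x 0)))
    · rw [one_smul, neg_add_eq_sub]
      refine (hg _ _).trans ?_
      rw [norm_sub_rev]
      have := mul_le_mul_of_nonneg_left (hRmax t ht) hL.le
      simpa using this
  have hpos : ∀ t ∈ Set.Icc 0 T, ‖x t - x 0‖ ≤ (‖v 0‖ + t / 2 * ‖g (x 0)‖ + L * R / 2 * t) * t := by
    intro t ht
    have h1 : ∀ t ∈ Set.Icc 0 T, ‖x t - x 0 - t • v 0 + (t ^ 2 / 2) • g (x 0)‖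
        ≤ L * R / 2 * t ^ (1 + 1) := by
      refine norm_le_of_norm_deriv_le
        (f' := fun t => v t - (1 : ℝ) • v 0 + (2 * t / 2) • g (x 0)) (fun t ht => ?_)
        (by simp) (hasDerivAt_const_mul_pow (L * R / 2) 1) (fun t ht => ?_)
      · refine (((h.pos t ht).sub_const (x 0)).sub
          ((hasDerivWithinAt_id t _).smul_const (v 0))).add ?_
        have := (((hasDerivAt_pow 2 t).div_const 2).smul_const (g (x 0))).hasDerivWithinAt
          (s := Set.Icc 0 T)
        simpa using this
      · rw [one_smul, mul_div_cancel_left₀ t two_ne_zero]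
        refine (hvel t ht).trans (le_of_eq ?_)
        push_cast; ring
    have h2 := h1 t ht
    have e : x t - x 0 = (x t - x 0 - t • v 0 + (t ^ 2 / 2) • g (x 0)) + t • v 0
        - (t ^ 2 / 2) • g (x 0) := by abel
    have h3 : ‖x t - x 0‖ ≤ L * R / 2 * t ^ (1 + 1) + t * ‖v 0‖ + t ^ 2 / 2 * ‖g (x 0)‖ := by
      rw [e]
      refine (norm_sub_le _ _).trans (add_le_add ((norm_add_le _ _).trans (add_le_add h2 ?_)) ?_)
      · rw [norm_smul, Real.norm_of_nonneg ht.1]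
      · rw [norm_smul, Real.norm_of_nonneg (by positivity)]
    refine h3.trans (le_of_eq (by ring))
  -- evaluating at the farthest point closes the bound on `R`
  have hRle : R ≤ T * V := by
    have h1 := hpos τ hτ
    have h2 : (‖v 0‖ + τ / 2 * ‖g (x 0)‖ + L * R / 2 * τ) * τ ≤
        (‖v 0‖ + T / 2 * ‖g (x 0)‖ + L * R / 2 * T) * T := by
      have := hτ.2
      have := hτ.1
      gcongr
    rw [hV] at h2
    have h3 : (1 - L * T ^ 2 / 2) * R ≤ (1 - L * T ^ 2 / 2) * (T * V) := by
      rw [← hR] at h1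
      linarith
    exact le_of_mul_le_mul_left h3 (by linarith)
  constructor
  · intro t ht
    refine (hpos t ht).trans (mul_le_mul_of_nonneg_right ?_ ht.1)
    have h1 : t / 2 * ‖g (x 0)‖ ≤ T / 2 * ‖g (x 0)‖ := by gcongr; exact ht.2
    have h2 : L * R / 2 * t ≤ L * (T * V) / 2 * T := by
      have := ht.1; gcongr; exact ht.2
    linarith
  · intro t ht
    have h1 := hvel t ht
    have e : v t = (v t - v 0 + t • g (x 0)) + v 0 - t • g (x 0) := by abel
    have h2 : ‖v t‖ ≤ L * R * t ^ (0 + 1) + ‖v 0‖ + t * ‖g (x 0)‖ := by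
      rw [e]
      refine (norm_sub_le _ _).trans
        (add_le_add ((norm_add_le _ _).trans (add_le_add ?_ le_rfl)) ?_)
      · simpa using h1
      · rw [norm_smul, Real.norm_of_nonneg ht.1]
    have h3 : L * R * t ≤ L * (T * V) * T := by
      have := ht.1; gcongr; exact ht.2
    have h4 : t * ‖g (x 0)‖ ≤ T * ‖g (x 0)‖ := by gcongr; exact ht.2
    have := norm_nonneg (v 0)
    simp only [zero_add, pow_one] at h2
    linarith

/-- One velocity-Verlet step of length `T` against the exact arc. The Verlet position is the
second-order Taylor polynomial of the arc, and the Verlet velocity is the trapezoidal rule for the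
integral of the force. As the force is only Lipschitz, the trapezoidal error is of order `T²`, with
coefficient `3 / 4` since a force at time `t` is compared with both end points, at distances at most
`V t` and `2 V (T - t)`. The term in `T⁴` comes from the error of the final position. -/
theorem verlet_error (h : IsHamiltonianArc g T x v) (hL : 0 < L) (hT : 0 < T)
    (hg : ∀ x y, ‖g x - g y‖ ≤ L * ‖x - y‖) (hTL : L * T ^ 2 / 2 < 1) {V : ℝ}
    (hV : ‖v 0‖ + T / 2 * ‖g (x 0)‖ = (1 - L * T ^ 2 / 2) * V) :
    ‖x T - (x 0 + T • (v 0 - (T / 2) • g (x 0)))‖ ≤ L * V / 6 * T ^ 3 ∧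
    ‖v T - (v 0 - (T / 2) • g (x 0)
        - (T / 2) • g (x 0 + T • (v 0 - (T / 2) • g (x 0))))‖ ≤
      3 / 4 * (L * V * T ^ 2) + L ^ 2 * V / 12 * T ^ 4 := by
  obtain ⟨hx, hv⟩ := h.displacement_le hL hT hg hTL hV
  have hTmem : T ∈ Set.Icc 0 T := Set.right_mem_Icc.2 hT.le
  have hvel : ∀ t ∈ Set.Icc 0 T, ‖v t - v 0 + t • g (x 0)‖ ≤ L * V / 2 * t ^ (1 + 1) := by
    refine norm_le_of_norm_deriv_le (f' := fun t => -g (x t) + (1 : ℝ) • g (x 0)) (fun t ht => ?_)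
      (by simp) (hasDerivAt_const_mul_pow (L * V / 2) 1) (fun t ht => ?_)
    · exact ((h.vel t ht).sub_const (v 0)).add
        ((hasDerivWithinAt_id t _).smul_const (g (x 0)))
    · rw [one_smul, neg_add_eq_sub]
      refine (hg _ _).trans ?_
      rw [norm_sub_rev]
      refine (mul_le_mul_of_nonneg_left (hx t ht) hL.le).trans (le_of_eq ?_)
      push_cast; ring
  have hpos : ∀ t ∈ Set.Icc 0 T, ‖x t - x 0 - t • v 0 + (t ^ 2 / 2) • g (x 0)‖
      ≤ L * V / 6 * t ^ (2 + 1) := by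
    refine norm_le_of_norm_deriv_le
      (f' := fun t => v t - (1 : ℝ) • v 0 + (2 * t / 2) • g (x 0)) (fun t ht => ?_)
      (by simp) (hasDerivAt_const_mul_pow (L * V / 6) 2) (fun t ht => ?_)
    · refine (((h.pos t ht).sub_const (x 0)).sub
        ((hasDerivWithinAt_id t _).smul_const (v 0))).add ?_
      have := (((hasDerivAt_pow 2 t).div_const 2).smul_const (g (x 0))).hasDerivWithinAt
        (s := Set.Icc 0 T)
      simpa using this
    · rw [one_smul, mul_div_cancel_left₀ t two_ne_zero]
      refine (hvel t ht).trans (le_of_eq ?_)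
      push_cast; ring
  have hxT : ‖x T - (x 0 + T • (v 0 - (T / 2) • g (x 0)))‖ ≤ L * V / 6 * T ^ 3 := by
    have := hpos T hTmem
    have e : x T - (x 0 + T • (v 0 - (T / 2) • g (x 0))) =
        x T - x 0 - T • v 0 + (T ^ 2 / 2) • g (x 0) := by module
    rw [e]; exact this
  refine ⟨hxT, ?_⟩
  -- the displacement from the end point
  have hend : ∀ t ∈ Set.Icc 0 T, ‖x t - x T‖ ≤ 2 * V * (T - t) := fun t ht => by
    have := (convex_Icc (0 : ℝ) T).norm_image_sub_le_of_norm_hasDerivWithin_le h.pos hv hTmem ht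
    rw [Real.norm_eq_abs, abs_of_nonpos (by linarith [ht.2])] at this
    linarith
  have htrap : ∀ t ∈ Set.Icc 0 T, ‖v t - v 0 + (t / 2) • (g (x 0) + g (x T))‖ ≤
      L * V * T * t + -(L * V / 4) * t ^ (1 + 1) := by
    refine norm_le_of_norm_deriv_le
      (f' := fun t => -g (x t) + ((1 : ℝ) / 2) • (g (x 0) + g (x T))) (fun t ht => ?_)
      (by simp) (fun t => ((hasDerivAt_id t).const_mul (L * V * T)).add
        (hasDerivAt_const_mul_pow (-(L * V / 4)) 1 t)) (fun t ht => ?_)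
    · exact ((h.vel t ht).sub_const (v 0)).add
        (((hasDerivWithinAt_id t _).div_const 2).smul_const (g (x 0) + g (x T)))
    · have e : -g (x t) + ((1 : ℝ) / 2) • (g (x 0) + g (x T)) =
          -(((1 : ℝ) / 2) • (g (x t) - g (x 0)) + ((1 : ℝ) / 2) • (g (x t) - g (x T))) := by module
      rw [e, norm_neg]
      refine (norm_add_le _ _).trans ?_
      rw [norm_smul, norm_smul, Real.norm_of_nonneg (by norm_num)]
      have h1 := (hg (x t) (x 0)).trans (mul_le_mul_of_nonneg_left (hx t ht) hL.le)
      have h2 := (hg (x t) (x T)).trans (mul_le_mul_of_nonneg_left (hend t ht) hL.le)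
      push_cast
      linarith
  have h1 := htrap T hTmem
  set x' := x 0 + T • (v 0 - (T / 2) • g (x 0)) with hx'
  have e : v T - (v 0 - (T / 2) • g (x 0) - (T / 2) • g x') =
      (v T - v 0 + (T / 2) • (g (x 0) + g (x T))) - (T / 2) • (g (x T) - g x') := by module
  rw [e]
  refine (norm_sub_le _ _).trans ?_
  rw [norm_smul, Real.norm_of_nonneg (by positivity)]
  have h2 := (hg (x T) x').trans (mul_le_mul_of_nonneg_left hxT hL.le)
  have h3 := mul_le_mul_of_nonneg_left h2 (by positivity : 0 ≤ T / 2)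
  calc _ ≤ L * V * T * T + -(L * V / 4) * T ^ (1 + 1) + T / 2 * (L * (L * V / 6 * T ^ 3)) :=
        add_le_add h1 h3
    _ = _ := by ring

end IsHamiltonianArc

end Arc

section Euler

/-! ### The Hamiltonian flow preserves the Gibbs measure -/

/-- One step of the symplectic Euler scheme, a composition of two shears. -/
def eulerStep {F : Type*} [NormedAddCommGroup F] [NormedSpace ℝ F] (g : F → F) (h : ℝ)
    (z : F × F) : F × F :=
  (z.1 + h • z.2, z.2 - h • g (z.1 + h • z.2))

variable {F : Type*} [NormedAddCommGroup F] [NormedSpace ℝ F] {g : F → F} {L T : ℝ}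

theorem norm_eulerStep_sub_le (hL : 0 < L) (hg : ∀ x y, ‖g x - g y‖ ≤ L * ‖x - y‖) {h : ℝ}
    (hh : 0 ≤ h) (hhT : h ≤ T) (z z' : F × F) :
    ‖eulerStep g h z - eulerStep g h z'‖ ≤ (1 + h * (1 + L * (1 + T))) * ‖z - z'‖ := by
  have h1 : ‖z.1 - z'.1‖ ≤ ‖z - z'‖ := norm_fst_le (z - z')
  have h2 : ‖z.2 - z'.2‖ ≤ ‖z - z'‖ := norm_snd_le (z - z')
  have hn := norm_nonneg (z - z')
  have hpos : ‖(z.1 + h • z.2) - (z'.1 + h • z'.2)‖ ≤ (1 + h) * ‖z - z'‖ := by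
    have e : (z.1 + h • z.2) - (z'.1 + h • z'.2) = (z.1 - z'.1) + h • (z.2 - z'.2) := by module
    rw [e]
    refine (norm_add_le _ _).trans ?_
    rw [norm_smul, Real.norm_of_nonneg hh]
    have := mul_le_mul_of_nonneg_left h2 hh
    linarith
  refine norm_prod_le_iff.2 ⟨hpos.trans ?_, ?_⟩
  · refine mul_le_mul_of_nonneg_right ?_ hn
    have : 0 ≤ h * (L * (1 + T)) := by have := hh.trans hhT; positivity
    linarith
  · change ‖(z.2 - h • g (z.1 + h • z.2)) - (z'.2 - h • g (z'.1 + h • z'.2))‖ ≤ _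
    have e : (z.2 - h • g (z.1 + h • z.2)) - (z'.2 - h • g (z'.1 + h • z'.2)) =
        (z.2 - z'.2) - h • (g (z.1 + h • z.2) - g (z'.1 + h • z'.2)) := by module
    rw [e]
    refine (norm_sub_le _ _).trans ?_
    rw [norm_smul, Real.norm_of_nonneg hh]
    have h3 : h * ‖g (z.1 + h • z.2) - g (z'.1 + h • z'.2)‖ ≤
        h * (L * ((1 + T) * ‖z - z'‖)) := by
      gcongr
      refine (hg _ _).trans (mul_le_mul_of_nonneg_left (hpos.trans ?_) hL.le)
      gcongr
    have h4 : 0 ≤ h * ‖z - z'‖ := by positivity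
    linarith

/-- The symplectic Euler scheme converges to the solution of Newton's equation. -/
theorem tendsto_iterate_eulerStep {x v : ℝ → F} (harc : IsHamiltonianArc g T x v) (hL : 0 < L)
    (hT : 0 < T) (hg : ∀ x y, ‖g x - g y‖ ≤ L * ‖x - y‖) :
    Tendsto (fun n : ℕ => (eulerStep g (T / (n + 1)))^[n + 1] (x 0, v 0)) atTop
      (𝓝 (x T, v T)) := by
  have hgc : Continuous g := (LipschitzWith.of_dist_le_mul (K := ⟨L, hL.le⟩) fun x y => by
    rw [dist_eq_norm, dist_eq_norm]; exact hg x y).continuous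
  obtain ⟨B, hB⟩ := isCompact_Icc.exists_bound_of_continuousOn harc.continuousOn_vel
  obtain ⟨C, hC⟩ := isCompact_Icc.exists_bound_of_continuousOn
    (hgc.comp_continuousOn harc.continuousOn_pos)
  have hB0 : 0 ≤ B := (norm_nonneg _).trans (hB 0 (Set.left_mem_Icc.2 hT.le))
  have hC0 : 0 ≤ C := (norm_nonneg _).trans (hC 0 (Set.left_mem_Icc.2 hT.le))
  -- local error, of order `h²`
  have hlocal : ∀ t h : ℝ, 0 ≤ t → 0 ≤ h → t + h ≤ T →
      ‖(x (t + h), v (t + h)) - eulerStep g h (x t, v t)‖ ≤ (C + 2 * L * B) * h ^ 2 := by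
    intro t h ht hh hth
    have hsub : Set.Icc t (t + h) ⊆ Set.Icc 0 T := Set.Icc_subset_Icc ht hth
    have hl : t ∈ Set.Icc t (t + h) := Set.left_mem_Icc.2 (by linarith)
    have hr : t + h ∈ Set.Icc t (t + h) := Set.right_mem_Icc.2 (by linarith)
    have hconv : Convex ℝ (Set.Icc t (t + h)) := convex_Icc _ _
    have hnh : ∀ s ∈ Set.Icc t (t + h), ‖s - t‖ ≤ h := fun s hs => by
      rw [Real.norm_eq_abs, abs_le]; constructor <;> linarith [hs.1, hs.2]
    have hvs : ∀ s ∈ Set.Icc t (t + h), ‖v s - v t‖ ≤ C * h := fun s hs => by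
      have := hconv.norm_image_sub_le_of_norm_hasDerivWithin_le (C := C)
        (fun s hs => (harc.vel s (hsub hs)).mono hsub)
        (fun s hs => by rw [norm_neg]; exact hC s (hsub hs)) hl hs
      exact this.trans (mul_le_mul_of_nonneg_left (hnh s hs) hC0)
    have hxs : ∀ s ∈ Set.Icc t (t + h), ‖x s - x t‖ ≤ B * h := fun s hs => by
      have := hconv.norm_image_sub_le_of_norm_hasDerivWithin_le (C := B)
        (fun s hs => (harc.pos s (hsub hs)).mono hsub) (fun s hs => hB s (hsub hs)) hl hs
      exact this.trans (mul_le_mul_of_nonneg_left (hnh s hs) hB0)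
    have hBh : ‖h • v t‖ ≤ B * h := by
      rw [norm_smul, Real.norm_of_nonneg hh, mul_comm]
      exact mul_le_mul_of_nonneg_right (hB t (hsub hl)) hh
    refine norm_prod_le_iff.2 ⟨?_, ?_⟩
    · have h1 := hconv.norm_image_sub_le_of_norm_hasDerivWithin_le
        (f := fun s => x s - s • v t) (f' := fun s => v s - (1 : ℝ) • v t) (C := C * h)
        (fun s hs => ((harc.pos s (hsub hs)).mono hsub).sub
          ((hasDerivWithinAt_id s _).smul_const (v t)))
        (fun s hs => by rw [one_smul]; exact hvs s hs) hl hr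
      have e : (x (t + h), v (t + h)).1 - (eulerStep g h (x t, v t)).1 =
          (x (t + h) - (t + h) • v t) - (x t - t • v t) := by
        simp only [eulerStep]; module
      have h2 : 0 ≤ 2 * L * B * h ^ 2 := by positivity
      rw [Prod.fst_sub, e]
      refine h1.trans ?_
      have := mul_le_mul_of_nonneg_left (hnh (t + h) hr) (mul_nonneg hC0 hh)
      linarith
    · set y := x t + h • v t with hy
      have h1 := hconv.norm_image_sub_le_of_norm_hasDerivWithin_le
        (f := fun s => v s + s • g y) (f' := fun s => -g (x s) + (1 : ℝ) • g y)
        (C := L * (2 * (B * h)))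
        (fun s hs => ((harc.vel s (hsub hs)).mono hsub).add
          ((hasDerivWithinAt_id s _).smul_const (g y)))
        (fun s hs => ?_) hl hr
      · have e : (x (t + h), v (t + h)).2 - (eulerStep g h (x t, v t)).2 =
            (v (t + h) + (t + h) • g y) - (v t + t • g y) := by
          simp only [eulerStep, ← hy]; module
        have h2 : 0 ≤ C * h ^ 2 := by positivity
        rw [Prod.snd_sub, e]
        refine h1.trans ?_
        have := mul_le_mul_of_nonneg_left (hnh (t + h) hr)
          (by positivity : 0 ≤ L * (2 * (B * h)))
        linarith
      · rw [one_smul, neg_add_eq_sub, norm_sub_rev]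
        refine (hg _ _).trans (mul_le_mul_of_nonneg_left ?_ hL.le)
        have e : x s - y = (x s - x t) - h • v t := by rw [hy]; abel
        rw [e]
        refine (norm_sub_le _ _).trans ?_
        linarith [hxs s hs]
  set K := 1 + L * (1 + T) with hK
  have hK0 : 0 ≤ K := by positivity
  set D := C + 2 * L * B with hD
  have hD0 : 0 ≤ D := by positivity
  -- the local errors are amplified by at most `e^{TK}`
  have hglobal : ∀ n : ℕ, ‖(eulerStep g (T / (n + 1)))^[n + 1] (x 0, v 0) - (x T, v T)‖ ≤
      Real.exp (T * K) * (D * T) * (T / (n + 1)) := by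
    intro n
    set h := T / ((n : ℝ) + 1) with hh
    have hn0 : (0 : ℝ) < (n : ℝ) + 1 := by positivity
    have hh0 : 0 < h := by positivity
    have hnh : ((n : ℝ) + 1) * h = T := by rw [hh]; field_simp
    have hhT : h ≤ T := by nlinarith [Nat.cast_nonneg (α := ℝ) n]
    have hind : ∀ k : ℕ, k ≤ n + 1 →
        ‖(eulerStep g h)^[k] (x 0, v 0) - (x (k * h), v (k * h))‖ ≤
          Real.exp (h * K) ^ k * (k * (D * h ^ 2)) := by
      intro k
      induction k with
      | zero => intro _; simp
      | succ k ih =>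
        intro hk
        have hkn : (k : ℝ) + 1 ≤ n + 1 := by exact_mod_cast hk
        have ih := ih (by omega)
        rw [Function.iterate_succ_apply']
        have h1 := norm_eulerStep_sub_le hL hg hh0.le hhT ((eulerStep g h)^[k] (x 0, v 0))
          (x (k * h), v (k * h))
        have h2 := hlocal (k * h) h (by positivity) hh0.le (by
          rw [← hnh]; have := mul_le_mul_of_nonneg_right hkn hh0.le; linarith)
        have e : ((k + 1 : ℕ) : ℝ) * h = k * h + h := by push_cast; ring
        rw [e]
        have hexp : 1 + h * K ≤ Real.exp (h * K) := by linarith [Real.add_one_le_exp (h * K)]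
        have hexp1 : 1 ≤ Real.exp (h * K) ^ (k + 1) :=
          one_le_pow₀ (Real.one_le_exp (by positivity))
        have h3 : (1 + h * K) * ‖(eulerStep g h)^[k] (x 0, v 0) - (x (k * h), v (k * h))‖ ≤
            Real.exp (h * K) * (Real.exp (h * K) ^ k * (k * (D * h ^ 2))) := by
          gcongr
        have h4 : 1 * (D * h ^ 2) ≤ Real.exp (h * K) ^ (k + 1) * (D * h ^ 2) := by gcongr
        calc ‖eulerStep g h ((eulerStep g h)^[k] (x 0, v 0)) - (x (k * h + h), v (k * h + h))‖
            ≤ ‖eulerStep g h ((eulerStep g h)^[k] (x 0, v 0)) -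
                eulerStep g h (x (k * h), v (k * h))‖ +
              ‖eulerStep g h (x (k * h), v (k * h)) - (x (k * h + h), v (k * h + h))‖ :=
              norm_sub_le_norm_sub_add_norm_sub _ _ _
          _ ≤ Real.exp (h * K) * (Real.exp (h * K) ^ k * (k * (D * h ^ 2))) +
              Real.exp (h * K) ^ (k + 1) * (D * h ^ 2) := by
              refine add_le_add (h1.trans h3) ?_
              rw [norm_sub_rev]
              linarith
          _ = _ := by push_cast; ring
    have h1 := hind (n + 1) le_rfl
    push_cast at h1
    rw [hnh] at h1
    refine h1.trans (le_of_eq ?_)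
    rw [← Real.exp_nat_mul]
    push_cast
    rw [← mul_assoc _ h K, hnh]
    have : ((n : ℝ) + 1) * (D * h ^ 2) = D * (((n : ℝ) + 1) * h) * h := by ring
    rw [this, hnh]
    ring
  rw [tendsto_iff_norm_sub_tendsto_zero]
  refine squeeze_zero (fun _ => norm_nonneg _) hglobal ?_
  have := (tendsto_one_div_add_atTop_nhds_zero_nat (𝕜 := ℝ)).const_mul
    (Real.exp (T * K) * (D * T) * T)
  rw [mul_zero] at this
  refine this.congr fun n => ?_
  ring

end Euler

section Volume

variable {d : ℕ}

theorem measurePreserving_shear_snd {f : E d → E d} (hf : Continuous f) :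
    MeasurePreserving (fun z : Phase d => (z.1, z.2 + f z.1)) := by
  rw [Measure.volume_eq_prod]
  exact (MeasurePreserving.id volume).skew_product (g := fun x v => v + f x) (by fun_prop)
    (Eventually.of_forall fun x => (measurePreserving_add_right volume (f x)).map_eq)

theorem measurePreserving_shear_fst {f : E d → E d} (hf : Continuous f) :
    MeasurePreserving (fun z : Phase d => (z.1 + f z.2, z.2)) := by
  have hs : MeasurePreserving (Prod.swap : Phase d → Phase d) := by
    rw [Measure.volume_eq_prod]; exact Measure.measurePreserving_swap
  exact (hs.comp (measurePreserving_shear_snd hf)).comp hs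

theorem measurePreserving_eulerStep {g : E d → E d} (hg : Continuous g) (h : ℝ) :
    MeasurePreserving (eulerStep g h : Phase d → Phase d) := by
  have h1 := measurePreserving_shear_fst (d := d) (f := fun v => h • v) (by fun_prop)
  have h2 := measurePreserving_shear_snd (d := d) (f := fun x => -(h • g x)) (by fun_prop)
  convert h2.comp h1 using 1
  ext1 z
  simp only [eulerStep, Function.comp_apply, sub_eq_add_neg]

end Volume

section Flow

variable {d : ℕ} {U : E d → ℝ} {L m T : ℝ}

/-- Conservation of energy. -/
theorem IsHamiltonianArc.hamiltonian_eq (hU : ContDiff ℝ 2 U) {x v : ℝ → E d} (hT : 0 ≤ T)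
    (h : IsHamiltonianArc (∇ U) T x v) :
    hamiltonian U (x T, v T) = hamiltonian U (x 0, v 0) := by
  have hd : ∀ t ∈ Set.Icc 0 T, HasDerivWithinAt (fun t => U (x t) + ‖v t‖ ^ 2 / 2) 0
      (Set.Icc 0 T) t := fun t ht => by
    have h1 : HasDerivWithinAt (fun t => U (x t)) (inner ℝ (∇ U (x t)) (v t)) (Set.Icc 0 T) t := by
      have := (hasGradientAt_gradient hU (x t)).hasFDerivAt.comp_hasDerivWithinAt t (h.pos t ht)
      simpa [Function.comp_def] using this
    have h2 := ((h.vel t ht).norm_sq).div_const 2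
    refine (h1.add h2).congr_deriv ?_
    rw [inner_neg_right, real_inner_comm (v t)]
    ring
  exact constant_of_has_deriv_right_zero (fun t ht => (hd t ht).continuousWithinAt)
    (fun t ht => (hd t (Set.Ico_subset_Icc_self ht)).mono_of_mem_nhdsWithin
      (Icc_mem_nhdsGE_of_mem ht)) T (Set.right_mem_Icc.2 hT)

/-- If the density were not integrable, `Measure.tilted` would return the zero measure. -/
theorem integrable_exp_neg_hamiltonian (hU : ContDiff ℝ 2 U) (hm : 0 < m)
    (hConv : StrongConv U m) : Integrable (fun z : Phase d => Real.exp (-hamiltonian U z)) := by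
  by_contra h
  have := isProbabilityMeasure_gibbs hU hm hConv
  have h0 : gibbs U = 0 := tilted_of_not_integrable h
  rw [h0] at this
  exact IsProbabilityMeasure.ne_zero (0 : Measure (Phase d)) rfl

/-- An energy-preserving pointwise limit of volume-preserving maps preserves the Gibbs measure.
Fatou's lemma gives `∫ f ∘ Φ dπ ≤ ∫ f dπ` for continuous `f ≥ 0`; since `π` has finite mass,
applying this to `c - f` as well gives equality for bounded `f`. -/
theorem map_gibbs_of_tendsto (hU : ContDiff ℝ 2 U) (hm : 0 < m) (hConv : StrongConv U m)
    {Φ : Phase d → Phase d} {σ : ℕ → Phase d → Phase d} (hσ : ∀ n, MeasurePreserving (σ n))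
    (hlim : ∀ z, Tendsto (fun n => σ n z) atTop (𝓝 (Φ z)))
    (hH : ∀ z, hamiltonian U (Φ z) = hamiltonian U z) :
    Measurable Φ ∧ (gibbs U).map Φ = gibbs U := by
  have hΦ : Measurable Φ := measurable_of_tendsto_metrizable (fun n => (hσ n).measurable)
    (tendsto_pi_nhds.2 hlim)
  refine ⟨hΦ, ?_⟩
  have := isProbabilityMeasure_gibbs hU hm hConv
  have hHc : Continuous (hamiltonian U) := by
    have := hU.continuous
    unfold hamiltonian
    fun_prop
  set Z := ∫ z : Phase d, Real.exp (-hamiltonian U z) with hZ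
  have hint : ∀ f : Phase d → ℝ≥0∞, ∫⁻ z, f z ∂gibbs U =
      ∫⁻ z, ENNReal.ofReal (Real.exp (-hamiltonian U z) / Z) * f z := fun f => by
    rw [gibbs, lintegral_tilted]
  have hle : ∀ f : Phase d → NNReal, Continuous f →
      ∫⁻ z, f (Φ z) ∂gibbs U ≤ ∫⁻ z, f z ∂gibbs U := fun f hf => by
    rw [hint, hint]
    set w : Phase d → ℝ≥0∞ := fun z => ENNReal.ofReal (Real.exp (-hamiltonian U z) / Z) * f z
      with hw
    have hwc : Continuous w := by
      have h : Continuous fun z =>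
          ((Real.toNNReal (Real.exp (-hamiltonian U z) / Z) * f z : NNReal) : ℝ≥0∞) := by fun_prop
      exact h.congr fun z => ENNReal.coe_mul _ _
    calc ∫⁻ z, ENNReal.ofReal (Real.exp (-hamiltonian U z) / Z) * f (Φ z)
        = ∫⁻ z, liminf (fun n => w (σ n z)) atTop := lintegral_congr fun z => by
          have h : Tendsto (fun n => w (σ n z)) atTop (𝓝 (w (Φ z))) :=
            (hwc.tendsto _).comp (hlim z)
          rw [h.liminf_eq, hw]
          simp only [hH]
      _ ≤ liminf (fun n => ∫⁻ z, w (σ n z)) atTop :=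
          lintegral_liminf_le fun n => hwc.measurable.comp (hσ n).measurable
      _ = liminf (fun _ : ℕ => ∫⁻ z, w z) atTop := by
          congr with n
          exact (hσ n).lintegral_comp hwc.measurable
      _ = _ := by simp
  have := Measure.isProbabilityMeasure_map (μ := gibbs U) hΦ.aemeasurable
  refine ext_of_forall_lintegral_eq_of_IsFiniteMeasure fun f => ?_
  rw [lintegral_map (by fun_prop) hΦ]
  obtain ⟨c, hc⟩ : ∃ c : NNReal, ∀ z, f z ≤ c := ⟨_, f.apply_le_nndist_zero⟩
  have h1 := hle f f.continuous
  have h2 := hle (fun z => c - f z) (by fun_prop)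
  have hsum : ∀ g : Phase d → Phase d, Measurable g →
      ∫⁻ z, f (g z) ∂gibbs U + ∫⁻ z, ((c - f (g z) : NNReal) : ℝ≥0∞) ∂gibbs U = c := fun g hg => by
    rw [← lintegral_add_left (by fun_prop)]
    have : ∀ z, (f (g z) : ℝ≥0∞) + ((c - f (g z) : NNReal) : ℝ≥0∞) = c := fun z => by
      rw [← ENNReal.coe_add, add_tsub_cancel_of_le (hc _)]
    rw [lintegral_congr this]
    simp
  have e1 := hsum Φ hΦ
  have e2 := hsum id measurable_id
  simp only [id] at e2
  refine le_antisymm h1 ?_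
  have hfin : ∫⁻ z, ((c - f (Φ z) : NNReal) : ℝ≥0∞) ∂gibbs U ≠ ∞ := by
    refine ne_top_of_le_ne_top ENNReal.coe_ne_top (b := (c : ℝ≥0∞)) ?_
    rw [← e1]; exact le_add_self
  refine (ENNReal.add_le_add_iff_right hfin).1 ?_
  rw [e1, ← e2]
  gcongr

/-- The velocity-Verlet integrator, the `BAB` part of the scheme. -/
def verlet (U : E d → ℝ) (δ : ℝ) (z : Phase d) : Phase d := stepB U δ (stepA δ (stepB U δ z))

/-- The time-`δ` Hamiltonian flow: it preserves the Gibbs measure and is close to one Verlet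
step. The number `V` is the bound of the average speed of `IsHamiltonianArc.displacement_le`. -/
theorem exists_hamiltonian_flow (hU : ContDiff ℝ 2 U) (hL : 0 < L) (hm : 0 < m)
    (hLip : GradLip U L) (hConv : StrongConv U m) {δ : ℝ} (hδ : 0 < δ)
    (hδL : δ ^ 2 * L ≤ 1 / 9) :
    ∃ Φ : Phase d → Phase d, Measurable Φ ∧ (gibbs U).map Φ = gibbs U ∧
      ∀ z V, ‖z.2‖ + δ / 2 * ‖∇ U z.1‖ = (1 - L * δ ^ 2 / 2) * V →
        phaseDist (Φ z) (verlet U δ z) ≤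
          L * δ ^ 2 * (3 / 4 + δ / 6 + L * δ ^ 2 / 12) * V := by
  have hsq : 3 * (δ * Real.sqrt L) ≤ 1 := by
    have h : (3 * (δ * Real.sqrt L)) ^ 2 ≤ 1 ^ 2 := by
      rw [mul_pow, mul_pow, Real.sq_sqrt hL.le]; linarith
    exact abs_le_of_sq_le_sq' h zero_le_one |>.2
  choose x v hx0 hv0 harc using fun z : Phase d => exists_isHamiltonianArc hL hδ.le hLip hsq z
  have hz : ∀ z, (x z 0, v z 0) = z := fun z => by rw [hx0, hv0]
  obtain ⟨h1, h2⟩ := map_gibbs_of_tendsto hU hm hConv (Φ := fun z => (x z δ, v z δ))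
    (σ := fun n => (eulerStep (∇ U) (δ / (n + 1)))^[n + 1])
    (fun n => (measurePreserving_eulerStep (continuous_gradient hU) _).iterate _)
    (fun z => by simpa only [hz] using tendsto_iterate_eulerStep (harc z) hL hδ hLip)
    (fun z => by rw [(harc z).hamiltonian_eq hU hδ.le, hz])
  refine ⟨_, h1, h2, fun z V hV => ?_⟩
  obtain ⟨e1, e2⟩ := (harc z).verlet_error hL hδ hLip (by linarith) (V := V) (by
    rw [hx0, hv0]; exact hV)
  rw [hx0, hv0] at e1 e2
  rw [phaseDist_eq]
  have h3 : Real.sqrt (‖((x z δ, v z δ) - verlet U δ z).1‖ ^ 2 +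
      ‖((x z δ, v z δ) - verlet U δ z).2‖ ^ 2) ≤
      ‖((x z δ, v z δ) - verlet U δ z).1‖ + ‖((x z δ, v z δ) - verlet U δ z).2‖ := by
    refine Real.sqrt_le_iff.2 ⟨by positivity, ?_⟩
    nlinarith [mul_nonneg (norm_nonneg ((x z δ, v z δ) - verlet U δ z).1)
      (norm_nonneg ((x z δ, v z δ) - verlet U δ z).2)]
  refine h3.trans ((add_le_add e1 e2).trans (le_of_eq ?_))
  ring

end Flow

/-! ### Random iterations -/

section Shift

variable {G : Type*} [MeasurableSpace G] (μ : Measure G) [IsProbabilityMeasure μ]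

/-- Putting an independent copy in front of an i.i.d. sequence gives an i.i.d. sequence. -/
theorem measurePreserving_cons :
    MeasurePreserving (fun p : G × (ℕ → G) => fun n : ℕ => Nat.casesOn n p.1 p.2)
      (μ.prod (Measure.infinitePi fun _ : ℕ => μ)) (Measure.infinitePi fun _ : ℕ => μ) := by
  have hm : Measurable (fun p : G × (ℕ → G) => fun n : ℕ => (Nat.casesOn n p.1 p.2 : G)) := by
    refine measurable_pi_iff.2 fun n => ?_
    cases n with
    | zero => exact measurable_fst
    | succ n => exact (measurable_pi_apply n).comp measurable_snd
  refine ⟨hm, Measure.eq_infinitePi _ fun s t ht => ?_⟩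
  -- enlarge the box to one indexed by an initial segment
  obtain ⟨N, hN⟩ : ∃ N, s ⊆ Finset.range (N + 1) :=
    ⟨s.sup id, fun i hi => Finset.mem_range_succ_iff.2 (Finset.le_sup (f := id) hi)⟩
  classical
  set T : ℕ → Set G := fun i => if i ∈ s then t i else Set.univ with hT
  have hTm : ∀ i, MeasurableSet (T i) := fun i => by
    simp only [hT]; split_ifs
    exacts [ht i, .univ]
  have hbox : Set.pi (s : Set ℕ) t = Set.pi (Finset.range (N + 1) : Set ℕ) T := by
    ext ω
    simp only [Set.mem_pi, hT]
    constructor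
    · intro h i _
      split_ifs with hi
      exacts [h i hi, trivial]
    · intro h i hi
      have := h i (hN hi)
      rwa [if_pos (by simpa using hi)] at this
  have hprod : ∏ i ∈ s, μ (t i) = ∏ i ∈ Finset.range (N + 1), μ (T i) := by
    rw [← Finset.prod_subset hN (fun i _ hi => by simp [hT, hi])]
    exact Finset.prod_congr rfl fun i hi => by simp [hT, hi]
  have hpre : (fun p : G × (ℕ → G) => fun n : ℕ => (Nat.casesOn n p.1 p.2 : G)) ⁻¹'
      (Set.pi (Finset.range (N + 1) : Set ℕ) T) =
      T 0 ×ˢ Set.pi (Finset.range N : Set ℕ) (fun i => T (i + 1)) := by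
    ext p
    simp only [Set.mem_preimage, Set.mem_pi, Finset.coe_range, Set.mem_Iio, Set.mem_prod]
    constructor
    · intro h
      exact ⟨h 0 (Nat.succ_pos _), fun i hi => h (i + 1) (Nat.succ_lt_succ hi)⟩
    · rintro ⟨h0, h⟩ i hi
      cases i with
      | zero => exact h0
      | succ i => exact h i (Nat.lt_of_succ_lt_succ hi)
  rw [hbox, Measure.map_apply hm
    (MeasurableSet.pi (Finset.countable_toSet _) fun i _ => hTm i), hpre, Measure.prod_prod,
    Measure.infinitePi_pi _ fun i _ => hTm (i + 1), hprod, Finset.prod_range_succ', mul_comm]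

/-- The tail and the head of an i.i.d. sequence are independent, and the tail has the law of the
sequence. -/
theorem measurePreserving_head_tail :
    MeasurePreserving (fun ω : ℕ → G => ((fun n => ω (n + 1)), ω 0))
      (Measure.infinitePi fun _ : ℕ => μ) ((Measure.infinitePi fun _ : ℕ => μ).prod μ) := by
  have hm : Measurable (fun ω : ℕ → G => ((fun n => ω (n + 1)), ω 0)) := by fun_prop
  refine ⟨hm, ?_⟩
  rw [← (measurePreserving_cons μ).map_eq, Measure.map_map hm (measurePreserving_cons μ).measurable,
    (measurePreserving_cons μ).map_eq]
  exact Measure.prod_swap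

end Shift

section RandomIteration

variable {G X : Type*}

/-- Backward iteration `F(·, ω₀) ∘ F(·, ω₁) ∘ ⋯ ∘ F(·, ω_{n-1})` applied to `x`. -/
def backward (F : X → G → X) : ℕ → X → (ℕ → G) → X
  | 0, x, _ => x
  | n + 1, x, ω => F (backward F n x fun k => ω (k + 1)) (ω 0)

variable {F : X → G → X}

theorem measurable_backward [MeasurableSpace G] [MeasurableSpace X]
    (hF : Measurable (Function.uncurry F)) (n : ℕ) :
    Measurable (Function.uncurry (backward F n)) := by
  induction n with
  | zero => exact measurable_fst
  | succ n ih =>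
    have h1 : Measurable (fun q : X × (ℕ → G) => (q.1, fun k => q.2 (k + 1))) := by fun_prop
    have h2 : Measurable (fun q : X × (ℕ → G) => q.2 0) := by fun_prop
    exact hF.comp ((ih.comp h1).prodMk h2)

/-- If `ν` is invariant, so is it as the law of the backward iterates started from `ν`. -/
theorem map_backward_of_invariant [MeasurableSpace G] [MeasurableSpace X] {μ : Measure G}
    [IsProbabilityMeasure μ] (hF : Measurable (Function.uncurry F))
    {ν : Measure X} [IsProbabilityMeasure ν] (hν : (ν.prod μ).map (Function.uncurry F) = ν)
    (n : ℕ) :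
    (ν.prod (Measure.infinitePi fun _ : ℕ => μ)).map (Function.uncurry (backward F n)) = ν := by
  induction n with
  | zero => exact Measure.map_fst_prod.trans (by simp)
  | succ n ih =>
    set P := Measure.infinitePi fun _ : ℕ => μ
    have h1 : MeasurePreserving (fun q : X × (ℕ → G) => (q.1, ((fun k => q.2 (k + 1)), q.2 0)))
        (ν.prod P) (ν.prod (P.prod μ)) :=
      (MeasurePreserving.id ν).prod (measurePreserving_head_tail μ)
    have h2 := (measurePreserving_prodAssoc ν P μ).symm
    have h3 : MeasurePreserving (Prod.map (Function.uncurry (backward F n)) id)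
        ((ν.prod P).prod μ) (ν.prod μ) :=
      MeasurePreserving.prod ⟨measurable_backward hF n, ih⟩ (MeasurePreserving.id μ)
    have h4 : MeasurePreserving (Function.uncurry F) (ν.prod μ) ν := ⟨hF, hν⟩
    exact (h4.comp (h3.comp (h2.comp h1))).map_eq

variable {Y : Type*} [NormedAddCommGroup X] [NormedAddCommGroup Y] [NormedSpace ℝ X]
  [NormedSpace ℝ Y] {N : X →L[ℝ] Y} {ρ c : ℝ}

theorem norm_backward_sub_le (hρ : 0 ≤ ρ)
    (hF : ∀ x x' g, ‖N (F x g - F x' g)‖ ≤ ρ * ‖N (x - x')‖) (n : ℕ) (x x' : X) (ω : ℕ → G) :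
    ‖N (backward F n x ω - backward F n x' ω)‖ ≤ ρ ^ n * ‖N (x - x')‖ := by
  induction n generalizing ω with
  | zero => simp [backward]
  | succ n ih =>
    refine (hF _ _ _).trans ?_
    rw [pow_succ', mul_assoc]
    exact mul_le_mul_of_nonneg_left (ih _) hρ

/-- Consecutive backward iterates differ only in the starting point of the innermost map, so that
all the outer maps contract their difference; forward iterates in general do not converge
pathwise. -/
theorem norm_backward_succ_sub_le (hρ : 0 ≤ ρ)
    (hF : ∀ x x' g, ‖N (F x g - F x' g)‖ ≤ ρ * ‖N (x - x')‖) (n : ℕ) (ω : ℕ → G) :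
    ‖N (backward F (n + 1) 0 ω - backward F n 0 ω)‖ ≤ ρ ^ n * ‖N (F 0 (ω n))‖ := by
  induction n generalizing ω with
  | zero => simp [backward]
  | succ n ih =>
    refine (hF _ _ _).trans ?_
    rw [pow_succ', mul_assoc]
    exact mul_le_mul_of_nonneg_left (ih fun k => ω (k + 1)) hρ

variable [MeasurableSpace G] {μ : Measure G} [IsProbabilityMeasure μ] [MeasurableSpace X]
  [BorelSpace X] [SecondCountableTopology X] [CompleteSpace X]

/-- A random iteration that contracts the norm `‖N ·‖` has a unique invariant probability measure,
the law of the limit of the backward iterates, and it has all the moments that the noise has. -/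
theorem exists_unique_invariant_of_contraction (hFm : Measurable (Function.uncurry F))
    (hFc : ∀ g, Continuous fun x => F x g) (hN : ∀ x, ‖x‖ ≤ c * ‖N x‖) (hρ : 0 ≤ ρ) (hρ1 : ρ < 1)
    (hc : 0 ≤ c) (hF : ∀ x x' g, ‖N (F x g - F x' g)‖ ≤ ρ * ‖N (x - x')‖)
    (hmem : ∀ p : ℝ≥0∞, p ≠ ∞ → MemLp (F 0) p μ) :
    ∃ π : Measure X, IsProbabilityMeasure π ∧ (π.prod μ).map (Function.uncurry F) = π ∧
      (∀ ν : Measure X, IsProbabilityMeasure ν → (ν.prod μ).map (Function.uncurry F) = ν → ν = π) ∧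
      ∀ p : ℝ≥0∞, 1 ≤ p → p ≠ ∞ → MemLp (fun x : X => x) p π := by
  set P := Measure.infinitePi fun _ : ℕ => μ with hP
  let Z : ℕ → (ℕ → G) → X := fun n => backward F n 0
  have hZm : ∀ n, Measurable (Z n) := fun n =>
    (measurable_backward hFm n).comp (measurable_const.prodMk measurable_id)
  have hNF : ∀ p : ℝ≥0∞, p ≠ ∞ → MemLp (fun g => N (F 0 g)) p μ := fun p hp =>
    N.comp_memLp' (hmem p hp)
  -- almost sure convergence: the increments `ρⁿ ‖N (F 0 ωₙ)‖` have a finite expected sum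
  have hconv : ∀ᵐ ω ∂P, ∃ l, Tendsto (fun n => Z n ω) atTop (𝓝 l) := by
    have hL1 : ∫⁻ g, ‖N (F 0 g)‖ₑ ∂μ ≠ ∞ := by
      have := (hNF 1 ENNReal.one_ne_top).2
      rw [eLpNorm_one_eq_lintegral_enorm] at this
      exact this.ne
    have hNm : AEMeasurable (fun g => ‖N (F 0 g)‖ₑ) μ :=
      (hNF 1 ENNReal.one_ne_top).1.enorm
    have hev : ∀ n : ℕ, MeasurePreserving (fun ω : ℕ → G => ω n) P μ := fun n =>
      measurePreserving_eval_infinitePi (fun _ : ℕ => μ) n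
    have hm : ∀ n : ℕ,
        AEMeasurable (fun ω : ℕ → G => ENNReal.ofReal (ρ ^ n) * ‖N (F 0 (ω n))‖ₑ) P := fun n =>
      (hNm.comp_quasiMeasurePreserving (hev n).quasiMeasurePreserving).const_mul _
    have hsum : ∫⁻ ω, ∑' n : ℕ, ENNReal.ofReal (ρ ^ n) * ‖N (F 0 (ω n))‖ₑ ∂P ≠ ∞ := by
      rw [lintegral_tsum hm]
      have : ∀ n : ℕ, ∫⁻ ω, ENNReal.ofReal (ρ ^ n) * ‖N (F 0 (ω n))‖ₑ ∂P =
          ENNReal.ofReal (ρ ^ n) * ∫⁻ g, ‖N (F 0 g)‖ₑ ∂μ := fun n => by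
        rw [lintegral_const_mul' _ _ ENNReal.ofReal_ne_top]
        congr 1
        rw [← (hev n).map_eq,
          lintegral_map' (by rwa [(hev n).map_eq]) (hev n).measurable.aemeasurable]
      simp_rw [this]
      rw [ENNReal.tsum_mul_right]
      refine ENNReal.mul_ne_top ?_ hL1
      rw [← ENNReal.ofReal_tsum_of_nonneg (fun n => by positivity)
        (summable_geometric_of_lt_one hρ hρ1)]
      exact ENNReal.ofReal_ne_top
    filter_upwards [ae_lt_top' (AEMeasurable.tsum hm) hsum] with ω hω
    refine cauchySeq_tendsto_of_complete ?_
    have hsummable : Summable fun n : ℕ => c * (ρ ^ n * ‖N (F 0 (ω n))‖) := by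
      refine Summable.mul_left c ?_
      have := ENNReal.summable_toReal hω.ne
      refine this.congr fun n => ?_
      rw [ENNReal.toReal_mul, ENNReal.toReal_ofReal (by positivity), toReal_enorm]
    refine cauchySeq_of_dist_le_of_summable _ (fun n => ?_) hsummable
    rw [dist_comm, dist_eq_norm]
    exact (hN _).trans (mul_le_mul_of_nonneg_left (norm_backward_succ_sub_le hρ hF n ω) hc)
  obtain ⟨Z', hZ'm, hZ'⟩ := measurable_limit_of_tendsto_metrizable_ae
    (fun n => (hZm n).aemeasurable) hconv
  have hprob : IsProbabilityMeasure (P.map Z') :=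
    Measure.isProbabilityMeasure_map hZ'm.aemeasurable
  have htail : MeasurePreserving (fun ω : ℕ → G => fun n => ω (n + 1)) P P :=
    measurePreserving_fst.comp (measurePreserving_head_tail μ)
  refine ⟨P.map Z', hprob, ?_, fun ν hν hinv => ?_, fun p hp1 hp => ?_⟩
  · -- the limit satisfies the fixed point equation in law
    have h1 : MeasurePreserving (Prod.map Z' id) (P.prod μ) ((P.map Z').prod μ) :=
      MeasurePreserving.prod ⟨hZ'm, rfl⟩ (MeasurePreserving.id μ)
    have h2 := h1.comp (measurePreserving_head_tail μ)
    rw [← h2.map_eq, Measure.map_map hFm h2.measurable]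
    refine Measure.map_congr ?_
    filter_upwards [hZ', htail.quasiMeasurePreserving.ae hZ'] with ω hω hω'
    have h3 : Tendsto (fun n => Z (n + 1) ω) atTop (𝓝 (F (Z' fun n => ω (n + 1)) (ω 0))) :=
      ((hFc (ω 0)).tendsto _).comp hω'
    exact tendsto_nhds_unique h3 (hω.comp (tendsto_add_atTop_nat 1))
  · -- started from `ν`, the backward iterates have the law `ν` and forget their starting point
    refine ext_of_forall_integral_eq_of_IsFiniteMeasure fun f => ?_
    have h1 : ∀ n, ∫ x, f x ∂ν =
        ∫ q : X × (ℕ → G), f (backward F n q.1 q.2) ∂ν.prod P := fun n => by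
      conv_lhs => rw [← map_backward_of_invariant hFm hinv n]
      rw [integral_map (measurable_backward hFm n).aemeasurable
        f.continuous.aestronglyMeasurable]
      rfl
    have h2 : Tendsto (fun n => ∫ q : X × (ℕ → G), f (backward F n q.1 q.2) ∂ν.prod P) atTop
        (𝓝 (∫ q : X × (ℕ → G), f (Z' q.2) ∂ν.prod P)) := by
      refine tendsto_integral_of_dominated_convergence (fun _ => ‖f‖) (fun n => ?_)
        (integrable_const _) (fun n => Eventually.of_forall fun q => f.norm_coe_le_norm _) ?_
      · exact (f.continuous.measurable.comp (measurable_backward hFm n)).aestronglyMeasurable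
      · have h3 : ∀ᵐ q ∂ν.prod P, Tendsto (fun n => Z n q.2) atTop (𝓝 (Z' q.2)) :=
          Measure.quasiMeasurePreserving_snd.ae hZ'
        filter_upwards [h3] with q hq
        refine (f.continuous.tendsto _).comp ?_
        have h4 : Tendsto (fun n => backward F n q.1 q.2 - Z n q.2) atTop (𝓝 0) := by
          refine squeeze_zero_norm (a := fun n => c * (ρ ^ n * ‖N (q.1 - 0)‖)) (fun n => ?_) ?_
          · exact (hN _).trans (mul_le_mul_of_nonneg_left (norm_backward_sub_le hρ hF n _ _ _) hc)
          · have := ((tendsto_pow_atTop_nhds_zero_of_lt_one hρ hρ1).mul_const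
              ‖N (q.1 - 0)‖).const_mul c
            simpa using this
        simpa using h4.add hq
    have h3 : ∫ q : X × (ℕ → G), f (Z' q.2) ∂ν.prod P = ∫ x, f x ∂P.map Z' := by
      rw [integral_map hZ'm.aemeasurable f.continuous.aestronglyMeasurable]
      have := integral_fun_snd (μ := ν) (ν := P) (fun ω => f (Z' ω))
      simpa using this
    rw [← h3]
    exact tendsto_nhds_unique (tendsto_const_nhds.congr h1) h2
  · -- the moments of the backward iterates obey `Mₙ₊₁ ≤ ρ Mₙ + r`
    have hZmeas : ∀ n, AEStronglyMeasurable (fun ω => N (Z n ω)) P := fun n =>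
      N.continuous.comp_aestronglyMeasurable (hZm n).aestronglyMeasurable
    set r := eLpNorm (fun g => N (F 0 g)) p μ with hr
    have hr_top : r ≠ ∞ := (hNF p hp).2.ne
    have hM : ∀ n, eLpNorm (fun ω => N (Z n ω)) p P ≤
        ENNReal.ofReal (1 / (1 - ρ)) * r := fun n => by
      induction n with
      | zero => simp [Z, backward]
      | succ n ih =>
        have h1 : eLpNorm (fun ω => N (Z (n + 1) ω)) p P ≤
            eLpNorm (fun ω : ℕ → G => N (F 0 (ω 0))) p P +
              eLpNorm (fun ω => ρ • ‖N (Z n fun k => ω (k + 1))‖) p P := by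
          have hm0 : AEStronglyMeasurable (fun ω : ℕ → G => ‖N (F 0 (ω 0))‖) P :=
            ((hNF p hp).1.comp_quasiMeasurePreserving
              (measurePreserving_eval_infinitePi (fun _ : ℕ => μ) 0).quasiMeasurePreserving).norm
          have hm1 : AEStronglyMeasurable (fun ω => ρ • ‖N (Z n fun k => ω (k + 1))‖) P :=
            ((hZmeas n).comp_quasiMeasurePreserving htail.quasiMeasurePreserving).norm.const_smul ρ
          rw [← eLpNorm_norm (fun ω : ℕ → G => N (F 0 (ω 0)))]
          refine le_trans (eLpNorm_mono_real fun ω => ?_) (eLpNorm_add_le hm0 hm1 hp1)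
          have h2 := hF (Z n fun k => ω (k + 1)) 0 (ω 0)
          rw [sub_zero] at h2
          have h3 : N (Z (n + 1) ω) = N (F 0 (ω 0)) +
              N (F (Z n fun k => ω (k + 1)) (ω 0) - F 0 (ω 0)) := by
            rw [← map_add]; congr 1; simp [Z, backward]
          rw [h3]
          exact (norm_add_le _ _).trans (add_le_add le_rfl h2)
        have h2 : eLpNorm (fun ω : ℕ → G => N (F 0 (ω 0))) p P = r :=
          eLpNorm_comp_measurePreserving (hNF p hp).1
            (measurePreserving_eval_infinitePi (fun _ : ℕ => μ) 0)
        have h3 : eLpNorm (fun ω => ρ • ‖N (Z n fun k => ω (k + 1))‖) p P =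
            ENNReal.ofReal ρ * eLpNorm (fun ω => N (Z n ω)) p P := by
          have h4 := eLpNorm_const_smul (p := p) (μ := P) ρ
            (fun ω : ℕ → G => ‖N (Z n fun k => ω (k + 1))‖)
          have h5 := eLpNorm_comp_measurePreserving (p := p) (hZmeas n) htail
          have h6 : eLpNorm (fun ω : ℕ → G => ‖N (Z n fun k => ω (k + 1))‖) p P =
              eLpNorm (fun ω => N (Z n ω)) p P := (eLpNorm_norm _).trans h5
          rw [h6, Real.enorm_eq_ofReal hρ] at h4
          exact h4
        rw [h2, h3] at h1
        refine h1.trans ?_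
        calc r + ENNReal.ofReal ρ * eLpNorm (fun ω => N (Z n ω)) p P
            ≤ r + ENNReal.ofReal ρ * (ENNReal.ofReal (1 / (1 - ρ)) * r) := by gcongr
          _ = (1 + ENNReal.ofReal ρ * ENNReal.ofReal (1 / (1 - ρ))) * r := by ring
          _ = ENNReal.ofReal (1 / (1 - ρ)) * r := by
              congr 1
              rw [← ENNReal.ofReal_one, ← ENNReal.ofReal_mul hρ, ← ENNReal.ofReal_add zero_le_one
                (mul_nonneg hρ (by rw [one_div, inv_nonneg]; linarith))]
              congr 1
              have : 1 - ρ ≠ 0 := by linarith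
              field_simp
              ring
    have hlim : eLpNorm (fun ω => N (Z' ω)) p P ≤ ENNReal.ofReal (1 / (1 - ρ)) * r := by
      refine (Lp.eLpNorm_lim_le_liminf_eLpNorm hZmeas _ ?_).trans ?_
      · filter_upwards [hZ'] with ω hω
        exact (N.continuous.tendsto _).comp hω
      · refine (liminf_le_liminf (Eventually.of_forall hM)).trans ?_
        simp
    have hZ'L : MemLp Z' p P := by
      have hNZ : MemLp (fun ω => N (Z' ω)) p P :=
        ⟨N.continuous.comp_aestronglyMeasurable hZ'm.aestronglyMeasurable,
          hlim.trans_lt (ENNReal.mul_lt_top ENNReal.ofReal_lt_top hr_top.lt_top)⟩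
      exact hNZ.of_le_mul hZ'm.aestronglyMeasurable (Eventually.of_forall fun ω => hN _)
    exact (memLp_map_measure_iff aestronglyMeasurable_id hZ'm.aemeasurable).2 hZ'L

end RandomIteration

/-! ### Synchronous coupling and the invariant measure of the scheme -/

section SynchronousCoupling

variable {X Y G : Type*} [NormedAddCommGroup X] [NormedSpace ℝ X] [MeasurableSpace X]
  [BorelSpace X] [SecondCountableTopology X] [NormedAddCommGroup Y] [NormedSpace ℝ Y]
  [MeasurableSpace G] {μ : Measure G} [IsProbabilityMeasure μ] {S F : X → G → X} {N : X →L[ℝ] Y}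
  {ρ : ℝ} {π ν : Measure X}

/-- One step of `S` from `x` and of `F` from `y` with the same noise: insert `F` from `x`, where `S`
and `F` are compared under the law `π` of `x` alone. -/
theorem eLpNorm_synchronous_step_le [SFinite π] (hSm : Measurable (Function.uncurry S))
    (hFm : Measurable (Function.uncurry F))
    (hcontr : ∀ x x' g, ‖N (F x g - F x' g)‖ ≤ ρ * ‖N (x - x')‖) {p : ℝ≥0∞} (hp : 1 ≤ p)
    {ζ : Measure (X × X)} [IsProbabilityMeasure ζ] (hζ : ζ.map Prod.fst = π) :
    eLpNorm (fun q : (X × X) × G => N (S q.1.1 q.2 - F q.1.2 q.2)) p (ζ.prod μ) ≤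
      eLpNorm (fun w : X × G => N (S w.1 w.2 - F w.1 w.2)) p (π.prod μ) +
        ENNReal.ofReal ρ * eLpNorm (fun w : X × X => N (w.1 - w.2)) p ζ := by
  have hm1 : MeasurePreserving (fun q : (X × X) × G => (q.1.1, q.2)) (ζ.prod μ) (π.prod μ) :=
    MeasurePreserving.prod (⟨measurable_fst, hζ⟩ : MeasurePreserving Prod.fst ζ π)
      (MeasurePreserving.id μ)
  have hG : Measurable fun q : X × G => S q.1 q.2 - F q.1 q.2 := hSm.sub hFm
  have hA : AEStronglyMeasurable (fun w : X × G => N (S w.1 w.2 - F w.1 w.2)) (π.prod μ) :=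
    N.continuous.comp_aestronglyMeasurable hG.aestronglyMeasurable
  have hF1 : Measurable fun q : (X × X) × G => F q.1.1 q.2 - F q.1.2 q.2 :=
    (hFm.comp hm1.measurable).sub
      (hFm.comp (by fun_prop : Measurable fun q : (X × X) × G => (q.1.2, q.2)))
  have hB : AEStronglyMeasurable (fun q : (X × X) × G => N (F q.1.1 q.2 - F q.1.2 q.2))
      (ζ.prod μ) := N.continuous.comp_aestronglyMeasurable hF1.aestronglyMeasurable
  have hC : AEStronglyMeasurable (fun w : X × X => N (w.1 - w.2)) ζ :=
    (N.continuous.comp (continuous_fst.sub continuous_snd)).aestronglyMeasurable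
  have e1 := eLpNorm_comp_measurePreserving (p := p) hA hm1
  have e2 := eLpNorm_comp_measurePreserving (p := p) hC (measurePreserving_fst (μ := ζ) (ν := μ))
  rw [← e1, ← e2]
  have e3 : (fun q : (X × X) × G => N (S q.1.1 q.2 - F q.1.2 q.2)) =
      ((fun w : X × G => N (S w.1 w.2 - F w.1 w.2)) ∘ fun q : (X × X) × G => (q.1.1, q.2)) +
        fun q : (X × X) × G => N (F q.1.1 q.2 - F q.1.2 q.2) := by
    ext1 q
    simp only [Function.comp, Pi.add_apply]
    rw [← map_add, sub_add_sub_cancel]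
  rw [e3]
  refine (eLpNorm_add_le (hA.comp_measurePreserving hm1) hB hp).trans (add_le_add le_rfl ?_)
  have e4 : ∀ q : (X × X) × G, ‖N (F q.1.1 q.2 - F q.1.2 q.2)‖ ≤
      ρ * ‖((fun w : X × X => N (w.1 - w.2)) ∘ Prod.fst) q‖ := fun q => hcontr q.1.1 q.1.2 q.2
  exact eLpNorm_le_mul_eLpNorm_of_ae_le_mul (Eventually.of_forall e4) p

/-- If `π` is invariant for `S`, `ν` for `F`, and `F` contracts by `ρ`, then there are couplings of
`π` and `ν` whose `L^p` distance is at most `1 / (1 - ρ)` times the one-step error between `S` and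
`F`, up to an arbitrarily small excess: drive `S` and `F` by the same noise, starting from any
coupling. -/
theorem exists_coupling_eLpNorm_le [IsProbabilityMeasure π] [IsProbabilityMeasure ν]
    (hSm : Measurable (Function.uncurry S))
    (hFm : Measurable (Function.uncurry F))
    (hS : (π.prod μ).map (Function.uncurry S) = π) (hF : (ν.prod μ).map (Function.uncurry F) = ν)
    (hρ : 0 ≤ ρ) (hρ1 : ρ < 1) (hcontr : ∀ x x' g, ‖N (F x g - F x' g)‖ ≤ ρ * ‖N (x - x')‖)
    {p : ℝ≥0∞} (hp : 1 ≤ p) (hπ : MemLp (fun x : X => x) p π) (hν : MemLp (fun x : X => x) p ν)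
    {e : ℝ≥0∞}
    (he : eLpNorm (fun w : X × G => N (S w.1 w.2 - F w.1 w.2)) p (π.prod μ) ≤ e)
    {ε : ℝ≥0∞} (hε : ε ≠ 0) :
    ∃ ζ ∈ couplings π ν, eLpNorm (fun w : X × X => N (w.1 - w.2)) p ζ ≤
      e * ENNReal.ofReal (1 / (1 - ρ)) + ε := by
  set a₀ := eLpNorm (fun w : X × X => N (w.1 - w.2)) p (π.prod ν) with ha₀
  have ha₀_top : a₀ ≠ ∞ := by
    have h1 : MemLp (fun w : X × X => w.1) p (π.prod ν) :=
      hπ.comp_measurePreserving measurePreserving_fst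
    have h2 : MemLp (fun w : X × X => w.2) p (π.prod ν) :=
      hν.comp_measurePreserving measurePreserving_snd
    exact (N.comp_memLp' (h1.sub h2)).2.ne
  have e4 : 1 + ENNReal.ofReal ρ * ENNReal.ofReal (1 / (1 - ρ)) =
      ENNReal.ofReal (1 / (1 - ρ)) := by
    rw [← ENNReal.ofReal_one, ← ENNReal.ofReal_mul hρ, ← ENNReal.ofReal_add zero_le_one
      (mul_nonneg hρ (by rw [one_div, inv_nonneg]; linarith))]
    congr 1
    have : 1 - ρ ≠ 0 := by linarith
    field_simp
    ring
  have key : ∀ n : ℕ, ∃ ζ ∈ couplings π ν, eLpNorm (fun w : X × X => N (w.1 - w.2)) p ζ ≤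
      e * ENNReal.ofReal (1 / (1 - ρ)) + ENNReal.ofReal ρ ^ n * a₀ := fun n => by
    induction n with
    | zero =>
      refine ⟨π.prod ν, ⟨inferInstance, by simp [Measure.map_fst_prod],
        by simp [Measure.map_snd_prod]⟩, ?_⟩
      rw [pow_zero, one_mul]
      exact le_add_self
    | succ n ih =>
      obtain ⟨ζ, ⟨hζ, hζ1, hζ2⟩, hle⟩ := ih
      have hm1 : MeasurePreserving (fun q : (X × X) × G => (q.1.1, q.2)) (ζ.prod μ) (π.prod μ) :=
        MeasurePreserving.prod (⟨measurable_fst, hζ1⟩ : MeasurePreserving Prod.fst ζ π)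
          (MeasurePreserving.id μ)
      have hm2 : MeasurePreserving (fun q : (X × X) × G => (q.1.2, q.2)) (ζ.prod μ) (ν.prod μ) :=
        MeasurePreserving.prod (⟨measurable_snd, hζ2⟩ : MeasurePreserving Prod.snd ζ ν)
          (MeasurePreserving.id μ)
      have hJ : Measurable fun q : (X × X) × G => (S q.1.1 q.2, F q.1.2 q.2) :=
        (hSm.comp hm1.measurable).prodMk (hFm.comp hm2.measurable)
      have hN : AEStronglyMeasurable (fun w : X × X => N (w.1 - w.2))
          ((ζ.prod μ).map fun q => (S q.1.1 q.2, F q.1.2 q.2)) :=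
        (N.continuous.comp (continuous_fst.sub continuous_snd)).aestronglyMeasurable
      refine ⟨(ζ.prod μ).map fun q => (S q.1.1 q.2, F q.1.2 q.2),
        ⟨Measure.isProbabilityMeasure_map hJ.aemeasurable, ?_, ?_⟩, ?_⟩
      · rw [Measure.map_map measurable_fst hJ]
        exact ((⟨hSm, hS⟩ : MeasurePreserving _ (π.prod μ) π).comp hm1).map_eq
      · rw [Measure.map_map measurable_snd hJ]
        exact ((⟨hFm, hF⟩ : MeasurePreserving _ (ν.prod μ) ν).comp hm2).map_eq
      · rw [eLpNorm_map_measure hN hJ.aemeasurable]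
        refine (eLpNorm_synchronous_step_le hSm hFm hcontr hp hζ1).trans ?_
        refine (add_le_add he (mul_le_mul_right hle _)).trans (le_of_eq ?_)
        calc e + ENNReal.ofReal ρ * (e * ENNReal.ofReal (1 / (1 - ρ)) + ENNReal.ofReal ρ ^ n * a₀)
            = e * (1 + ENNReal.ofReal ρ * ENNReal.ofReal (1 / (1 - ρ))) +
              ENNReal.ofReal ρ ^ (n + 1) * a₀ := by ring
          _ = _ := by rw [e4]
  have hlim : Tendsto (fun n : ℕ => ENNReal.ofReal ρ ^ n * a₀) atTop (𝓝 0) := by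
    have h := ENNReal.Tendsto.mul_const (b := a₀) (ENNReal.tendsto_pow_atTop_nhds_zero_of_lt_one
      (by rwa [ENNReal.ofReal_lt_one] : ENNReal.ofReal ρ < 1)) (Or.inr ha₀_top)
    simpa using h
  obtain ⟨n, hn⟩ := (hlim.eventually_lt_const (pos_iff_ne_zero.2 hε)).exists
  obtain ⟨ζ, hζ, hle⟩ := key n
  exact ⟨ζ, hζ, hle.trans (by gcongr)⟩

end SynchronousCoupling

section Invariant

variable {d : ℕ} {U : E d → ℝ} {L m γ δ : ℝ}

/-- One transition as a function of the state and of the pair of noises. -/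
def obaboStep {d : ℕ} (U : E d → ℝ) (δ γ : ℝ) (z : Phase d) (g : E d × E d) : Phase d :=
  obaboMap U δ γ z g.1 g.2

/-- Invariance under the kernel, in terms of the random map `obaboStep`. -/
theorem invariant_iff (hU : ContDiff ℝ 2 U) (ν : Measure (Phase d)) [IsProbabilityMeasure ν] :
    (obaboKernel U δ γ).Invariant ν ↔
      (ν.prod ((stdGaussian (E d)).prod (stdGaussian (E d)))).map
        (Function.uncurry (obaboStep U δ γ)) = ν := by
  rw [Kernel.Invariant, obaboKernel, ← Measure.map_comp _ _ (measurable_obaboMap hU δ γ),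
    ← Measure.compProd_eq_comp_prod, Measure.compProd_const]
  rfl

theorem memLp_obaboStep_zero (hU : ContDiff ℝ 2 U) (hLip : GradLip U L) {p : ℝ≥0∞}
    (hp : p ≠ ∞) :
    MemLp (obaboStep U δ γ 0) p ((stdGaussian (E d)).prod (stdGaussian (E d))) := by
  have h1 : MemLp (fun g : E d × E d => g.1) p ((stdGaussian (E d)).prod (stdGaussian (E d))) :=
    (IsGaussian.memLp_id (stdGaussian (E d)) p hp).comp_measurePreserving measurePreserving_fst
  have h2 : MemLp (fun g : E d × E d => g.2) p ((stdGaussian (E d)).prod (stdGaussian (E d))) :=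
    (IsGaussian.memLp_id (stdGaussian (E d)) p hp).comp_measurePreserving measurePreserving_snd
  set μ := (stdGaussian (E d)).prod (stdGaussian (E d))
  -- the half-step velocity, then the new position, then the new gradient
  set w : E d × E d → E d := fun g =>
    eta δ γ • (0 : E d) + Real.sqrt (1 - eta δ γ ^ 2) • g.1 - (δ / 2) • ∇ U 0 with hw
  have h3 : MemLp w p μ :=
    ((memLp_const (eta δ γ • (0 : E d))).add (h1.const_smul (Real.sqrt (1 - eta δ γ ^ 2)))).sub
      (memLp_const ((δ / 2) • ∇ U 0))
  have h4 : MemLp (fun g => (0 : E d) + δ • w g) p μ :=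
    (memLp_const (0 : E d)).add (h3.const_smul δ)
  have h5 : MemLp (fun g => ∇ U ((0 : E d) + δ • w g) - ∇ U 0) p μ := by
    refine h4.of_le_mul (c := L) ?_ (Eventually.of_forall fun g => ?_)
    · exact ((continuous_gradient hU).comp_aestronglyMeasurable h4.1).sub
        aestronglyMeasurable_const
    · exact (hLip _ _).trans_eq (by rw [sub_zero])
  have h6 : MemLp (fun g => (∇ U ((0 : E d) + δ • w g) - ∇ U 0) + ∇ U 0) p μ :=
    h5.add (memLp_const (∇ U 0))
  simp only [sub_add_cancel] at h6
  have h7 : MemLp (fun g : E d × E d => eta δ γ • (w g - (δ / 2) • ∇ U ((0 : E d) + δ • w g)) +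
      Real.sqrt (1 - eta δ γ ^ 2) • g.2) p μ :=
    ((h3.sub (h6.const_smul (δ / 2))).const_smul (eta δ γ)).add
      (h2.const_smul (Real.sqrt (1 - eta δ γ ^ 2)))
  exact memLp_prod_iff.2 ⟨h4, h7⟩

/-- The norm of `Phase d` is the larger of the norms of the two components. -/
theorem phaseDist_le_two_mul_norm (z z' : Phase d) : phaseDist z z' ≤ 2 * ‖z - z'‖ := by
  rw [phaseDist_eq]
  refine Real.sqrt_le_iff.2 ⟨by positivity, ?_⟩
  have h1 := pow_le_pow_left₀ (norm_nonneg _) (norm_fst_le (z - z')) 2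
  have h2 := pow_le_pow_left₀ (norm_nonneg _) (norm_snd_le (z - z')) 2
  nlinarith [sq_nonneg ‖z - z'‖]

theorem norm_sub_le_phaseDist (z z' : Phase d) : ‖z - z'‖ ≤ phaseDist z z' := by
  rw [phaseDist_eq]
  refine Real.le_sqrt_of_sq_le ?_
  rcases max_choice ‖(z - z').1‖ ‖(z - z').2‖ with h | h <;> rw [Prod.norm_def, h] <;>
    nlinarith [sq_nonneg ‖(z - z').1‖, sq_nonneg ‖(z - z').2‖]

theorem norm_phaseDist (z z' : Phase d) : ‖phaseDist z z'‖ = phaseDist z z' :=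
  Real.norm_of_nonneg (Real.sqrt_nonneg _)

theorem measurable_phaseDist : Measurable (fun w : Phase d × Phase d => phaseDist w.1 w.2) := by
  unfold phaseDist
  fun_prop

/-- The `L^p` cost of the definition of `W_p` is an `L^p` seminorm. -/
theorem lintegral_phaseDist_eq {Z : Type*} [MeasurableSpace Z] (ζ : Measure Z) (f f' : Z → Phase d)
    {p : ℝ} (hp : 1 ≤ p) :
    (∫⁻ w, ENNReal.ofReal (phaseDist (f w) (f' w)) ^ p ∂ζ) ^ (1 / p) =
      eLpNorm (fun w => phaseDist (f w) (f' w)) (ENNReal.ofReal p) ζ := by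
  have hp0 : 0 < p := by linarith
  rw [eLpNorm_eq_lintegral_rpow_enorm_toReal (by simpa using hp0) ENNReal.ofReal_ne_top,
    ENNReal.toReal_ofReal hp0.le]
  have h : ∀ w, ‖phaseDist (f w) (f' w)‖ₑ = ENNReal.ofReal (phaseDist (f w) (f' w)) := fun w =>
    Real.enorm_eq_ofReal (Real.sqrt_nonneg _)
  simp only [h]

theorem memPp_of_memLp {μ : Measure (Phase d)} [IsProbabilityMeasure μ] {p : ℝ} (hp : 1 ≤ p)
    (h : MemLp (fun z : Phase d => z) (ENNReal.ofReal p) μ) : MemPp p μ := by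
  refine ⟨inferInstance, ?_⟩
  have hp0 : 0 < p := by linarith
  have h1 : eLpNorm (fun z => phaseDist 0 z) (ENNReal.ofReal p) μ < ∞ := by
    refine ((h.const_smul (2 : ℝ)).of_le ?_ (Eventually.of_forall fun z => ?_)).2
    · exact (measurable_phaseDist.comp measurable_prodMk_left).aestronglyMeasurable
    · have := phaseDist_le_two_mul_norm 0 z
      rw [zero_sub, norm_neg] at this
      rwa [Pi.smul_apply, norm_smul, Real.norm_two, norm_phaseDist]
  rw [← lintegral_phaseDist_eq μ (fun _ => 0) (fun z => z) hp] at h1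
  by_contra hcon
  rw [not_lt, top_le_iff] at hcon
  rw [hcon, ENNReal.top_rpow_of_pos (by positivity)] at h1
  exact lt_irrefl _ h1

theorem memLp_gibbs (hU : ContDiff ℝ 2 U) (hm : 0 < m) (hConv : StrongConv U m) {p : ℝ}
    (hp : 1 ≤ p) : MemLp (fun z : Phase d => z) (ENNReal.ofReal p) (gibbs U) := by
  have := isProbabilityMeasure_gibbs hU hm hConv
  obtain ⟨x₀, hx₀⟩ := exists_gradient_eq_zero hU hm hConv
  have h1 : MemLp (fun z : Phase d => z.1 - x₀) (ENNReal.ofReal p) (gibbs U) :=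
    ⟨by fun_prop, (eLpNorm_fst_gibbs_le hU hm hConv hx₀ hp).trans_lt ENNReal.ofReal_lt_top⟩
  have h2 : MemLp (fun z : Phase d => z.2) (ENNReal.ofReal p) (gibbs U) :=
    ⟨by fun_prop, (eLpNorm_snd_gibbs_le hU hm hConv hp).trans_lt ENNReal.ofReal_lt_top⟩
  refine memLp_prod_iff.2 ⟨?_, h2⟩
  have h3 : MemLp (fun z : Phase d => z.1 - x₀ + x₀) (ENNReal.ofReal p) (gibbs U) :=
    h1.add (memLp_const x₀)
  simpa only [sub_add_cancel] using h3

theorem exists_invariant (hU : ContDiff ℝ 2 U) (hL : 0 < L) (hm : 0 < m) (hmL : m ≤ L)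
    (hLip : GradLip U L) (hConv : StrongConv U m) (hγ : 2 * Real.sqrt L ≤ γ) (hδ : 0 < δ)
    (hδγ : δ ≤ m / (33 * γ ^ 3)) :
    ∃ πδ : Measure (Phase d), IsProbabilityMeasure πδ ∧ (obaboKernel U δ γ).Invariant πδ ∧
      (∀ ν : Measure (Phase d), IsProbabilityMeasure ν → (obaboKernel U δ γ).Invariant ν → ν = πδ) ∧
      ∀ p : ℝ≥0∞, 1 ≤ p → p ≠ ∞ → MemLp (fun z : Phase d => z) p πδ := by
  have hg := continuous_gradient hU
  obtain ⟨π, hπ, hinv, huniq, hmem⟩ := exists_unique_invariant_of_contraction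
    (μ := (stdGaussian (E d)).prod (stdGaussian (E d))) (F := obaboStep U δ γ) (N := twist L γ)
    (ρ := rho m γ δ) (c := Real.sqrt 2 * max 1 (Real.sqrt L)) (measurable_obaboMap hU δ γ)
    (fun g => by
      unfold obaboStep obaboMap stepO stepB stepA
      fun_prop)
    (fun z => by
      have h := phaseDist_le_norm_twist hL hγ z 0
      rw [sub_zero] at h
      refine le_trans ?_ h
      simpa using norm_sub_le_phaseDist z 0)
    rho_nonneg (rho_lt_one hm (pos_of_two_sqrt_le hL hγ) hδ) (by positivity)
    (fun z z' g => norm_twist_obaboMap_sub_le hU hL hm hmL hLip hConv hγ hδ hδγ z z' g.1 g.2)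
    (fun p hp => memLp_obaboStep_zero hU hLip hp)
  refine ⟨π, hπ, (invariant_iff hU π).2 hinv, fun ν hν h => huniq ν hν ((invariant_iff hU ν).1 h),
    hmem⟩

end Invariant

/-! ### Wasserstein bias -/

section WassersteinBias

variable {d : ℕ} {U : E d → ℝ} {L m γ δ : ℝ}

/-- The transition in which the Verlet step is replaced by the map `Φ`. -/
def flowStep {d : ℕ} (Φ : Phase d → Phase d) (δ γ : ℝ) (z : Phase d) (g : E d × E d) : Phase d :=
  stepO δ γ g.2 (Φ (stepO δ γ g.1 z))

theorem measurable_stepO : Measurable (fun w : Phase d × E d => stepO δ γ w.2 w.1) := by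
  unfold stepO
  fun_prop

theorem measurePreserving_stepO_gibbs (hU : ContDiff ℝ 2 U) (hm : 0 < m) (hConv : StrongConv U m)
    (h : 0 ≤ δ * γ) :
    MeasurePreserving (fun w : Phase d × E d => stepO δ γ w.2 w.1)
      ((gibbs U).prod (stdGaussian (E d))) (gibbs U) :=
  ⟨measurable_stepO, map_stepO_gibbs hU hm hConv h⟩

theorem measurePreserving_flowStep (hU : ContDiff ℝ 2 U) (hm : 0 < m) (hConv : StrongConv U m)
    (h : 0 ≤ δ * γ) {Φ : Phase d → Phase d} (hΦ : MeasurePreserving Φ (gibbs U) (gibbs U)) :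
    MeasurePreserving (Function.uncurry (flowStep Φ δ γ))
      ((gibbs U).prod ((stdGaussian (E d)).prod (stdGaussian (E d)))) (gibbs U) := by
  have := isProbabilityMeasure_gibbs hU hm hConv
  have hO := measurePreserving_stepO_gibbs hU hm hConv h
  have h1 := (measurePreserving_prodAssoc (gibbs U) (stdGaussian (E d)) (stdGaussian (E d))).symm
  have h2 : MeasurePreserving (Prod.map (fun w : Phase d × E d => Φ (stepO δ γ w.2 w.1)) id)
      (((gibbs U).prod (stdGaussian (E d))).prod (stdGaussian (E d)))
      ((gibbs U).prod (stdGaussian (E d))) :=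
    (hΦ.comp hO).prod (MeasurePreserving.id _)
  exact hO.comp (h2.comp h1)

theorem phaseDist_stepO_le (h : 0 ≤ δ * γ) (g : E d) (z z' : Phase d) :
    phaseDist (stepO δ γ g z) (stepO δ γ g z') ≤ phaseDist z z' := by
  rw [phaseDist_eq, phaseDist_eq]
  refine Real.sqrt_le_sqrt ?_
  have h1 : eta δ γ ≤ 1 := Real.exp_le_one_iff.2 (by linarith)
  have h0 : 0 ≤ eta δ γ := (Real.exp_pos _).le
  have e1 : stepO δ γ g z - stepO δ γ g z' = ((z - z').1, eta δ γ • (z - z').2) := by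
    ext1
    · rfl
    · simp only [stepO, Prod.snd_sub]; module
  rw [e1]
  simp only [norm_smul, mul_pow, Real.norm_eq_abs, sq_abs]
  have : eta δ γ ^ 2 ≤ 1 := pow_le_one₀ h0 h1
  have := mul_le_mul_of_nonneg_right this (sq_nonneg ‖(z - z').2‖)
  linarith

/-- The coefficient of the one-step error of `exists_hamiltonian_flow` is below that of `K₃`. -/
theorem local_error_coeff_le {δ y : ℝ} (hδ : 0 ≤ δ) (hy : 0 ≤ y) (hy1 : y ≤ 1 / 3) :
    (3 / 4 + δ / 6 + y / 12) / (1 - y / 2) ≤ 1 + Real.exp y * (δ / 6 + y / 24) := by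
  rw [div_le_iff₀ (by linarith)]
  have h1 := Real.add_one_le_exp y
  have h2 : 1 ≤ Real.exp y * (1 - y / 2) := by nlinarith
  have h3 := mul_le_mul_of_nonneg_right h2 (by positivity : 0 ≤ δ / 6 + y / 24)
  nlinarith

/-- The local error of the Verlet step in `L^p` of the Gibbs measure. -/
theorem eLpNorm_phaseDist_verlet_le (hU : ContDiff ℝ 2 U) (hm : 0 < m) (hL : 0 < L)
    (hLip : GradLip U L) (hConv : StrongConv U m) (hδ : 0 < δ) (hδL : δ ^ 2 * L ≤ 1 / 9)
    {Φ : Phase d → Phase d} (hΦ : ∀ z V, ‖z.2‖ + δ / 2 * ‖∇ U z.1‖ = (1 - L * δ ^ 2 / 2) * V →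
        phaseDist (Φ z) (verlet U δ z) ≤ L * δ ^ 2 * (3 / 4 + δ / 6 + L * δ ^ 2 / 12) * V)
    {p : ℝ} (hp : 1 ≤ p) :
    eLpNorm (fun z => phaseDist (Φ z) (verlet U δ z)) (ENNReal.ofReal p) (gibbs U) ≤
      ENNReal.ofReal (δ ^ 2 * Real.sqrt (d + max (p - 2) 0) * K3 L m δ) := by
  obtain ⟨x₀, hx₀⟩ := exists_gradient_eq_zero hU hm hConv
  set S := Real.sqrt (d + max (p - 2) 0) with hS
  set y := L * δ ^ 2 with hy
  have hy0 : 0 ≤ y := by positivity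
  have hy1 : y ≤ 1 / 9 := by rw [hy, mul_comm]; exact hδL
  have hS0 : 0 ≤ S := Real.sqrt_nonneg _
  set C := y * ((3 / 4 + δ / 6 + y / 12) / (1 - y / 2)) with hC
  have hC0 : 0 ≤ C := mul_nonneg hy0 (div_nonneg (by positivity) (by linarith))
  have hpt : ∀ z : Phase d, ‖phaseDist (Φ z) (verlet U δ z)‖ ≤
      C * ‖‖z.2‖ + δ * L / 2 * ‖z.1 - x₀‖‖ := fun z => by
    rw [norm_phaseDist,
      Real.norm_of_nonneg (by positivity)]
    have hne : 1 - y / 2 ≠ 0 := by linarith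
    have h1 := hΦ z ((‖z.2‖ + δ / 2 * ‖∇ U z.1‖) / (1 - y / 2)) (mul_div_cancel₀ _ hne).symm
    have h2 : ‖∇ U z.1‖ ≤ L * ‖z.1 - x₀‖ := by simpa [hx₀] using hLip z.1 x₀
    calc phaseDist (Φ z) (verlet U δ z)
        ≤ y * (3 / 4 + δ / 6 + y / 12) * ((‖z.2‖ + δ / 2 * ‖∇ U z.1‖) / (1 - y / 2)) := h1
      _ = C * (‖z.2‖ + δ / 2 * ‖∇ U z.1‖) := by rw [hC]; ring
      _ ≤ C * (‖z.2‖ + δ / 2 * (L * ‖z.1 - x₀‖)) := by gcongr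
      _ = _ := by ring
  have h1 : eLpNorm (fun z : Phase d => ‖z.2‖ + δ * L / 2 * ‖z.1 - x₀‖) (ENNReal.ofReal p)
      (gibbs U) ≤ ENNReal.ofReal (S + δ * L / 2 * (S / Real.sqrt m)) := by
    have e1 : eLpNorm (fun z : Phase d => ‖z.2‖) (ENNReal.ofReal p) (gibbs U) ≤
        ENNReal.ofReal S :=
      (eLpNorm_norm _).trans_le (eLpNorm_snd_gibbs_le hU hm hConv hp)
    have e2 : eLpNorm (fun z : Phase d => δ * L / 2 * ‖z.1 - x₀‖) (ENNReal.ofReal p) (gibbs U) ≤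
        ENNReal.ofReal (δ * L / 2) * ENNReal.ofReal (S / Real.sqrt m) := by
      refine (eLpNorm_le_mul_eLpNorm_of_ae_le_mul (g := fun z : Phase d => z.1 - x₀)
        (c := δ * L / 2) (Eventually.of_forall fun z => ?_) _).trans ?_
      · rw [Real.norm_of_nonneg (by positivity)]
      · gcongr
        rw [hS, ← Real.sqrt_div' _ hm.le]
        exact eLpNorm_fst_gibbs_le hU hm hConv hx₀ hp
    rw [ENNReal.ofReal_add hS0 (by positivity), ENNReal.ofReal_mul (by positivity)]
    exact (eLpNorm_add_le (by fun_prop) (by fun_prop) (by simpa using hp)).trans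
      (add_le_add e1 e2)
  refine (eLpNorm_le_mul_eLpNorm_of_ae_le_mul (Eventually.of_forall hpt) _).trans ?_
  refine (mul_le_mul_right h1 _).trans ?_
  rw [← ENNReal.ofReal_mul hC0]
  refine ENNReal.ofReal_le_ofReal ?_
  have hcoef := local_error_coeff_le hδ.le hy0 (by linarith)
  have e3 : S + δ * L / 2 * (S / Real.sqrt m) = S * (1 + δ * L / (2 * Real.sqrt m)) := by
    field_simp
  rw [e3]
  calc C * (S * (1 + δ * L / (2 * Real.sqrt m)))
      ≤ y * (1 + Real.exp y * (δ / 6 + y / 24)) * (S * (1 + δ * L / (2 * Real.sqrt m))) := by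
        gcongr
        exact mul_le_mul_of_nonneg_left hcoef hy0
    _ = δ ^ 2 * S * K3 L m δ := by
        rw [K3, hy]
        ring_nf

/-- Couplings of the Gibbs measure and of the invariant measure of the scheme, close in the twisted
norm. -/
theorem exists_coupling_twist_le (hU : ContDiff ℝ 2 U) (hL : 0 < L) (hm : 0 < m) (hmL : m ≤ L)
    (hLip : GradLip U L) (hConv : StrongConv U m) (hγ : 2 * Real.sqrt L ≤ γ) (hδ : 0 < δ)
    (hδγ : δ ≤ m / (33 * γ ^ 3)) {πδ : Measure (Phase d)} [IsProbabilityMeasure πδ]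
    (hinv : (obaboKernel U δ γ).Invariant πδ) {p : ℝ} (hp : 1 ≤ p)
    (hmem : MemLp (fun z : Phase d => z) (ENNReal.ofReal p) πδ) {ε : ℝ≥0∞} (hε : ε ≠ 0) :
    ∃ ζ ∈ couplings (gibbs U) πδ,
      eLpNorm (fun w : Phase d × Phase d => twist L γ (w.1 - w.2)) (ENNReal.ofReal p) ζ ≤
        ENNReal.ofReal (Real.sqrt (3 / 2) * max 1 (Real.sqrt L)⁻¹ *
          (δ * Real.sqrt (d + max (p - 2) 0) * (2 * K3 L m δ / kappa m γ))) + ε := by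
  have := isProbabilityMeasure_gibbs hU hm hConv
  have hγ0 := pos_of_two_sqrt_le hL hγ
  have hδγ0 : 0 ≤ δ * γ := by positivity
  have hδL : δ ^ 2 * L ≤ 1 / 9 :=
    (step_sq_mul_lip_le hL hm hmL hγ hδ hδγ).trans (by norm_num)
  obtain ⟨Φ, hΦm, hΦ, hΦerr⟩ := exists_hamiltonian_flow hU hL hm hLip hConv hδ hδL
  have hflow := measurePreserving_flowStep hU hm hConv hδγ0 ⟨hΦm, hΦ⟩
  set e := Real.sqrt (3 / 2) * max 1 (Real.sqrt L)⁻¹ with he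
  have he0 : 0 ≤ e := by positivity
  set S := Real.sqrt (d + max (p - 2) 0)
  have hK : 0 ≤ K3 L m δ := by rw [K3]; positivity
  have hV : Measurable (verlet U δ) := by
    have hg := continuous_gradient hU
    refine Continuous.measurable ?_
    unfold verlet stepA stepB
    fun_prop
  have herr : eLpNorm (fun w : Phase d × (E d × E d) =>
      twist L γ (flowStep Φ δ γ w.1 w.2 - obaboStep U δ γ w.1 w.2)) (ENNReal.ofReal p)
      ((gibbs U).prod ((stdGaussian (E d)).prod (stdGaussian (E d)))) ≤
      ENNReal.ofReal (e * (δ ^ 2 * S * K3 L m δ)) := by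
    have hf : AEStronglyMeasurable (fun z => phaseDist (Φ z) (verlet U δ z)) (gibbs U) :=
      (measurable_phaseDist.comp (hΦm.prodMk hV)).aestronglyMeasurable
    have hmp : MeasurePreserving (fun w : Phase d × (E d × E d) => stepO δ γ w.2.1 w.1)
        ((gibbs U).prod ((stdGaussian (E d)).prod (stdGaussian (E d)))) (gibbs U) :=
      (measurePreserving_stepO_gibbs hU hm hConv hδγ0).comp
        ((MeasurePreserving.id (gibbs U)).prod
          (measurePreserving_fst (μ := stdGaussian (E d)) (ν := stdGaussian (E d))))
    have hpt : ∀ w : Phase d × (E d × E d),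
        ‖twist L γ (flowStep Φ δ γ w.1 w.2 - obaboStep U δ γ w.1 w.2)‖ ≤
        e * ‖((fun z => phaseDist (Φ z) (verlet U δ z)) ∘
          fun w : Phase d × (E d × E d) => stepO δ γ w.2.1 w.1) w‖ := fun w => by
      rw [Function.comp, norm_phaseDist]
      exact (norm_twist_le_phaseDist hL hγ _ _).trans
        (mul_le_mul_of_nonneg_left (phaseDist_stepO_le hδγ0 _ _ _) he0)
    refine (eLpNorm_le_mul_eLpNorm_of_ae_le_mul (Eventually.of_forall hpt) _).trans ?_
    rw [eLpNorm_comp_measurePreserving hf hmp, ENNReal.ofReal_mul he0]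
    gcongr
    exact eLpNorm_phaseDist_verlet_le hU hm hL hLip hConv hδ hδL hΦerr hp
  obtain ⟨ζ, hζ, hle⟩ := exists_coupling_eLpNorm_le (F := obaboStep U δ γ)
    hflow.measurable (measurable_obaboMap hU δ γ)
    hflow.map_eq ((invariant_iff hU πδ).1 hinv) rho_nonneg (rho_lt_one hm hγ0 hδ)
    (fun z z' g => norm_twist_obaboMap_sub_le hU hL hm hmL hLip hConv hγ hδ hδγ z z' g.1 g.2)
    (by simpa using hp) (memLp_gibbs hU hm hConv hp) hmem herr hε
  refine ⟨ζ, hζ, hle.trans (add_le_add ?_ le_rfl)⟩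
  rw [← ENNReal.ofReal_mul (by positivity)]
  refine ENNReal.ofReal_le_ofReal ?_
  have hκ := kappa_pos hm hγ0
  have h1 := half_step_mul_kappa_le hL hm hmL hγ hδγ
  have h2 : 1 / (1 - rho m γ δ) ≤ 1 / (δ * kappa m γ / 2) :=
    one_div_le_one_div_of_le (by positivity) h1
  calc e * (δ ^ 2 * S * K3 L m δ) * (1 / (1 - rho m γ δ))
      ≤ e * (δ ^ 2 * S * K3 L m δ) * (1 / (δ * kappa m γ / 2)) := by gcongr
    _ = e * (δ * S * (2 * K3 L m δ / kappa m γ)) := by field_simp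

/-- The `W_p` bound, from the couplings of `exists_coupling_twist_le` by equivalence of norms. -/
theorem wasserstein_gibbs_le (hU : ContDiff ℝ 2 U) (hL : 0 < L) (hm : 0 < m) (hmL : m ≤ L)
    (hLip : GradLip U L) (hConv : StrongConv U m) (hγ : 2 * Real.sqrt L ≤ γ) (hδ : 0 < δ)
    (hδγ : δ ≤ m / (33 * γ ^ 3)) {πδ : Measure (Phase d)} [IsProbabilityMeasure πδ]
    (hinv : (obaboKernel U δ γ).Invariant πδ) {p : ℝ} (hp : 1 ≤ p)
    (hmem : MemLp (fun z : Phase d => z) (ENNReal.ofReal p) πδ) :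
    wasserstein p (gibbs U) πδ ≤ ENNReal.ofReal (δ * Real.sqrt (d + max (p - 2) 0) *
      (2 * K1 L * K3 L m δ / kappa m γ)) := by
  set c := Real.sqrt 2 * max 1 (Real.sqrt L) with hc
  have hc0 : 0 < c := by positivity
  refine ENNReal.le_of_forall_pos_le_add fun ε hε _ => ?_
  obtain ⟨ζ, hζ, hle⟩ := exists_coupling_twist_le hU hL hm hmL hLip hConv hγ hδ hδγ hinv hp hmem
    (ε := ENNReal.ofReal (ε / c)) (by simpa using div_pos (NNReal.coe_pos.2 hε) hc0)
  refine (iInf₂_le ζ hζ).trans ?_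
  rw [lintegral_phaseDist_eq ζ Prod.fst Prod.snd hp]
  have h1 : ∀ w : Phase d × Phase d, ‖phaseDist w.1 w.2‖ ≤ c * ‖twist L γ (w.1 - w.2)‖ :=
    fun w => by
      rw [norm_phaseDist]
      exact phaseDist_le_norm_twist hL hγ _ _
  refine (eLpNorm_le_mul_eLpNorm_of_ae_le_mul (Eventually.of_forall h1) _).trans ?_
  refine (mul_le_mul_right hle _).trans ?_
  rw [mul_add, ← ENNReal.ofReal_mul hc0.le, ← ENNReal.ofReal_mul hc0.le]
  refine add_le_add (le_of_eq ?_) (le_of_eq ?_)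
  · congr 1
    rw [← equivalence_constants hL]
    ring
  · rw [mul_div_cancel₀ _ hc0.ne', ENNReal.ofReal_coe_nnreal]

end WassersteinBias

/-! ### Total variation and translations of Gaussian vectors -/

section TotalVariation

variable {X : Type*} [MeasurableSpace X] {μ ν : Measure X} [IsProbabilityMeasure μ]
  [IsProbabilityMeasure ν]

/-- The coupling that keeps the common part `ξ = μ ∧ ν` on the diagonal bounds the total variation
norm by twice the largest excess of `μ` over `ν` on an event. -/
theorem tvNorm_le {ε : ℝ} (h : ∀ A, MeasurableSet A → μ.real A ≤ ν.real A + ε) :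
    tvNorm μ ν ≤ ENNReal.ofReal (2 * ε) := by
  classical
  -- `μ ≤ ν` on `s` and `ν ≤ μ` on its complement
  obtain ⟨s, hs, hs1, hs2⟩ := exists_isHahnDecomposition μ ν
  set ξ := μ.restrict s + ν.restrict sᶜ with hξ
  have hξμ : ξ ≤ μ := by
    rw [← Measure.restrict_add_restrict_compl (μ := μ) hs]
    exact add_le_add le_rfl hs2
  have hξν : ξ ≤ ν := by
    rw [← Measure.restrict_add_restrict_compl (μ := ν) hs]
    exact add_le_add hs1 le_rfl
  have hξfin : IsFiniteMeasure ξ := isFiniteMeasure_of_le μ hξμ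
  have hμ' := Measure.sub_add_cancel_of_le hξμ
  have hν' := Measure.sub_add_cancel_of_le hξν
  set μ' := μ - ξ
  set ν' := ν - ξ
  have hμ'fin : IsFiniteMeasure μ' := isFiniteMeasure_of_le μ Measure.sub_le
  have hν'fin : IsFiniteMeasure ν' := isFiniteMeasure_of_le ν Measure.sub_le
  have hmass : μ' Set.univ = ν' Set.univ := by
    have h1 : μ' Set.univ + ξ Set.univ = ν' Set.univ + ξ Set.univ := by
      rw [← Measure.add_apply, ← Measure.add_apply, hμ', hν', measure_univ, measure_univ]
    exact (ENNReal.add_left_inj (measure_ne_top ξ _)).1 h1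
  set r := μ' Set.univ with hr
  have hr_top : r ≠ ∞ := measure_ne_top _ _
  have hrε : r ≤ ENNReal.ofReal ε := by
    have h1 : r + ξ Set.univ = 1 := by
      rw [hr, ← Measure.add_apply, hμ', measure_univ]
    have h2 : ξ Set.univ = μ s + ν sᶜ := by
      simp [hξ]
    rw [h2] at h1
    have h3 := congrArg ENNReal.toReal h1
    rw [ENNReal.toReal_add hr_top (by simp), ENNReal.toReal_add (by simp) (by simp),
      ENNReal.toReal_one] at h3
    have h4 := h sᶜ hs.compl
    have h5 := probReal_add_probReal_compl (μ := μ) hs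
    simp only [Measure.real] at h4 h5
    rw [← ENNReal.ofReal_toReal hr_top]
    exact ENNReal.ofReal_le_ofReal (by linarith)
  have hdiag : Measurable fun x : X => (x, x) := by fun_prop
  refine (iInf₂_le (ξ.map (fun x => (x, x)) + r⁻¹ • μ'.prod ν') ?_).trans ?_
  · have hr1 : ∀ η : Measure X, IsFiniteMeasure η → η Set.univ = r → r⁻¹ • r • η = η :=
      fun η _ hη => by
        rw [smul_smul]
        rcases eq_or_ne r 0 with h0 | h0
        · rw [h0, Measure.measure_univ_eq_zero] at hη
          simp [hη]
        · rw [ENNReal.inv_mul_cancel h0 hr_top, one_smul]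
    have hfst : (ξ.map (fun x => (x, x)) + r⁻¹ • μ'.prod ν').map Prod.fst = μ := by
      rw [Measure.map_add _ _ measurable_fst, Measure.map_smul, Measure.map_fst_prod, ← hmass,
        hr1 μ' hμ'fin rfl, Measure.map_map measurable_fst hdiag, add_comm]
      exact (congrArg (μ' + ·) Measure.map_id).trans hμ'
    have hsnd : (ξ.map (fun x => (x, x)) + r⁻¹ • μ'.prod ν').map Prod.snd = ν := by
      rw [Measure.map_add _ _ measurable_snd, Measure.map_smul, Measure.map_snd_prod,
        hr1 ν' hν'fin hmass.symm, Measure.map_map measurable_snd hdiag, add_comm]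
      exact (congrArg (ν' + ·) Measure.map_id).trans hν'
    refine ⟨⟨?_⟩, hfst, hsnd⟩
    have := congrArg (fun η : Measure X => η Set.univ) hfst
    simpa [Measure.map_apply measurable_fst] using this
  · simp only [div_one, ENNReal.rpow_one]
    rw [lintegral_add_measure, lintegral_smul_measure]
    have h1 : ∫⁻ w, ENNReal.ofReal (if w.1 = w.2 then 0 else 2) ∂(ξ.map fun x => (x, x)) = 0 := by
      refine le_antisymm ((lintegral_map_le _ _).trans ?_) bot_le
      simp
    have h2 : ∫⁻ w, ENNReal.ofReal (if w.1 = w.2 then 0 else 2) ∂(μ'.prod ν') ≤ 2 * (r * r) := by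
      calc ∫⁻ w, ENNReal.ofReal (if w.1 = w.2 then 0 else 2) ∂(μ'.prod ν')
          ≤ ∫⁻ _, 2 ∂(μ'.prod ν') := by
            refine lintegral_mono fun w => ?_
            split_ifs <;> simp
        _ = 2 * (r * r) := by
            rw [lintegral_const, ← Set.univ_prod_univ, Measure.prod_prod, ← hmass]
    rw [h1, zero_add, smul_eq_mul]
    calc r⁻¹ * ∫⁻ w, ENNReal.ofReal (if w.1 = w.2 then 0 else 2) ∂(μ'.prod ν')
        ≤ r⁻¹ * (2 * (r * r)) := by gcongr
      _ = (r⁻¹ * r) * (2 * r) := by ring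
      _ ≤ 1 * (2 * r) := by gcongr; exact ENNReal.inv_mul_le_one r
      _ ≤ ENNReal.ofReal (2 * ε) := by
          rw [one_mul, ENNReal.ofReal_mul zero_le_two, ENNReal.ofReal_ofNat]
          gcongr

end TotalVariation

section GaussianShift

variable {V : Type*} [NormedAddCommGroup V] [InnerProductSpace ℝ V] [FiniteDimensional ℝ V]
  [MeasurableSpace V] [BorelSpace V]

/-- Density of the translate of a standard Gaussian vector. -/
theorem integral_comp_add_stdGaussian (φ : V → ℝ) (h : V) :
    ∫ g, φ (g + h) ∂stdGaussian V =
      ∫ g, φ g * Real.exp (inner ℝ g h - ‖h‖ ^ 2 / 2) ∂stdGaussian V := by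
  rw [stdGaussian_eq_tilted, integral_tilted, integral_tilted,
    ← integral_add_right_eq_self _ (-h)]
  congr 1
  ext1 v
  rw [neg_add_cancel_right, smul_eq_mul, smul_eq_mul, ← sub_eq_add_neg, norm_sub_sq_real]
  have : Real.exp (-((‖v‖ ^ 2 - 2 * inner ℝ v h + ‖h‖ ^ 2) / 2)) =
      Real.exp (-(‖v‖ ^ 2 / 2)) * Real.exp (inner ℝ v h - ‖h‖ ^ 2 / 2) := by
    rw [← Real.exp_add]; ring_nf
  rw [this]
  ring

theorem integral_exp_inner_sub (h : V) :
    ∫ g, Real.exp (inner ℝ g h - ‖h‖ ^ 2 / 2) ∂stdGaussian V = 1 := by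
  have := integral_comp_add_stdGaussian (fun _ : V => (1 : ℝ)) h
  simpa using this.symm

theorem integrable_exp_inner_sub (h : V) :
    Integrable (fun g : V => Real.exp (inner ℝ g h - ‖h‖ ^ 2 / 2)) (stdGaussian V) :=
  Integrable.of_integral_ne_zero (by rw [integral_exp_inner_sub]; exact one_ne_zero)

/-- The Hellinger bound on the effect of a translation: with `ψ² = e^{g·h - |h|²/2}` the density of
the translate, `|ψ² - 1| ≤ (2 / |h|) (ψ - 1)² + (|h| / 8) (ψ + 1)²`, and `∫ ψ = e^{-|h|²/8}`. -/
theorem integral_comp_add_sub_le {φ : V → ℝ} (hφ : Measurable φ) (h0 : ∀ x, 0 ≤ φ x)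
    (h1 : ∀ x, φ x ≤ 1) (h : V) :
    |∫ g, φ (g + h) ∂stdGaussian V - ∫ g, φ g ∂stdGaussian V| ≤ ‖h‖ / 2 := by
  rcases eq_or_ne h 0 with rfl | hne
  · simp
  set t := ‖h‖ with ht
  have ht0 : 0 < t := norm_pos_iff.2 hne
  set ψ : V → ℝ := fun g => Real.exp ((inner ℝ g h - t ^ 2 / 2) / 2) with hψ
  set a := Real.exp (-(t ^ 2 / 8)) with ha
  have hsq : ∀ g, ψ g ^ 2 = Real.exp (inner ℝ g h - t ^ 2 / 2) := fun g => by
    rw [hψ, ← Real.exp_nat_mul]; congr 1; push_cast; ring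
  have hhalf : ∀ g, ψ g = a * Real.exp (inner ℝ g ((1 / 2 : ℝ) • h) - ‖(1 / 2 : ℝ) • h‖ ^ 2 / 2) :=
    fun g => by
      simp only [hψ]
      rw [ha, ← Real.exp_add, norm_smul, inner_smul_right, ← ht]
      congr 1
      rw [Real.norm_of_nonneg (by norm_num)]
      ring
  have i1 : Integrable ψ (stdGaussian V) := by
    rw [funext hhalf]; exact (integrable_exp_inner_sub _).const_mul a
  have i2 : Integrable (fun g => ψ g ^ 2) (stdGaussian V) := by
    rw [funext hsq]; exact integrable_exp_inner_sub h
  have e1 : ∫ g, ψ g ∂stdGaussian V = a := by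
    rw [funext hhalf, integral_const_mul, integral_exp_inner_sub, mul_one]
  have e2 : ∫ g, ψ g ^ 2 ∂stdGaussian V = 1 := by
    rw [funext hsq]; exact integral_exp_inner_sub h
  have iφ : Integrable φ (stdGaussian V) :=
    Integrable.of_bound hφ.aestronglyMeasurable 1 (Eventually.of_forall fun x => by
      rw [Real.norm_of_nonneg (h0 x)]; exact h1 x)
  have iφψ : Integrable (fun g => φ g * ψ g ^ 2) (stdGaussian V) :=
    i2.bdd_mul hφ.aestronglyMeasurable (c := 1) (Eventually.of_forall fun x => by
      rw [Real.norm_of_nonneg (h0 x)]; exact h1 x)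
  -- `ψ² - 1` has mean zero, so `φ` may be centred to have modulus at most `1 / 2`
  have e3 : ∫ g, φ (g + h) ∂stdGaussian V - ∫ g, φ g ∂stdGaussian V =
      ∫ g, (φ g - 1 / 2) * (ψ g ^ 2 - 1) ∂stdGaussian V := by
    have e4 : ∀ g, (φ g - 1 / 2) * (ψ g ^ 2 - 1) =
        φ g * ψ g ^ 2 - φ g - (1 / 2 * ψ g ^ 2 - 1 / 2) := fun g => by ring
    simp_rw [e4]
    have j1 : Integrable (fun g => φ g * ψ g ^ 2 - φ g) (stdGaussian V) := iφψ.sub iφ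
    have j2 : Integrable (fun g => 1 / 2 * ψ g ^ 2) (stdGaussian V) := i2.const_mul _
    have j3 : Integrable (fun g => 1 / 2 * ψ g ^ 2 - 1 / 2) (stdGaussian V) :=
      j2.sub (integrable_const _)
    rw [integral_sub j1 j3, integral_sub iφψ iφ, integral_sub j2 (integrable_const _),
      integral_const_mul, e2, integral_comp_add_stdGaussian]
    simp only [hsq, ht]
    simp
  have hb : ∀ g, ‖(φ g - 1 / 2) * (ψ g ^ 2 - 1)‖ ≤
      1 / t * (ψ g ^ 2 - 2 * ψ g + 1) + t / 16 * (ψ g ^ 2 + 2 * ψ g + 1) := fun g => by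
    have hp : 0 < ψ g := Real.exp_pos _
    have hab : |φ g - 1 / 2| ≤ 1 / 2 := abs_le.2 ⟨by linarith [h0 g], by linarith [h1 g]⟩
    have hf : |ψ g ^ 2 - 1| = |ψ g - 1| * (ψ g + 1) := by
      have hp1 : 0 < ψ g + 1 := by linarith
      rw [show ψ g ^ 2 - 1 = (ψ g - 1) * (ψ g + 1) by ring, abs_mul, abs_of_pos hp1]
    rw [norm_mul, Real.norm_eq_abs, Real.norm_eq_abs, hf]
    have hsq1 : (ψ g - 1) ^ 2 = |ψ g - 1| ^ 2 := (sq_abs _).symm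
    have key : |ψ g - 1| * (ψ g + 1) ≤ 2 / t * |ψ g - 1| ^ 2 + t / 8 * (ψ g + 1) ^ 2 := by
      have h2 : 2 / t * |ψ g - 1| ^ 2 + t / 8 * (ψ g + 1) ^ 2 - |ψ g - 1| * (ψ g + 1) =
          1 / (8 * t) * (4 * |ψ g - 1| - t * (ψ g + 1)) ^ 2 := by
        field_simp; ring
      have h3 : 0 ≤ 1 / (8 * t) * (4 * |ψ g - 1| - t * (ψ g + 1)) ^ 2 := by positivity
      linarith
    calc |φ g - 1 / 2| * (|ψ g - 1| * (ψ g + 1))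
        ≤ 1 / 2 * (|ψ g - 1| * (ψ g + 1)) := by gcongr
      _ ≤ 1 / 2 * (2 / t * |ψ g - 1| ^ 2 + t / 8 * (ψ g + 1) ^ 2) := by gcongr
      _ = _ := by rw [← hsq1]; ring
  have ib : ∀ c : ℝ, Integrable (fun g => ψ g ^ 2 + c * ψ g + 1) (stdGaussian V) := fun c =>
    (i2.add (i1.const_mul c)).add (integrable_const _)
  have eb : ∀ c : ℝ, ∫ g, (ψ g ^ 2 + c * ψ g + 1) ∂stdGaussian V = 2 + c * a := fun c => by
    have j1 : Integrable (fun g => c * ψ g) (stdGaussian V) := i1.const_mul c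
    have j2 : Integrable (fun g => ψ g ^ 2 + c * ψ g) (stdGaussian V) := i2.add j1
    rw [integral_add j2 (integrable_const _), integral_add i2 j1, integral_const_mul, e1, e2,
      integral_const, probReal_univ, one_smul]
    ring
  have hb' : ∀ g, ‖(φ g - 1 / 2) * (ψ g ^ 2 - 1)‖ ≤
      1 / t * (ψ g ^ 2 + (-2) * ψ g + 1) + t / 16 * (ψ g ^ 2 + 2 * ψ g + 1) := fun g =>
    (hb g).trans (le_of_eq (by ring))
  rw [e3, ← Real.norm_eq_abs]
  have j1 : Integrable (fun g => 1 / t * (ψ g ^ 2 + (-2) * ψ g + 1)) (stdGaussian V) :=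
    (ib (-2)).const_mul _
  have j2 : Integrable (fun g => t / 16 * (ψ g ^ 2 + 2 * ψ g + 1)) (stdGaussian V) :=
    (ib 2).const_mul _
  have j3 : Integrable (fun g => 1 / t * (ψ g ^ 2 + (-2) * ψ g + 1) +
    t / 16 * (ψ g ^ 2 + 2 * ψ g + 1)) (stdGaussian V) := j1.add j2
  refine (norm_integral_le_of_norm_le j3 (Eventually.of_forall hb')).trans ?_
  rw [integral_add j1 j2, integral_const_mul, integral_const_mul, eb, eb]
  have ha1 : a ≤ 1 := Real.exp_le_one_iff.2 (by nlinarith)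
  have ha2 : 1 - t ^ 2 / 8 ≤ a := by
    have := Real.add_one_le_exp (-(t ^ 2 / 8)); linarith
  have h3 : 1 / t * (2 + -2 * a) ≤ 1 / t * (t ^ 2 / 4) := by gcongr; linarith
  have h4 : 1 / t * (t ^ 2 / 4) = t / 4 := by field_simp
  have h5 : t / 16 * (2 + 2 * a) ≤ t / 16 * 4 := by gcongr; linarith
  linarith

/-- Translating two independent standard Gaussian vectors. -/
theorem integral_comp_add_sub_le_prod {φ : V × V → ℝ} (hφ : Measurable φ) (h0 : ∀ x, 0 ≤ φ x)
    (h1 : ∀ x, φ x ≤ 1) (h h' : V) :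
    |∫ g, φ (g.1 + h, g.2 + h') ∂(stdGaussian V).prod (stdGaussian V) -
      ∫ g, φ g ∂(stdGaussian V).prod (stdGaussian V)| ≤ (‖h‖ + ‖h'‖) / 2 := by
  have hbd : ∀ {Z : Type _} [MeasurableSpace Z] (μ : Measure Z) [IsProbabilityMeasure μ]
      (f : Z → V × V), Measurable f → Integrable (fun z => φ (f z)) μ := fun μ _ f hf =>
    Integrable.of_bound (hφ.comp hf).aestronglyMeasurable 1 (Eventually.of_forall fun x => by
      rw [Real.norm_of_nonneg (h0 _)]; exact h1 _)
  set ψ : V → ℝ := fun g => ∫ g', φ (g, g') ∂stdGaussian V with hψ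
  have hψm : Measurable ψ := (hφ.stronglyMeasurable.integral_prod_right').measurable
  have hψ0 : ∀ g, 0 ≤ ψ g := fun g => integral_nonneg fun _ => h0 _
  have hψ1 : ∀ g, ψ g ≤ 1 := fun g => by
    refine (integral_mono (hbd (stdGaussian V) _ measurable_prodMk_left) (integrable_const 1)
      fun _ => h1 _).trans ?_
    simp
  have hψi : Integrable (fun g => ψ (g + h)) (stdGaussian V) :=
    Integrable.of_bound (hψm.comp (by fun_prop)).aestronglyMeasurable 1
      (Eventually.of_forall fun x => by rw [Real.norm_of_nonneg (hψ0 _)]; exact hψ1 _)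
  have hI := hbd ((stdGaussian V).prod (stdGaussian V)) (fun g => (g.1 + h, g.2 + h')) (by fun_prop)
  have e1 : ∫ g, φ g ∂(stdGaussian V).prod (stdGaussian V) = ∫ g, ψ g ∂stdGaussian V :=
    integral_prod _ (hbd _ (fun g => g) measurable_id)
  have e2 : ∫ g, φ (g.1 + h, g.2 + h') ∂(stdGaussian V).prod (stdGaussian V) =
      ∫ g, ∫ g', φ (g + h, g' + h') ∂stdGaussian V ∂stdGaussian V := integral_prod _ hI
  have e3 : |∫ g, ∫ g', φ (g + h, g' + h') ∂stdGaussian V ∂stdGaussian V -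
      ∫ g, ψ (g + h) ∂stdGaussian V| ≤ ‖h'‖ / 2 := by
    rw [← integral_sub hI.integral_prod_left hψi, ← Real.norm_eq_abs]
    refine (norm_integral_le_of_norm_le_const (C := ‖h'‖ / 2)
      (Eventually.of_forall fun g => ?_)).trans (by simp)
    exact integral_comp_add_sub_le (φ := fun g' => φ (g + h, g')) (hφ.comp measurable_prodMk_left)
      (fun _ => h0 _) (fun _ => h1 _) h'
  have e4 := integral_comp_add_sub_le hψm hψ0 hψ1 h
  rw [e1, e2]
  calc _ ≤ _ := abs_sub_le _ (∫ g, ψ (g + h) ∂stdGaussian V) _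
    _ ≤ _ := add_le_add e3 e4
    _ = _ := by ring

end GaussianShift

/-! ### Energy error of the Verlet step -/

section VerletBias

variable {d : ℕ} {U : E d → ℝ} {L m : ℝ}

theorem measurePreserving_verlet (hU : ContDiff ℝ 2 U) (t : ℝ) :
    MeasurePreserving (verlet U t) (volume : Measure (Phase d)) volume := by
  have hg := continuous_gradient hU
  have hB : MeasurePreserving (stepB U t) (volume : Measure (Phase d)) volume := by
    have h := measurePreserving_shear_snd (f := fun x => -((t / 2) • ∇ U x)) (by fun_prop)
    have e : stepB U t = fun z => (z.1, z.2 + -((t / 2) • ∇ U z.1)) := by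
      ext1 z; simp only [stepB, sub_eq_add_neg]
    rw [e]
    exact h
  have hA : MeasurePreserving (stepA t) (volume : Measure (Phase d)) volume :=
    measurePreserving_shear_fst (f := fun v : E d => t • v) (by fun_prop)
  exact hB.comp (hA.comp hB)

/-- The Verlet step is reversible: undoing it is stepping with the opposite time step. -/
theorem verlet_verlet_neg (U : E d → ℝ) (t : ℝ) (z : Phase d) :
    verlet U t (verlet U (-t) z) = z := by
  simp only [verlet, stepA, stepB]
  have e1 : z.1 + -t • (z.2 - (-t / 2) • ∇ U z.1) +
      t • (z.2 - (-t / 2) • ∇ U z.1 - (-t / 2) • ∇ U (z.1 + -t • (z.2 - (-t / 2) • ∇ U z.1)) -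
        (t / 2) • ∇ U (z.1 + -t • (z.2 - (-t / 2) • ∇ U z.1))) = z.1 := by module
  rw [e1]
  ext1
  · rfl
  · simp only; module

/-- A volume preserving map changes the Gibbs average of an observable with values in `[0, 1]` by at
most the average energy increase along the inverse map. -/
theorem abs_integral_comp_sub_gibbs_le (hU : ContDiff ℝ 2 U) (hm : 0 < m) (hConv : StrongConv U m)
    {Ψ Ψ' : Phase d → Phase d} (hΨ' : MeasurePreserving Ψ' volume volume)
    (hinv : ∀ z, Ψ (Ψ' z) = z) (hΨm : Measurable Ψ) {B : Phase d → ℝ}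
    (hB : ∀ z, hamiltonian U (Ψ' z) - hamiltonian U z ≤ B z)
    (hB0 : ∀ z, 0 ≤ B z) (hBi : Integrable B (gibbs U)) {f : Phase d → ℝ} (hf : Measurable f)
    (h0 : ∀ z, 0 ≤ f z) (h1 : ∀ z, f z ≤ 1) :
    |∫ z, f (Ψ z) ∂gibbs U - ∫ z, f z ∂gibbs U| ≤ ∫ z, B z ∂gibbs U := by
  have hprob := isProbabilityMeasure_gibbs hU hm hConv
  have hHm : Measurable (hamiltonian U) := by
    have := hU.continuous
    unfold hamiltonian
    fun_prop
  have hH := integrable_exp_neg_hamiltonian hU hm hConv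
  set D : Phase d → ℝ := fun z => Real.exp (-(hamiltonian U (Ψ' z) - hamiltonian U z)) with hD
  -- the image of the Gibbs measure under `Ψ` has density `D`
  have hchange : ∀ φ : Phase d → ℝ, Measurable φ →
      ∫ z, φ (Ψ z) ∂gibbs U = ∫ z, φ z * D z ∂gibbs U := fun φ hφ => by
    rw [gibbs, integral_tilted, integral_tilted, ← hΨ'.map_eq,
      integral_map hΨ'.measurable.aemeasurable (by fun_prop), hΨ'.map_eq]
    congr 1
    ext1 z
    have : Real.exp (-hamiltonian U (Ψ' z)) = Real.exp (-hamiltonian U z) * D z := by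
      rw [hD, ← Real.exp_add]; congr 1; ring
    rw [hinv, this, smul_eq_mul, smul_eq_mul]
    ring
  have hDi : Integrable D (gibbs U) := by
    refine Integrable.of_integral_ne_zero ?_
    have := hchange (fun _ => 1) measurable_const
    simp only [one_mul] at this
    rw [← this]
    simp
  have hD1 : ∀ z, 1 - D z ≤ B z := fun z => by
    have := Real.add_one_le_exp (-(hamiltonian U (Ψ' z) - hamiltonian U z))
    have := hB z
    simp only [hD]
    linarith
  have key : ∀ φ : Phase d → ℝ, Measurable φ → (∀ z, 0 ≤ φ z) → (∀ z, φ z ≤ 1) →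
      ∫ z, φ z ∂gibbs U - ∫ z, φ (Ψ z) ∂gibbs U ≤ ∫ z, B z ∂gibbs U := fun φ hφ p0 p1 => by
    have hbd : ∀ z, ‖φ z‖ ≤ 1 := fun z => by rw [Real.norm_of_nonneg (p0 z)]; exact p1 z
    have i1 : Integrable φ (gibbs U) :=
      Integrable.of_bound hφ.aestronglyMeasurable 1 (Eventually.of_forall hbd)
    have i2 : Integrable (fun z => φ z * D z) (gibbs U) :=
      hDi.bdd_mul hφ.aestronglyMeasurable (c := 1) (Eventually.of_forall hbd)
    rw [hchange φ hφ, ← integral_sub i1 i2]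
    refine integral_mono (i1.sub i2) hBi fun z => ?_
    calc φ z - φ z * D z = φ z * (1 - D z) := by ring
      _ ≤ φ z * B z := mul_le_mul_of_nonneg_left (hD1 z) (p0 z)
      _ ≤ B z := mul_le_of_le_one_left (hB0 z) (p1 z)
  have iC : ∀ g : Phase d → Phase d, Measurable g → Integrable (fun z => f (g z)) (gibbs U) :=
    fun g hg => Integrable.of_bound (hf.comp hg).aestronglyMeasurable 1
      (Eventually.of_forall fun z => by rw [Real.norm_of_nonneg (h0 _)]; exact h1 _)
  have k1 := key f hf h0 h1
  have k2 := key (fun z => 1 - f z) (measurable_const.sub hf) (fun z => by linarith [h1 z])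
    (fun z => by linarith [h0 z])
  rw [integral_sub (integrable_const _) (iC (fun z => z) measurable_id),
    integral_sub (integrable_const _) (iC Ψ hΨm)] at k2
  exact abs_le.2 ⟨by linarith, by linarith⟩

/-- Energy increase along a Verlet step. The potential part is bounded by the trapezoidal rule of
`increment_le_trapezoid`, whose main term is exactly cancelled by the kinetic part. What is left is
`L t² |u|² / 4`, with `u` the velocity during the drift, and a difference of squared forces. -/
theorem hamiltonian_verlet_sub_le (hU : ContDiff ℝ 2 U) (hL : 0 < L) (hm : 0 < m)
    (hLip : GradLip U L) (hConv : StrongConv U m) {t : ℝ} (ht : t ^ 2 * L ≤ 1 / 100)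
    {x₀ : E d} (hx₀ : ∇ U x₀ = 0) (z : Phase d) :
    hamiltonian U (verlet U t z) - hamiltonian U z ≤
      t ^ 2 * L / 4 * (3 / 2 * ‖z.2‖ ^ 2 + 3 * (t ^ 2 * L ^ 2 * ‖z.1 - x₀‖ ^ 2)) := by
  set u := z.2 - (t / 2) • ∇ U z.1 with hu
  set y := z.1 + t • u with hy
  have hv : verlet U t z = (y, u - (t / 2) • ∇ U y) := rfl
  have hz2 : z.2 = u + (t / 2) • ∇ U z.1 := by rw [hu]; abel
  have hyz : y - z.1 = t • u := by rw [hy]; abel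
  have h1 := increment_le_trapezoid (hasGradientAt_gradient hU) hLip
    (inner_gradient_sub_nonneg hm hConv) z.1 y
  rw [hyz, inner_smul_right, inner_add_left, norm_smul, mul_pow, Real.norm_eq_abs, sq_abs] at h1
  have e1 : ‖u - (t / 2) • ∇ U y‖ ^ 2 =
      ‖u‖ ^ 2 - t * inner ℝ (∇ U y) u + t ^ 2 / 4 * ‖∇ U y‖ ^ 2 := by
    rw [norm_sub_sq_real, inner_smul_right, norm_smul, mul_pow, Real.norm_eq_abs, sq_abs,
      real_inner_comm]
    ring
  have e2 : ‖z.2‖ ^ 2 = ‖u‖ ^ 2 + t * inner ℝ (∇ U z.1) u + t ^ 2 / 4 * ‖∇ U z.1‖ ^ 2 := by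
    rw [hz2, norm_add_sq_real, inner_smul_right, norm_smul, mul_pow, Real.norm_eq_abs, sq_abs,
      real_inner_comm]
    ring
  have h2 : ‖∇ U y‖ ≤ ‖∇ U z.1‖ + L * (|t| * ‖u‖) := by
    have := hLip y z.1
    rw [hyz, norm_smul, Real.norm_eq_abs] at this
    have h3 := norm_sub_norm_le (∇ U y) (∇ U z.1)
    linarith
  have h3 : ‖∇ U y‖ ^ 2 ≤ (‖∇ U z.1‖ + L * (|t| * ‖u‖)) ^ 2 :=
    pow_le_pow_left₀ (norm_nonneg _) h2 2
  have h4 : ‖u‖ ≤ ‖z.2‖ + |t| / 2 * ‖∇ U z.1‖ := by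
    refine (norm_sub_le _ _).trans_eq ?_
    rw [norm_smul, Real.norm_eq_abs, abs_div, abs_two]
  have h5 : ‖∇ U z.1‖ ≤ L * ‖z.1 - x₀‖ := by simpa [hx₀] using hLip z.1 x₀
  rw [hv]
  simp only [hamiltonian]
  have hsum : U y + ‖u - (t / 2) • ∇ U y‖ ^ 2 / 2 - (U z.1 + ‖z.2‖ ^ 2 / 2) ≤
      L / 4 * (t ^ 2 * ‖u‖ ^ 2) + t ^ 2 / 8 * (‖∇ U y‖ ^ 2 - ‖∇ U z.1‖ ^ 2) := by
    rw [e1, e2]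
    linarith
  refine hsum.trans ?_
  have hτ : |t| ^ 2 = t ^ 2 := sq_abs t
  set g := ‖∇ U z.1‖ with hg
  set q := ‖u‖ with hq
  set a := ‖z.2‖ with ha
  set τ := |t| with hτd
  have hτ0 : 0 ≤ τ := abs_nonneg t
  have hg0 : 0 ≤ g := norm_nonneg _
  have hq0 : 0 ≤ q := norm_nonneg _
  have ha0 : 0 ≤ a := norm_nonneg _
  rw [← hτ] at ht ⊢
  -- everything in terms of `q`, `a` and `w = |t| |∇U(x)|`
  set w := τ * g with hw
  have hw0 : 0 ≤ w := by positivity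
  have s1 : L / 4 * (τ ^ 2 * q ^ 2) + τ ^ 2 / 8 * (‖∇ U y‖ ^ 2 - g ^ 2) ≤
      τ ^ 2 * L / 4 * (q ^ 2 * (1 + τ ^ 2 * L / 2) + q * w) := by
    have : τ ^ 2 / 8 * (‖∇ U y‖ ^ 2 - g ^ 2) ≤
        τ ^ 2 / 8 * ((g + L * (τ * q)) ^ 2 - g ^ 2) := by gcongr
    refine (add_le_add le_rfl this).trans (le_of_eq ?_)
    rw [hw]; ring
  have s2 : q ≤ a + w / 2 := by rw [hw]; linarith
  have s3 : q ^ 2 * (1 + τ ^ 2 * L / 2) + q * w ≤ 3 / 2 * a ^ 2 + 3 * w ^ 2 := by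
    have t1 : q ^ 2 ≤ (a + w / 2) ^ 2 := pow_le_pow_left₀ hq0 s2 2
    have t2 : q * w ≤ (a + w / 2) * w := mul_le_mul_of_nonneg_right s2 hw0
    have t3 : q ^ 2 * (1 + τ ^ 2 * L / 2) ≤ q ^ 2 * (201 / 200) :=
      mul_le_mul_of_nonneg_left (by linarith) (sq_nonneg q)
    nlinarith only [t1, t2, t3, sq_nonneg (a - 2 * w), sq_nonneg w]
  have s4 : w ^ 2 ≤ τ ^ 2 * L ^ 2 * ‖z.1 - x₀‖ ^ 2 := by
    have := pow_le_pow_left₀ hg0 h5 2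
    calc w ^ 2 = τ ^ 2 * g ^ 2 := by rw [hw]; ring
      _ ≤ τ ^ 2 * (L * ‖z.1 - x₀‖) ^ 2 := by gcongr
      _ = _ := by ring
  have s5 : 0 ≤ τ ^ 2 * L / 4 := by positivity
  refine s1.trans (mul_le_mul_of_nonneg_left (s3.trans ?_) s5)
  linarith

/-- An `L²` bound in terms of `eLpNorm`, restated for the integral of the square. -/
theorem integral_norm_sq_le {Z F : Type*} [MeasurableSpace Z] [NormedAddCommGroup F] {μ : Measure Z}
    {f : Z → F} (hf : AEStronglyMeasurable f μ) {S : ℝ}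
    (h : eLpNorm f (ENNReal.ofReal 2) μ ≤ ENNReal.ofReal (Real.sqrt S)) (hS : 0 ≤ S) :
    Integrable (fun z => ‖f z‖ ^ 2) μ ∧ ∫ z, ‖f z‖ ^ 2 ∂μ ≤ S := by
  rw [ENNReal.ofReal_ofNat] at h
  have hmem : MemLp f 2 μ := ⟨hf, h.trans_lt ENNReal.ofReal_lt_top⟩
  refine ⟨hmem.integrable_norm_pow (p := 2) (by norm_num), ?_⟩
  rw [hmem.eLpNorm_eq_integral_rpow_norm (by norm_num) (by norm_num)] at h
  have h1 := (ENNReal.ofReal_le_ofReal_iff (Real.sqrt_nonneg _)).1 h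
  simp only [ENNReal.toReal_ofNat, Real.rpow_ofNat] at h1
  have h0 : 0 ≤ ∫ z, ‖f z‖ ^ 2 ∂μ := integral_nonneg fun _ => by positivity
  rw [← one_div, ← Real.sqrt_eq_rpow] at h1
  exact (Real.sqrt_le_sqrt_iff hS).1 h1

/-- One Verlet step changes Gibbs averages by `O(δ² d L)`. -/
theorem abs_integral_verlet_sub_gibbs_le (hU : ContDiff ℝ 2 U) (hL : 0 < L) (hm : 0 < m)
    (hLip : GradLip U L) (hConv : StrongConv U m) {δ : ℝ} (hδ : 0 < δ)
    (hδL : δ ^ 2 * L ≤ 1 / 100) (hδm : δ * L / Real.sqrt m ≤ 1 / 10)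
    {f : Phase d → ℝ} (hf : Measurable f) (h0 : ∀ z, 0 ≤ f z) (h1 : ∀ z, f z ≤ 1) :
    |∫ z, f (verlet U δ z) ∂gibbs U - ∫ z, f z ∂gibbs U| ≤ δ ^ 2 * L * d / 2 := by
  have hprob := isProbabilityMeasure_gibbs hU hm hConv
  obtain ⟨x₀, hx₀⟩ := exists_gradient_eq_zero hU hm hConv
  have m1 := eLpNorm_fst_gibbs_le hU hm hConv hx₀ one_le_two
  have m2 := eLpNorm_snd_gibbs_le hU hm hConv one_le_two
  rw [sub_self, max_self, add_zero] at m1 m2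
  obtain ⟨i1, e1⟩ := integral_norm_sq_le (by fun_prop) m1 (by positivity)
  obtain ⟨i2, e2⟩ := integral_norm_sq_le (by fun_prop) m2 (Nat.cast_nonneg d)
  set B : Phase d → ℝ := fun z =>
    δ ^ 2 * L / 4 * (3 / 2 * ‖z.2‖ ^ 2 + 3 * (δ ^ 2 * L ^ 2 * ‖z.1 - x₀‖ ^ 2)) with hB
  have j1 : Integrable (fun z : Phase d => 3 / 2 * ‖z.2‖ ^ 2) (gibbs U) := i2.const_mul _
  have j2 : Integrable (fun z : Phase d => 3 * (δ ^ 2 * L ^ 2 * ‖z.1 - x₀‖ ^ 2)) (gibbs U) :=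
    (i1.const_mul _).const_mul _
  have hBi : Integrable B (gibbs U) := (j1.add j2).const_mul _
  refine (abs_integral_comp_sub_gibbs_le hU hm hConv (measurePreserving_verlet hU (-δ))
    (verlet_verlet_neg U δ) (measurePreserving_verlet hU δ).measurable (B := B) (fun z => ?_)
    (fun z => by positivity) hBi hf h0 h1).trans ?_
  · have := hamiltonian_verlet_sub_le hU hL hm hLip hConv (t := -δ) (by rwa [neg_sq]) hx₀ z
    rwa [neg_sq] at this
  · have hint : ∫ z, B z ∂gibbs U = δ ^ 2 * L / 4 * (3 / 2 * ∫ z : Phase d, ‖z.2‖ ^ 2 ∂gibbs U +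
        3 * (δ ^ 2 * L ^ 2 * ∫ z : Phase d, ‖z.1 - x₀‖ ^ 2 ∂gibbs U)) := by
      simp only [hB]
      rw [integral_const_mul, integral_add j1 j2, integral_const_mul, integral_const_mul,
        integral_const_mul]
    rw [hint]
    have hd : (0 : ℝ) ≤ d := Nat.cast_nonneg d
    have h3 : δ ^ 2 * L ^ 2 * ((d : ℝ) / m) ≤ 1 / 100 * d := by
      have h4 : (δ * L / Real.sqrt m) ^ 2 ≤ (1 / 10) ^ 2 :=
        pow_le_pow_left₀ (by positivity) hδm 2
      rw [div_pow, mul_pow, Real.sq_sqrt hm.le] at h4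
      calc δ ^ 2 * L ^ 2 * ((d : ℝ) / m) = δ ^ 2 * L ^ 2 / m * d := by ring
        _ ≤ (1 / 10 : ℝ) ^ 2 * d := by gcongr
        _ = _ := by norm_num
    calc _ ≤ δ ^ 2 * L / 4 * (3 / 2 * d + 3 * (δ ^ 2 * L ^ 2 * (d / m))) := by gcongr
      _ ≤ δ ^ 2 * L / 4 * (3 / 2 * d + 3 * (1 / 100 * d)) := by gcongr
      _ ≤ δ ^ 2 * L / 4 * (2 * d) := by gcongr; linarith
      _ = _ := by ring

end VerletBias

/-! ### Smoothing and contraction of the transition semigroup -/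

section Semigroup

variable {d : ℕ} {U : E d → ℝ} {L m γ δ : ℝ}

theorem integral_comp_measurePreserving {Z W : Type*} [MeasurableSpace Z] [MeasurableSpace W]
    {μ : Measure Z} {ν : Measure W} {e : Z → W} (he : MeasurePreserving e μ ν) {f : W → ℝ}
    (hf : Measurable f) : ∫ z, f (e z) ∂μ = ∫ w, f w ∂ν := by
  rw [← he.map_eq, integral_map he.measurable.aemeasurable hf.aestronglyMeasurable]

/-- Measurable observables with values in `[0, 1]`. -/
structure IsTest {Z : Type*} [MeasurableSpace Z] (f : Z → ℝ) : Prop where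
  measurable : Measurable f
  nonneg : ∀ z, 0 ≤ f z
  le_one : ∀ z, f z ≤ 1

theorem IsTest.comp {Z W : Type*} [MeasurableSpace Z] [MeasurableSpace W] {f : W → ℝ}
    (hf : IsTest f) {e : Z → W} (he : Measurable e) : IsTest fun z => f (e z) :=
  ⟨hf.measurable.comp he, fun _ => hf.nonneg _, fun _ => hf.le_one _⟩

theorem IsTest.integrable {Z : Type*} [MeasurableSpace Z] {f : Z → ℝ} (hf : IsTest f)
    (μ : Measure Z) [IsFiniteMeasure μ] : Integrable f μ :=
  Integrable.of_bound hf.measurable.aestronglyMeasurable 1 (Eventually.of_forall fun z => by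
    rw [Real.norm_of_nonneg (hf.nonneg z)]; exact hf.le_one z)

theorem IsTest.integral {Z W : Type*} [MeasurableSpace Z] [MeasurableSpace W] {f : Z × W → ℝ}
    (hf : IsTest f) (μ : Measure W) [IsProbabilityMeasure μ] :
    IsTest fun z => ∫ w, f (z, w) ∂μ := by
  refine ⟨hf.measurable.stronglyMeasurable.integral_prod_right'.measurable,
    fun z => integral_nonneg fun _ => hf.nonneg _, fun z => ?_⟩
  refine (integral_mono ((hf.comp measurable_prodMk_left).integrable μ) (integrable_const 1)
    fun _ => hf.le_one _).trans ?_
  simp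

/-- The action `P f` of the chain on an observable `f`. -/
def average {d : ℕ} (U : E d → ℝ) (δ γ : ℝ) (f : Phase d → ℝ) (z : Phase d) : ℝ :=
  ∫ g, f (obaboStep U δ γ z g) ∂(stdGaussian (E d)).prod (stdGaussian (E d))

theorem measurable_uncurry_obaboStep (hU : ContDiff ℝ 2 U) (δ γ : ℝ) :
    Measurable (Function.uncurry (obaboStep U δ γ)) := measurable_obaboMap hU δ γ

theorem IsTest.average (hU : ContDiff ℝ 2 U) (δ γ : ℝ) {f : Phase d → ℝ} (hf : IsTest f) :
    IsTest (average U δ γ f) :=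
  (hf.comp (measurable_uncurry_obaboStep hU δ γ)).integral _

theorem IsTest.iterate_average (hU : ContDiff ℝ 2 U) (δ γ : ℝ) {f : Phase d → ℝ} (hf : IsTest f)
    (n : ℕ) : IsTest ((OBABO.average U δ γ)^[n] f) := by
  induction n with
  | zero => exact hf
  | succ n ih => rw [Function.iterate_succ_apply']; exact ih.average hU δ γ

theorem integral_average_of_invariant (hU : ContDiff ℝ 2 U) {ν : Measure (Phase d)}
    [IsProbabilityMeasure ν] (hν : (obaboKernel U δ γ).Invariant ν) {f : Phase d → ℝ}
    (hf : IsTest f) : ∫ z, average U δ γ f z ∂ν = ∫ z, f z ∂ν := by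
  have hm := measurable_uncurry_obaboStep hU δ γ
  have h := integral_comp_measurePreserving ⟨hm, (invariant_iff hU ν).1 hν⟩ hf.measurable
  rw [← h, integral_prod _ ((hf.comp hm).integrable _)]
  rfl

theorem integral_iterate_average_of_invariant (hU : ContDiff ℝ 2 U) {ν : Measure (Phase d)}
    [IsProbabilityMeasure ν] (hν : (obaboKernel U δ γ).Invariant ν) {f : Phase d → ℝ}
    (hf : IsTest f) (n : ℕ) : ∫ z, (average U δ γ)^[n] f z ∂ν = ∫ z, f z ∂ν := by
  induction n with
  | zero => rfl
  | succ n ih =>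
    rw [Function.iterate_succ_apply', integral_average_of_invariant hU hν
      (hf.iterate_average hU δ γ n), ih]

/-- Since the Ornstein–Uhlenbeck steps preserve the Gibbs measure, one step of the chain moves Gibbs
averages no more than the Verlet step does. -/
theorem abs_integral_average_sub_gibbs_le (hU : ContDiff ℝ 2 U) (hL : 0 < L) (hm : 0 < m)
    (hLip : GradLip U L) (hConv : StrongConv U m) (hδ : 0 < δ) (hγ : 0 < γ)
    (hδL : δ ^ 2 * L ≤ 1 / 100) (hδm : δ * L / Real.sqrt m ≤ 1 / 10) {f : Phase d → ℝ}
    (hf : IsTest f) :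
    |∫ z, average U δ γ f z ∂gibbs U - ∫ z, f z ∂gibbs U| ≤ δ ^ 2 * L * d / 2 := by
  have hprob := isProbabilityMeasure_gibbs hU hm hConv
  have hδγ0 : 0 ≤ δ * γ := by positivity
  have hO := measurePreserving_stepO_gibbs hU hm hConv hδγ0
  have hstep := measurable_uncurry_obaboStep hU δ γ
  have hV := (measurePreserving_verlet hU δ).measurable
  have hfO : IsTest fun w : Phase d × E d => f (stepO δ γ w.2 w.1) := hf.comp measurable_stepO
  have hf' : IsTest fun z => ∫ g, f (stepO δ γ g z) ∂stdGaussian (E d) := hfO.integral _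
  have e1 : ∫ z, f z ∂gibbs U = ∫ z, ∫ g, f (stepO δ γ g z) ∂stdGaussian (E d) ∂gibbs U := by
    rw [← integral_comp_measurePreserving hO hf.measurable, integral_prod _ (hfO.integrable _)]
  have h1 := (measurePreserving_prodAssoc (gibbs U) (stdGaussian (E d)) (stdGaussian (E d))).symm
  have h2 : MeasurePreserving (Prod.map (fun w : Phase d × E d => stepO δ γ w.2 w.1) id)
      (((gibbs U).prod (stdGaussian (E d))).prod (stdGaussian (E d)))
      ((gibbs U).prod (stdGaussian (E d))) := hO.prod (MeasurePreserving.id _)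
  have hfV : IsTest fun w : Phase d × E d => f (stepO δ γ w.2 (verlet U δ w.1)) :=
    hfO.comp (e := fun w : Phase d × E d => (verlet U δ w.1, w.2))
      ((hV.comp measurable_fst).prodMk measurable_snd)
  have e2 : ∫ z, average U δ γ f z ∂gibbs U =
      ∫ z, ∫ g, f (stepO δ γ g (verlet U δ z)) ∂stdGaussian (E d) ∂gibbs U := by
    have h3 := integral_comp_measurePreserving (h2.comp h1) hfV.measurable
    rw [integral_prod _ (hfV.integrable _)] at h3
    rw [← h3]
    exact (integral_prod _ ((hf.comp hstep).integrable _)).symm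
  rw [e1, e2]
  exact abs_integral_verlet_sub_gibbs_le hU hL hm hLip hConv hδ hδL hδm hf'.measurable hf'.nonneg
    hf'.le_one

theorem abs_integral_iterate_average_sub_gibbs_le (hU : ContDiff ℝ 2 U) (hL : 0 < L) (hm : 0 < m)
    (hLip : GradLip U L) (hConv : StrongConv U m) (hδ : 0 < δ) (hγ : 0 < γ)
    (hδL : δ ^ 2 * L ≤ 1 / 100) (hδm : δ * L / Real.sqrt m ≤ 1 / 10) {f : Phase d → ℝ}
    (hf : IsTest f) (n : ℕ) :
    |∫ z, (average U δ γ)^[n] f z ∂gibbs U - ∫ z, f z ∂gibbs U| ≤ n * (δ ^ 2 * L * d / 2) := by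
  induction n with
  | zero => simp
  | succ n ih =>
    rw [Function.iterate_succ_apply']
    have h := abs_integral_average_sub_gibbs_le hU hL hm hLip hConv hδ hγ hδL hδm
      (hf.iterate_average hU δ γ n)
    refine (abs_sub_le _ _ _).trans ((add_le_add h ih).trans (le_of_eq ?_))
    push_cast
    ring

/-- Moving the starting point amounts to translating the noises, by amounts that do not depend on
them. -/
theorem obaboStep_eq_obaboStep_add (U : E d → ℝ) (hδ : δ ≠ 0)
    (hs : Real.sqrt (1 - eta δ γ ^ 2) ≠ 0) (z z' : Phase d) (g : E d × E d) :
    obaboStep U δ γ z' g = obaboStep U δ γ z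
      (g.1 + (Real.sqrt (1 - eta δ γ ^ 2))⁻¹ • (δ⁻¹ • (z' - z).1 + eta δ γ • (z' - z).2 -
          (δ / 2) • (∇ U z'.1 - ∇ U z.1)),
        g.2 + (Real.sqrt (1 - eta δ γ ^ 2))⁻¹ • (-(eta δ γ * δ⁻¹) • (z' - z).1)) := by
  set s := Real.sqrt (1 - eta δ γ ^ 2) with hsdef
  set η := eta δ γ with hη
  simp only [obaboStep, obaboMap, stepO, stepB, stepA, ← hsdef, ← hη, smul_add s,
    smul_inv_smul₀ hs, Prod.fst_sub, Prod.snd_sub]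
  have e1 : η • z.2 + (s • g.1 + (δ⁻¹ • (z'.1 - z.1) + η • (z'.2 - z.2) -
      (δ / 2) • (∇ U z'.1 - ∇ U z.1))) - (δ / 2) • ∇ U z.1 =
      (η • z'.2 + s • g.1 - (δ / 2) • ∇ U z'.1) + δ⁻¹ • (z'.1 - z.1) := by module
  rw [e1]
  set u := η • z'.2 + s • g.1 - (δ / 2) • ∇ U z'.1
  have e2 : z.1 + δ • (u + δ⁻¹ • (z'.1 - z.1)) = z'.1 + δ • u := by
    rw [smul_add, smul_inv_smul₀ hδ]; abel
  rw [e2]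
  ext1
  · rfl
  · simp only; module

/-- Smoothing: `P f` is Lipschitz in the twisted norm as soon as `0 ≤ f ≤ 1`. -/
theorem abs_average_sub_le (hU : ContDiff ℝ 2 U) (hL : 0 < L) (hLip : GradLip U L)
    (hγ : 2 * Real.sqrt L ≤ γ) (hδ : 0 < δ) (hδL : δ ^ 2 * L ≤ 1 / 400) {f : Phase d → ℝ}
    (hf : IsTest f) (z z' : Phase d) :
    |average U δ γ f z' - average U δ γ f z| ≤
      21 / 20 * Real.sqrt 2 / (δ * Real.sqrt (1 - eta δ γ ^ 2)) * ‖twist L γ (z' - z)‖ := by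
  have hγ0 := pos_of_two_sqrt_le hL hγ
  have hη0 : 0 < eta δ γ := Real.exp_pos _
  have hη1 : eta δ γ < 1 := Real.exp_lt_one_iff.2 (by have := mul_pos hδ hγ0; linarith)
  have hs : 0 < Real.sqrt (1 - eta δ γ ^ 2) := Real.sqrt_pos.2 (by nlinarith)
  set s := Real.sqrt (1 - eta δ γ ^ 2) with hsdef
  set η := eta δ γ with hη
  set w := z' - z with hw
  set h := s⁻¹ • (δ⁻¹ • w.1 + η • w.2 - (δ / 2) • (∇ U z'.1 - ∇ U z.1)) with hh
  set h' := s⁻¹ • (-(η * δ⁻¹) • w.1) with hh'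
  have e1 : ∀ g, f (obaboStep U δ γ z' g) = f (obaboStep U δ γ z (g.1 + h, g.2 + h')) := fun g => by
    rw [obaboStep_eq_obaboStep_add U hδ.ne' hs.ne' z z' g]
  have hz : IsTest fun g => f (obaboStep U δ γ z g) :=
    (hf.comp (measurable_uncurry_obaboStep hU δ γ)).comp measurable_prodMk_left
  have h1 := integral_comp_add_sub_le_prod hz.measurable hz.nonneg hz.le_one h h'
  unfold average
  simp_rw [e1]
  refine h1.trans ?_
  have hgrad : ‖∇ U z'.1 - ∇ U z.1‖ ≤ L * ‖w.1‖ := hLip z'.1 z.1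
  have n1 : ‖h‖ ≤ s⁻¹ * (δ⁻¹ * ‖w.1‖ + ‖w.2‖ + δ / 2 * (L * ‖w.1‖)) := by
    rw [hh, norm_smul, Real.norm_of_nonneg (inv_nonneg.2 hs.le)]
    gcongr
    refine (norm_sub_le _ _).trans (add_le_add ((norm_add_le _ _).trans ?_) ?_)
    · rw [norm_smul, norm_smul, Real.norm_of_nonneg (inv_nonneg.2 hδ.le),
        Real.norm_of_nonneg hη0.le]
      have := mul_le_mul_of_nonneg_right hη1.le (norm_nonneg w.2)
      linarith
    · rw [norm_smul, Real.norm_of_nonneg (by positivity)]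
      gcongr
  have n2 : ‖h'‖ ≤ s⁻¹ * (δ⁻¹ * ‖w.1‖) := by
    rw [hh', norm_smul, norm_smul, norm_neg, Real.norm_of_nonneg (inv_nonneg.2 hs.le),
      Real.norm_of_nonneg (by positivity)]
    gcongr
    exact mul_le_of_le_one_left (inv_nonneg.2 hδ.le) hη1.le
  have t1 := norm_fst_le_norm_twist hL hγ w
  have t2 := norm_snd_le_norm_twist hL hγ w
  set N := ‖twist L γ w‖ with hN
  have hN0 : 0 ≤ N := norm_nonneg _
  have hsL : δ * Real.sqrt L ≤ 1 / 20 := by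
    refine abs_le_of_sq_le_sq' ?_ (by norm_num) |>.2
    rw [mul_pow, Real.sq_sqrt hL.le]; linarith
  have hr2 := Real.sqrt_nonneg 2
  have key : 2 * ‖w.1‖ + δ * ‖w.2‖ + δ ^ 2 * L / 2 * ‖w.1‖ ≤ 21 / 10 * (Real.sqrt 2 * N) := by
    have q0 : 0 ≤ Real.sqrt 2 * N := by positivity
    have q1 : δ * ‖w.2‖ ≤ δ * Real.sqrt L * (Real.sqrt 2 * N) := by
      calc δ * ‖w.2‖ ≤ δ * (Real.sqrt L * (Real.sqrt 2 * N)) := by gcongr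
        _ = _ := by ring
    have q2 : δ * Real.sqrt L * (Real.sqrt 2 * N) ≤ 1 / 20 * (Real.sqrt 2 * N) := by gcongr
    have q3 : δ ^ 2 * L / 2 * ‖w.1‖ ≤ 1 / 800 * (Real.sqrt 2 * N) :=
      mul_le_mul (by linarith) t1 (norm_nonneg _) (by norm_num)
    linarith
  calc (‖h‖ + ‖h'‖) / 2
      ≤ (s⁻¹ * (δ⁻¹ * ‖w.1‖ + ‖w.2‖ + δ / 2 * (L * ‖w.1‖)) + s⁻¹ * (δ⁻¹ * ‖w.1‖)) / 2 := by gcongr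
    _ = (2 * ‖w.1‖ + δ * ‖w.2‖ + δ ^ 2 * L / 2 * ‖w.1‖) / (2 * (δ * s)) := by
        field_simp; ring
    _ ≤ 21 / 10 * (Real.sqrt 2 * N) / (2 * (δ * s)) := by gcongr
    _ = _ := by field_simp; ring

/-- The synchronous coupling propagates the smoothing with the factor `ρ` per step. -/
theorem abs_iterate_average_sub_le (hU : ContDiff ℝ 2 U) (hL : 0 < L) (hm : 0 < m) (hmL : m ≤ L)
    (hLip : GradLip U L) (hConv : StrongConv U m) (hγ : 2 * Real.sqrt L ≤ γ) (hδ : 0 < δ)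
    (hδγ : δ ≤ m / (33 * γ ^ 3)) {f : Phase d → ℝ} (hf : IsTest f) (n : ℕ) (z z' : Phase d) :
    |(average U δ γ)^[n + 1] f z' - (average U δ γ)^[n + 1] f z| ≤
      21 / 20 * Real.sqrt 2 / (δ * Real.sqrt (1 - eta δ γ ^ 2)) * rho m γ δ ^ n *
        ‖twist L γ (z' - z)‖ := by
  have hδL := step_sq_mul_lip_le hL hm hmL hγ hδ hδγ
  induction n generalizing z z' with
  | zero =>
    rw [pow_zero, mul_one]
    exact abs_average_sub_le hU hL hLip hγ hδ (by linarith) hf z z'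
  | succ n ih =>
    set C := 21 / 20 * Real.sqrt 2 / (δ * Real.sqrt (1 - eta δ γ ^ 2)) with hC
    have hC0 : 0 ≤ C := by positivity
    have hT := hf.iterate_average hU δ γ (n + 1)
    have hi : ∀ y, Integrable (fun g => (average U δ γ)^[n + 1] f (obaboStep U δ γ y g))
        ((stdGaussian (E d)).prod (stdGaussian (E d))) := fun y =>
      ((hT.comp (measurable_uncurry_obaboStep hU δ γ)).comp
        (measurable_prodMk_left (x := y))).integrable _
    rw [Function.iterate_succ_apply' _ (n + 1)]
    unfold average at hi ⊢
    rw [← integral_sub (hi z') (hi z), ← Real.norm_eq_abs]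
    refine (norm_integral_le_of_norm_le_const (C := C * rho m γ δ ^ (n + 1) * ‖twist L γ (z' - z)‖)
      (Eventually.of_forall fun g => ?_)).trans (by simp)
    refine (ih _ _).trans ?_
    have h := norm_twist_obaboMap_sub_le hU hL hm hmL hLip hConv hγ hδ hδγ z' z g.1 g.2
    calc C * rho m γ δ ^ n * ‖twist L γ (obaboStep U δ γ z' g - obaboStep U δ γ z g)‖
        ≤ C * rho m γ δ ^ n * (rho m γ δ * ‖twist L γ (z' - z)‖) :=
          mul_le_mul_of_nonneg_left h (mul_nonneg hC0 (pow_nonneg rho_nonneg n))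
      _ = _ := by ring

/-- Lipschitz observables have close averages under measures with a close coupling. -/
theorem abs_integral_sub_le_of_coupling {X Y : Type*} [NormedAddCommGroup X] [NormedSpace ℝ X]
    [MeasurableSpace X] [BorelSpace X] [SecondCountableTopology X] [NormedAddCommGroup Y]
    [NormedSpace ℝ Y] (N : X →L[ℝ] Y) {μ ν : Measure X} {ζ : Measure (X × X)}
    (hζ : ζ ∈ couplings μ ν) {f : X → ℝ} (hf : IsTest f) {K w : ℝ} (hK : 0 ≤ K) (hw : 0 ≤ w)
    (hLipf : ∀ x x', |f x' - f x| ≤ K * ‖N (x' - x)‖)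
    (hle : eLpNorm (fun q : X × X => N (q.1 - q.2)) 1 ζ ≤ ENNReal.ofReal w) :
    |∫ x, f x ∂μ - ∫ x, f x ∂ν| ≤ K * w := by
  obtain ⟨hprob, h1, h2⟩ := hζ
  have hNm : AEStronglyMeasurable (fun q : X × X => N (q.1 - q.2)) ζ :=
    (N.continuous.comp (continuous_fst.sub continuous_snd)).aestronglyMeasurable
  rw [← integral_comp_measurePreserving ⟨measurable_fst, h1⟩ hf.measurable,
    ← integral_comp_measurePreserving ⟨measurable_snd, h2⟩ hf.measurable,
    ← integral_sub ((hf.comp measurable_fst).integrable ζ) ((hf.comp measurable_snd).integrable ζ),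
    ← Real.norm_eq_abs]
  have hi : Integrable (fun q : X × X => N (q.1 - q.2)) ζ :=
    memLp_one_iff_integrable.1 ⟨hNm, hle.trans_lt ENNReal.ofReal_lt_top⟩
  refine (norm_integral_le_of_norm_le (hi.norm.const_mul K)
    (Eventually.of_forall fun q => hLipf q.2 q.1)).trans ?_
  rw [integral_const_mul, integral_norm_eq_lintegral_enorm hNm,
    ← eLpNorm_one_eq_lintegral_enorm]
  exact mul_le_mul_of_nonneg_left (ENNReal.toReal_le_of_le_ofReal hw hle) hK

end Semigroup

/-! ### Total variation bias -/

section TotalVariationBias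

variable {d : ℕ} {U : E d → ℝ} {L m γ δ : ℝ}

/-- Comparison of the events' probabilities after `n + 1` steps: the first term is the bias
accumulated by the Gibbs measure, the second one comes from smoothing and contraction. -/
theorem gibbs_real_sub_le (hU : ContDiff ℝ 2 U) (hL : 0 < L) (hm : 0 < m) (hmL : m ≤ L)
    (hLip : GradLip U L) (hConv : StrongConv U m) (hγ : 2 * Real.sqrt L ≤ γ) (hδ : 0 < δ)
    (hδγ : δ ≤ m / (33 * γ ^ 3)) {πδ : Measure (Phase d)} [IsProbabilityMeasure πδ]
    (hinv : (obaboKernel U δ γ).Invariant πδ)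
    (hmem : MemLp (fun z : Phase d => z) (ENNReal.ofReal 1) πδ) (n : ℕ) {A : Set (Phase d)}
    (hA : MeasurableSet A) :
    (gibbs U).real A ≤ πδ.real A + ((n + 1) * (δ ^ 2 * L * d / 2) +
      21 / 20 * Real.sqrt 2 / (δ * Real.sqrt (1 - eta δ γ ^ 2)) * rho m γ δ ^ n *
        (Real.sqrt (3 / 2) * max 1 (Real.sqrt L)⁻¹ *
          (δ * Real.sqrt d * (2 * K3 L m δ / kappa m γ)))) := by
  have hprob := isProbabilityMeasure_gibbs hU hm hConv
  have hγ0 := pos_of_two_sqrt_le hL hγ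
  have hκ := kappa_pos hm hγ0
  have hδL := step_sq_mul_lip_le hL hm hmL hγ hδ hδγ
  have hδm := step_mul_lip_le hL hm hmL hγ hδγ
  have hK : 0 ≤ K3 L m δ := by rw [K3]; positivity
  set C := 21 / 20 * Real.sqrt 2 / (δ * Real.sqrt (1 - eta δ γ ^ 2)) * rho m γ δ ^ n with hC
  have hC0 : 0 ≤ C := mul_nonneg (by positivity) (pow_nonneg rho_nonneg n)
  set w := Real.sqrt (3 / 2) * max 1 (Real.sqrt L)⁻¹ *
    (δ * Real.sqrt d * (2 * K3 L m δ / kappa m γ)) with hw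
  have hw0 : 0 ≤ w := by positivity
  have hf : IsTest (A.indicator fun _ : Phase d => (1 : ℝ)) :=
    ⟨measurable_const.indicator hA, fun z => Set.indicator_nonneg (fun _ _ => zero_le_one) z,
      fun z => Set.indicator_le_self' (fun _ _ => zero_le_one) z⟩
  set f := A.indicator fun _ : Phase d => (1 : ℝ) with hfdef
  have e1 : ∀ μ : Measure (Phase d), ∫ z, f z ∂μ = μ.real A := fun μ => by
    rw [hfdef, integral_indicator_const _ hA, smul_eq_mul, mul_one]
  have b1 := abs_integral_iterate_average_sub_gibbs_le hU hL hm hLip hConv hδ hγ0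
    (by linarith) (by linarith) hf (n + 1)
  have b2 : |∫ z, (average U δ γ)^[n + 1] f z ∂gibbs U -
      ∫ z, (average U δ γ)^[n + 1] f z ∂πδ| ≤ C * w := by
    -- the couplings come with an arbitrarily small excess `ε`
    have hε : ∀ ε : ℝ, 0 < ε → |∫ z, (average U δ γ)^[n + 1] f z ∂gibbs U -
        ∫ z, (average U δ γ)^[n + 1] f z ∂πδ| ≤ C * (w + ε) := fun ε hε => by
      obtain ⟨ζ, hζ, hle⟩ := exists_coupling_twist_le hU hL hm hmL hLip hConv hγ hδ hδγ hinv
        le_rfl hmem (ε := ENNReal.ofReal ε) (by simpa using hε)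
      rw [max_eq_right (by norm_num : (1 : ℝ) - 2 ≤ 0), add_zero, ← hw,
        ← ENNReal.ofReal_add hw0 hε.le, ENNReal.ofReal_one] at hle
      exact abs_integral_sub_le_of_coupling (twist L γ) hζ (hf.iterate_average hU δ γ (n + 1)) hC0
        (by linarith)
        (abs_iterate_average_sub_le hU hL hm hmL hLip hConv hγ hδ hδγ hf n) hle
    have hlim : Tendsto (fun ε : ℝ => C * (w + ε)) (𝓝[>] 0) (𝓝 (C * (w + 0))) :=
      (Continuous.tendsto (by fun_prop) 0).mono_left nhdsWithin_le_nhds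
    rw [add_zero] at hlim
    exact ge_of_tendsto hlim (eventually_mem_nhdsWithin.mono fun ε hε' => hε ε hε')
  rw [integral_iterate_average_of_invariant hU hinv hf] at b2
  rw [e1] at b1 b2
  have c1 := (abs_le.1 b1).1
  have c2 := (abs_le.1 b2).2
  push_cast at c1
  linarith

theorem lip_le_K4 (hL : 0 < L) (hm : 0 < m) (hδ : 0 < δ) : L ≤ K4 L m δ := by
  have h1 : 1 ≤ 1 + δ / 4 + δ ^ 2 * L / 4 := by
    have : 0 ≤ δ / 4 + δ ^ 2 * L / 4 := by positivity
    linarith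
  have h2 : 1 ≤ 1 + δ * L / Real.sqrt m + δ ^ 2 * L ^ 2 / (4 * m) := by
    have : 0 ≤ δ * L / Real.sqrt m + δ ^ 2 * L ^ 2 / (4 * m) := by positivity
    linarith
  have h3 : 0 ≤ δ * L ^ 2 / m := by positivity
  have h4 : L * 1 * 1 ≤ L * (1 + δ / 4 + δ ^ 2 * L / 4) *
      (1 + δ * L / Real.sqrt m + δ ^ 2 * L ^ 2 / (4 * m)) := by gcongr
  rw [K4]
  linarith

/-- The smoothing constant is below what `K₁` and `K₂` allow. Only `2` of the maximum in `K₂` and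
one of the two factors `max (√L) (1/√L)` in `K₁²` are needed. -/
theorem smoothing_constant_le (hL : 0 < L) (hδ : 0 < δ)
    (hη : 0 < 1 - eta δ γ ^ 2) :
    21 / 10 * Real.sqrt 3 * max 1 (Real.sqrt L)⁻¹ * (Real.sqrt δ / Real.sqrt (1 - eta δ γ ^ 2)) ≤
      2 * (K1 L ^ 2 * K2 L γ δ) := by
  have hs := Real.sqrt_pos.2 hL
  set M := max 1 (Real.sqrt L)⁻¹ with hM
  set r := Real.sqrt δ / Real.sqrt (1 - eta δ γ ^ 2) with hr
  have hr0 : 0 ≤ r := by positivity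
  have hM1 : 1 ≤ M := le_max_left _ _
  have hK1 : 3 * M ≤ K1 L ^ 2 := by
    rw [K1, mul_pow, Real.sq_sqrt (by norm_num)]
    have h : M ≤ max (Real.sqrt L) (Real.sqrt L)⁻¹ ^ 2 := by
      rcases le_total 1 (Real.sqrt L) with h | h
      · rw [hM, max_eq_left (inv_le_one_of_one_le₀ h)]
        exact one_le_pow₀ (h.trans (le_max_left _ _))
      · have h' : 1 ≤ (Real.sqrt L)⁻¹ := (one_le_inv₀ hs).2 h
        rw [hM, max_eq_right h', max_eq_right (h.trans h')]
        exact le_self_pow₀ h' two_ne_zero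
    linarith
  have hK2 : r * (200 / 251) ≤ K2 L γ δ := by
    have h1 : Real.sqrt (δ / (2 * Real.pi * (1 - eta δ γ ^ 2))) = r / Real.sqrt (2 * Real.pi) := by
      rw [Real.sqrt_div hδ.le, Real.sqrt_mul (by positivity), hr]
      field_simp
    -- `2π < 6.3 < 2.51²`
    have h2 : Real.sqrt (2 * Real.pi) ≤ 251 / 100 := by
      rw [Real.sqrt_le_left (by norm_num)]
      have := Real.pi_lt_d2
      linarith
    have h3 : (2 : ℝ) ≤ max (2 + 3 * δ ^ 2 * L / 2) (3 * δ) := by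
      refine le_max_of_le_left ?_
      have : 0 ≤ 3 * δ ^ 2 * L / 2 := by positivity
      linarith
    rw [K2, h1]
    calc r * (200 / 251) = r / (251 / 100) * 2 := by ring
      _ ≤ r / Real.sqrt (2 * Real.pi) * max (2 + 3 * δ ^ 2 * L / 2) (3 * δ) := by gcongr
  have h3 : Real.sqrt 3 ≤ 7 / 4 := by
    rw [Real.sqrt_le_left (by norm_num)]; norm_num
  calc 21 / 10 * Real.sqrt 3 * M * r ≤ 21 / 10 * (7 / 4) * M * r := by gcongr
    _ ≤ 2 * (3 * M * (r * (200 / 251))) := by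
        have : 0 ≤ M * r := by positivity
        linarith
    _ ≤ _ := by gcongr

theorem tvNorm_gibbs_le (hd : 1 ≤ d) (hU : ContDiff ℝ 2 U) (hL : 0 < L) (hm : 0 < m) (hmL : m ≤ L)
    (hLip : GradLip U L) (hConv : StrongConv U m) (hγ : 2 * Real.sqrt L ≤ γ) (hδ : 0 < δ)
    (hδγ : δ ≤ m / (33 * γ ^ 3)) {πδ : Measure (Phase d)} [IsProbabilityMeasure πδ]
    (hinv : (obaboKernel U δ γ).Invariant πδ)
    (hmem : MemLp (fun z : Phase d => z) (ENNReal.ofReal 1) πδ) :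
    tvNorm (gibbs U) πδ ≤ ENNReal.ofReal
      (δ * d * (2 + |Real.log (δ ^ 3 * d)|) *
        (2 * K1 L ^ 2 * K2 L γ δ * K3 L m δ / (kappa m γ * Real.sqrt (1 - δ * kappa m γ)) +
          K4 L m δ / kappa m γ)) := by
  have hprob := isProbabilityMeasure_gibbs hU hm hConv
  have hγ0 := pos_of_two_sqrt_le hL hγ
  have hκ := kappa_pos hm hγ0
  have hδκ := step_mul_kappa_le hL hm hmL hγ hδγ
  have hK3 : 0 ≤ K3 L m δ := by rw [K3]; positivity
  have hd0 : (0 : ℝ) < d := by exact_mod_cast hd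
  have hη : 0 < 1 - eta δ γ ^ 2 := by
    have hη0 : 0 < eta δ γ := Real.exp_pos _
    have hη1 : eta δ γ < 1 := Real.exp_lt_one_iff.2 (by have := mul_pos hδ hγ0; linarith)
    nlinarith
  have hρ0 : 0 < rho m γ δ := Real.sqrt_pos.2 (by linarith)
  set κ := kappa m γ with hκdef
  set ρ := rho m γ δ with hρdef
  set ℓ := |Real.log (δ ^ 3 * d)| with hℓ
  have hℓ0 : 0 ≤ ℓ := abs_nonneg _
  -- `n + 1` steps contract by a factor at most `√(δ³ d)`, and their bias adds up to at most
  -- `δ d (2 + ℓ) L / (2κ)`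
  set n := ⌊ℓ / (δ * κ)⌋₊ with hn
  have hn1 : ℓ ≤ (n + 1) * (δ * κ) := by
    have := (Nat.lt_floor_add_one (ℓ / (δ * κ))).le
    rwa [div_le_iff₀ (by positivity)] at this
  have hn2 : (n + 1) * (δ * κ) ≤ 2 + ℓ := by
    have := Nat.floor_le (div_nonneg hℓ0 (by positivity : 0 ≤ δ * κ))
    rw [← hn, le_div_iff₀ (by positivity)] at this
    linarith
  have hpow : ρ ^ (n + 1) ≤ Real.sqrt (δ ^ 3 * d) := by
    refine Real.le_sqrt_of_sq_le ?_
    rw [← pow_mul, mul_comm, pow_mul, rho_sq hL hm hmL hγ hδγ]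
    have h1 : 1 - δ * κ ≤ Real.exp (-(δ * κ)) := Real.one_sub_le_exp_neg _
    calc (1 - δ * κ) ^ (n + 1) ≤ Real.exp (-(δ * κ)) ^ (n + 1) :=
          pow_le_pow_left₀ (by linarith) h1 _
      _ = Real.exp (-((n + 1) * (δ * κ))) := by
          rw [← Real.exp_nat_mul]; congr 1; push_cast; ring
      _ ≤ Real.exp (Real.log (δ ^ 3 * d)) := by
          refine Real.exp_le_exp.2 ?_
          have := neg_abs_le (Real.log (δ ^ 3 * d))
          linarith
      _ = δ ^ 3 * d := Real.exp_log (by positivity)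
  have hsq : Real.sqrt (δ ^ 3 * d) * Real.sqrt d = δ * Real.sqrt δ * d := by
    rw [Real.sqrt_mul (by positivity), mul_assoc, Real.mul_self_sqrt hd0.le,
      show δ ^ 3 = δ ^ 2 * δ by ring, Real.sqrt_mul (by positivity), Real.sqrt_sq hδ.le]
  refine (tvNorm_le fun A hA => gibbs_real_sub_le hU hL hm hmL hLip hConv hγ hδ hδγ hinv hmem n
    hA).trans (ENNReal.ofReal_le_ofReal ?_)
  rw [← hκdef, ← hρdef]
  have p1 : (n + 1) * (δ ^ 2 * L * d) ≤ δ * d * (2 + ℓ) * (K4 L m δ / κ) := by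
    calc (n + 1) * (δ ^ 2 * L * d) = (n + 1) * (δ * κ) * (δ * d * (L / κ)) := by field_simp
      _ ≤ (2 + ℓ) * (δ * d * (K4 L m δ / κ)) := by
          gcongr
          exact lip_le_K4 hL hm hδ
      _ = _ := by ring
  have h23 : Real.sqrt 2 * Real.sqrt (3 / 2) = Real.sqrt 3 := by
    rw [← Real.sqrt_mul zero_le_two]; norm_num
  set s := Real.sqrt (1 - eta δ γ ^ 2) with hs
  have hs0 : 0 < s := Real.sqrt_pos.2 hη
  set M := max 1 (Real.sqrt L)⁻¹ with hM
  have hM0 : 0 < M := lt_of_lt_of_le one_pos (le_max_left _ _)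
  have p2 : 2 * (21 / 20 * Real.sqrt 2 / (δ * s) * ρ ^ n *
      (Real.sqrt (3 / 2) * M * (δ * Real.sqrt d * (2 * K3 L m δ / κ)))) ≤
      δ * d * (2 + ℓ) * (2 * K1 L ^ 2 * K2 L γ δ * K3 L m δ / (κ * ρ)) := by
    have hc := smoothing_constant_le (γ := γ) hL hδ hη
    calc 2 * (21 / 20 * Real.sqrt 2 / (δ * s) * ρ ^ n *
          (Real.sqrt (3 / 2) * M * (δ * Real.sqrt d * (2 * K3 L m δ / κ))))
        = 21 / 10 * (Real.sqrt 2 * Real.sqrt (3 / 2)) * M / s * (ρ ^ (n + 1) * Real.sqrt d) *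
          (2 * K3 L m δ / (κ * ρ)) := by
          rw [pow_succ]; field_simp; ring
      _ ≤ 21 / 10 * Real.sqrt 3 * M / s * (Real.sqrt (δ ^ 3 * d) * Real.sqrt d) *
          (2 * K3 L m δ / (κ * ρ)) := by
          rw [h23]; gcongr
      _ = 21 / 10 * Real.sqrt 3 * M * (Real.sqrt δ / s) * (δ * d * (2 * K3 L m δ / (κ * ρ))) := by
          rw [hsq]; ring
      _ ≤ 2 * (K1 L ^ 2 * K2 L γ δ) * (δ * d * (2 * K3 L m δ / (κ * ρ))) := by gcongr
      _ = δ * d * 2 * (2 * K1 L ^ 2 * K2 L γ δ * K3 L m δ / (κ * ρ)) := by ring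
      _ ≤ δ * d * (2 + ℓ) * (2 * K1 L ^ 2 * K2 L γ δ * K3 L m δ / (κ * ρ)) := by
          have hK2 : 0 ≤ K2 L γ δ := by rw [K2]; positivity
          gcongr
          linarith
  have e : Real.sqrt (1 - δ * κ) = ρ := rfl
  rw [e, mul_add (δ * d * (2 + ℓ))]
  linarith

end TotalVariationBias

/-! ### Limits of the constants -/

theorem tendsto_K3 (L m : ℝ) : Tendsto (fun s : ℝ => K3 L m s) (𝓝[>] 0) (𝓝 L) := by
  have hc : Continuous fun s : ℝ => K3 L m s := by
    unfold K3; fun_prop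
  have h := hc.tendsto 0
  have e : K3 L m 0 = L := by simp [K3]
  rw [e] at h
  exact h.mono_left nhdsWithin_le_nhds

theorem tendsto_K4 (L m : ℝ) : Tendsto (fun s : ℝ => K4 L m s) (𝓝[>] 0) (𝓝 L) := by
  have hc : Continuous fun s : ℝ => K4 L m s := by
    unfold K4; fun_prop
  have h := hc.tendsto 0
  have e : K4 L m 0 = L := by simp [K4]
  rw [e] at h
  exact h.mono_left nhdsWithin_le_nhds

end OBABO

end

theorem mainTheorem6 {d : ℕ} (hd : 1 ≤ d) (U : OBABO.E d → ℝ) (hU : ContDiff ℝ 2 U)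
    (L m γ δ : ℝ) (hL : 0 < L) (hm : 0 < m)
    (hLip : OBABO.GradLip U L) (hConv : OBABO.StrongConv U m)
    (hγ : 2 * Real.sqrt L ≤ γ) (hδ : 0 < δ) (hδγ : δ ≤ m / (33 * γ ^ 3)) :
    (∃ πδ : Measure (OBABO.Phase d),
      -- `πδ` is the unique invariant probability measure of the chain
      (IsProbabilityMeasure πδ ∧ (OBABO.obaboKernel U δ γ).Invariant πδ ∧
        ∀ ν : Measure (OBABO.Phase d), IsProbabilityMeasure ν →
          (OBABO.obaboKernel U δ γ).Invariant ν → ν = πδ) ∧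
      -- Wasserstein bias
      (∀ p : ℝ, 1 ≤ p →
        OBABO.MemPp p (OBABO.gibbs U) ∧ OBABO.MemPp p πδ ∧
        OBABO.wasserstein p (OBABO.gibbs U) πδ ≤ ENNReal.ofReal
          (δ * Real.sqrt (d + max (p - 2) 0) *
            (2 * OBABO.K1 L * OBABO.K3 L m δ / OBABO.kappa m γ))) ∧
      -- total variation bias
      OBABO.tvNorm (OBABO.gibbs U) πδ ≤ ENNReal.ofReal
        (δ * d * (2 + |Real.log (δ ^ 3 * d)|) *
          (2 * OBABO.K1 L ^ 2 * OBABO.K2 L γ δ * OBABO.K3 L m δ /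
              (OBABO.kappa m γ * Real.sqrt (1 - δ * OBABO.kappa m γ)) +
            OBABO.K4 L m δ / OBABO.kappa m γ))) ∧
    -- limits of the constants as the step size vanishes
    Tendsto (fun s : ℝ => OBABO.K3 L m s) (𝓝[>] 0) (𝓝 L) ∧
    Tendsto (fun s : ℝ => OBABO.K4 L m s) (𝓝[>] 0) (𝓝 L) := by
  have hmL := OBABO.strongConv_le_lip hd hLip hConv
  obtain ⟨πδ, hprob, hinv, huniq, hmem⟩ :=
    OBABO.exists_invariant hU hL hm hmL hLip hConv hγ hδ hδγ
  have hprob' := OBABO.isProbabilityMeasure_gibbs hU hm hConv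
  have hmem' : ∀ p : ℝ, 1 ≤ p → MemLp (fun z : OBABO.Phase d => z) (ENNReal.ofReal p) πδ :=
    fun p hp => hmem _ (by simpa using hp) ENNReal.ofReal_ne_top
  exact ⟨⟨πδ, ⟨hprob, hinv, huniq⟩,
    fun p hp => ⟨OBABO.memPp_of_memLp hp (OBABO.memLp_gibbs hU hm hConv hp),
      OBABO.memPp_of_memLp hp (hmem' p hp),
      OBABO.wasserstein_gibbs_le hU hL hm hmL hLip hConv hγ hδ hδγ hinv hp (hmem' p hp)⟩,
    OBABO.tvNorm_gibbs_le hd hU hL hm hmL hLip hConv hγ hδ hδγ hinv (hmem' 1 le_rfl)⟩,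
    OBABO.tendsto_K3 L m, OBABO.tendsto_K4 L m⟩
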